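/- **Setting.** Particle $j\in\{1,2\}$ has position space $\mathbb R^{d_j}$ and internal space $\mathbb C^{n_j}$ ($n_j=1$: spinless; $d_j=0$: a finite-dimensional system), Hilbert space $\mathcal H_j=L^2(\mathbb R^{d_j},\mathbb C^{n_j})$ and domain $\mathcal D_j=\mathcal S(\mathbb R^{d_j},\mathbb C^{n_j})$ (Schwartz functions). Its attributes are the symmetric elements of the O$^*$-algebra $\mathcal A_j$ of operators on $\mathcal D_j$ generated by the positions $\hat Q_i$, the momenta $\hat P_i=-i\hbar\partial_i$ and the internal operators. The pair has Hilbert space $\mathcal H_{12}=\mathcal H_1\otimes\mathcal H_2$ and domain $\mathcal D_{12}=\mathcal S(\mathbb R^{d_1}\times\mathbb R^{d_2},\mathbb C^{n_1}\otimes\mathbb C^{n_2})$. A (smooth) state of a system with domain $\mathcal D$ is a density operator $\rho=\sum_n|\varphi_n\rangle\langle\varphi_n|$ of trace $1$ with $\varphi_n\in\mathcal D$ and $\sum_n p(\varphi_n)^2<\infty$ for every continuous seminorm $p$ on $\mathcal D$. A condition of particle $j$ is a non-empty subset of its state space that is open in the topology generated by the sets $\{\sigma:|\mathrm{Tr}\,\sigma\hat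 A-\mathrm{Tr}\,\rho\hat A|<\varepsilon\}$ ($\hat A$ an attribute, $\rho$ a state, $\varepsilon>0$) and the sets $\nu(\rho;\delta)=\{\sigma:\mathrm{Tr}|\sigma-\rho|<\delta\}$ ($\delta>0$). The qr-number value $a|_W$ of $\hat A$ at a set $W$ of states is the function $\rho\mapsto\mathrm{Tr}\,\rho\hat A$ on $W$. A set $W$ of states of the pair is a *product condition* if every $\rho\in W$, with reduced states (partial traces) $\tilde\rho_1,\tilde\rho_2$, satisfies $\mathrm{Tr}\,\rho(\hat A\otimes\hat B)=\mathrm{Tr}\,\tilde\rho_1\hat A\cdot\mathrm{Tr}\,\tilde\rho_2\hat B$ for all attributes $\hat A$ of particle 1 and $\hat B$ of particle 2, that is, $(a\otimes b)|_W=a|_{\tilde W_1}\,b|_{\tilde W_2}$, where $\tilde W_j$ are the reduced conditions. It is *entangled* if it is not a product condition. Let $K_j$ be a symmetric operator on $\mathcal D_j$ (the Hamiltonian of particle $j$ without interaction) and let the interaction $V$ be a symmetric operator on $\mathcal D_{12}$; all operators on the domains are linear, continuous in the Schwartz topology, and leave the domain invariant. The interaction is *separable* if $V=V_1\otimes\hat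 I+\hat I\otimes V_2$ with symmetric operators $V_j$ on $\mathcal D_j$. Suppose that the total Hamiltonian $H=K_1\otimes\hat I+\hat I\otimes K_2+V$ generates a one-parameter unitary group $\hat U_t=e^{-itH/\hbar}$ of $\mathcal H_{12}$ that acts on $\mathcal D_{12}$ by continuous operators and satisfies the Schrödinger equation there: $\frac1t(\hat U_t\psi-\psi)\to-\frac i\hbar H\psi$ in $\mathcal D_{12}$ as $t\to0$, for all $\psi\in\mathcal D_{12}$. For conditions $W_1,W_2$ of the two particles, let the pair be prepared in $W(0)=W_1\otimes W_2=\{\rho_1\otimes\rho_2:\rho_j\in W_j\}$, and let $W(t)=\hat U_tW(0)\hat U_t^*$. **Theorem.** (i) If $V$ is separable, then $W(t)$ is a product condition for all $t\in\mathbb R$ and all $W_1,W_2$. (ii) If $V$ is not separable, then the joint condition becomes entangled: there is $p>0$ such that, for all $W_1,W_2$, $W(t)$ is entangled for every $t\in\mathbb R$ that is not an integer multiple of $p$ (in particular for all $0<t<p$). -/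

import Mathlib

open MeasureTheory Filter Topology Set
open scoped SchwartzMap ENNReal LineDeriv InnerProductSpace

noncomputable section

namespace QR

/-! ### One quantum system on a configuration space

`E` is the configuration space and `F` the (finite-dimensional) internal space of a system.  Its
Hilbert space is `L²(E, F)`; the common dense domain of its attributes is the Schwartz space
`𝓢(E, F)`. -/

section System

variable (E F : Type*) [NormedAddCommGroup E] [NormedSpace ℝ E] [FiniteDimensional ℝ E]
  [MeasureSpace E] [BorelSpace E] [(volume : Measure E).IsAddHaarMeasure]
  [NormedAddCommGroup F] [InnerProductSpace ℂ F]

/-- The Hilbert space of the system. -/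
abbrev L2 := Lp F 2 (volume : Measure E)

/-- Operators on the common dense domain `𝓢(E, F)` that leave it invariant. -/
abbrev Op := 𝓢(E, F) →L[ℂ] 𝓢(E, F)

variable {E F}

/-- The inclusion of the common dense domain in the Hilbert space. -/
def ket : 𝓢(E, F) →L[ℂ] L2 E F := SchwartzMap.toLpCLM ℂ F 2 (volume : Measure E)

/-- `A` is symmetric (Hermitian) on the common dense domain. -/
def IsSymm (A : Op E F) : Prop :=
  ∀ φ ψ : 𝓢(E, F), ⟪ket (A φ), ket ψ⟫_ℂ = ⟪ket φ, ket (A ψ)⟫_ℂ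

/-- A sequence of (unnormalised) vectors of the domain whose mixture `ρ = ∑ |φ n⟩⟨φ n|` is a density
operator of trace one for which all the traces `Tr A ρ B`, with `A`, `B` operators on the domain,
converge absolutely.  (The topology of the Schwartz space is that of the norms `‖A φ‖`, with `A` in
the algebra generated by positions and momenta, so it is enough that `Tr A* A ρ` is finite for
these `A`.) -/
structure IsSmoothEnsemble (φ : ℕ → 𝓢(E, F)) : Prop where
  summable : ∀ p : Seminorm ℂ 𝓢(E, F), Continuous p → Summable fun n => p (φ n) ^ 2
  trace_one : HasSum (fun n => ‖ket (φ n)‖ ^ 2) 1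

variable (E F) in
/-- The smooth state space: density operators `ρ = ∑ |φ n⟩⟨φ n|` of trace one for which all
operators on the domain have finite expectation `Tr ρ A`. -/
@[ext]
structure State where
  op : L2 E F →L[ℂ] L2 E F
  exists_ensemble : ∃ φ : ℕ → 𝓢(E, F), IsSmoothEnsemble φ ∧
    ∀ ξ : L2 E F, HasSum (fun n => ⟪ket (φ n), ξ⟫_ℂ • ket (φ n)) (op ξ)

/-- The expectation `Tr ρ A = ∑ ⟨φ n, A φ n⟩`, where `ρ = ∑ |φ n⟩⟨φ n|`.  For symmetric `A` it does
not depend on the decomposition of `ρ`, see `State.expect_eq`. -/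
def State.expect (ρ : State E F) (A : Op E F) : ℂ :=
  ∑' n, ⟪ket (ρ.exists_ensemble.choose n), ket (A (ρ.exists_ensemble.choose n))⟫_ℂ

section Expect

set_option linter.unusedSectionVars false

variable [CompleteSpace F]

theorem summable_norm_ket {φ : ℕ → 𝓢(E, F)} (hφ : IsSmoothEnsemble φ) (A : Op E F) :
    Summable fun n => ‖ket (A (φ n))‖ ^ 2 :=
  hφ.summable ((normSeminorm ℂ (L2 E F)).comp
    ((ket ∘L A : 𝓢(E, F) →L[ℂ] L2 E F) : 𝓢(E, F) →ₗ[ℂ] L2 E F))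
    (continuous_norm.comp (ket ∘L A : 𝓢(E, F) →L[ℂ] L2 E F).continuous)

/-- The mixture `∑ |v n⟩⟨v n|`. -/
theorem exists_mixture (v : ℕ → L2 E F) (hv : Summable fun n => ‖v n‖ ^ 2) :
    ∃ T : L2 E F →L[ℂ] L2 E F, ∀ ξ η, HasSum (fun n => ⟪η, v n⟫_ℂ * ⟪v n, ξ⟫_ℂ) ⟪η, T ξ⟫_ℂ := by
  have hs : Summable fun n => (InnerProductSpace.rankOne ℂ (v n) (v n) : L2 E F →L[ℂ] L2 E F) := by
    refine Summable.of_norm ?_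
    simpa [InnerProductSpace.norm_rankOne, ← pow_two] using hv
  refine ⟨∑' n, InnerProductSpace.rankOne ℂ (v n) (v n), fun ξ η => ?_⟩
  have := (hs.hasSum.mapL (ContinuousLinearMap.apply ℂ (L2 E F) ξ)).mapL (innerSL ℂ η)
  simpa [mul_comm] using this

theorem tsum_norm_eq_of_mixture {v : ℕ → L2 E F} {T : L2 E F →L[ℂ] L2 E F}
    (hv : Summable fun n => ‖v n‖ ^ 2)
    (hT : ∀ ξ η, HasSum (fun n => ⟪η, v n⟫_ℂ * ⟪v n, ξ⟫_ℂ) ⟪η, T ξ⟫_ℂ)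
    {κ : Type*} (b : HilbertBasis κ ℂ (L2 E F)) :
    ENNReal.ofReal (∑' n, ‖v n‖ ^ 2) = ∑' k, ENNReal.ofReal (⟪b k, T (b k)⟫_ℂ).re := by
  have hre : ∀ (u w : L2 E F), (⟪w, u⟫_ℂ * ⟪u, w⟫_ℂ).re = ‖⟪u, w⟫_ℂ‖ ^ 2 := by
    intro u w
    rw [← inner_conj_symm w u, ← Complex.normSq_eq_conj_mul_self, Complex.ofReal_re,
      Complex.normSq_eq_norm_sq]
  rw [ENNReal.ofReal_tsum_of_nonneg (fun _ => by positivity) hv]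
  have h1 : ∀ n, ENNReal.ofReal (‖v n‖ ^ 2) = ∑' k, ENNReal.ofReal (‖⟪v n, b k⟫_ℂ‖ ^ 2) := by
    intro n
    have h := Complex.hasSum_re (b.hasSum_inner_mul_inner (v n) (v n))
    have h' : HasSum (fun k => ‖⟪v n, b k⟫_ℂ‖ ^ 2) (‖v n‖ ^ 2) := by
      convert! h using 1
      · funext k
        rw [mul_comm, hre]
      · rw [inner_self_eq_norm_sq_to_K]
        norm_cast
    rw [← h'.tsum_eq, ENNReal.ofReal_tsum_of_nonneg (fun _ => by positivity) h'.summable]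
  have h2 : ∀ k, ENNReal.ofReal (⟪b k, T (b k)⟫_ℂ).re =
      ∑' n, ENNReal.ofReal (‖⟪v n, b k⟫_ℂ‖ ^ 2) := by
    intro k
    have h := Complex.hasSum_re (hT (b k) (b k))
    simp only [hre] at h
    rw [← h.tsum_eq, ENNReal.ofReal_tsum_of_nonneg (fun _ => by positivity) h.summable]
  simp_rw [h1, h2]
  exact ENNReal.tsum_comm

theorem tsum_norm_ket_eq {φ ψ : ℕ → 𝓢(E, F)} (hφ : IsSmoothEnsemble φ) (hψ : IsSmoothEnsemble ψ)
    {ρ : L2 E F →L[ℂ] L2 E F}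
    (h₁ : ∀ ξ : L2 E F, HasSum (fun n => ⟪ket (φ n), ξ⟫_ℂ • ket (φ n)) (ρ ξ))
    (h₂ : ∀ ξ : L2 E F, HasSum (fun n => ⟪ket (ψ n), ξ⟫_ℂ • ket (ψ n)) (ρ ξ))
    {A : Op E F} (hA : IsSymm A) :
    ∑' n, ‖ket (A (φ n))‖ ^ 2 = ∑' n, ‖ket (A (ψ n))‖ ^ 2 := by
  have dense : DenseRange (ket : 𝓢(E, F) → L2 E F) :=
    SchwartzMap.denseRange_toLpCLM (by norm_num)
  have key : ∀ (φ : ℕ → 𝓢(E, F)) (T : L2 E F →L[ℂ] L2 E F),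
      (∀ ξ : L2 E F, HasSum (fun n => ⟪ket (φ n), ξ⟫_ℂ • ket (φ n)) (ρ ξ)) →
      (∀ ξ η, HasSum (fun n => ⟪η, ket (A (φ n))⟫_ℂ * ⟪ket (A (φ n)), ξ⟫_ℂ) ⟪η, T ξ⟫_ℂ) →
      ∀ s s', ⟪ket s', T (ket s)⟫_ℂ = ⟪ket (A s'), ρ (ket (A s))⟫_ℂ := by
    intro φ T h hT s s'
    refine (hT (ket s) (ket s')).unique ?_
    have := (h (ket (A s))).mapL (innerSL ℂ (ket (A s')))
    have e : ∀ n, ⟪ket s', ket (A (φ n))⟫_ℂ * ⟪ket (A (φ n)), ket s⟫_ℂ =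
        ⟪ket (φ n), ket (A s)⟫_ℂ * ⟪ket (A s'), ket (φ n)⟫_ℂ := by
      intro n
      rw [hA (φ n) s, ← hA s' (φ n), mul_comm]
    simp only [e]
    simpa using this
  obtain ⟨T, hT⟩ := exists_mixture _ (summable_norm_ket hφ A)
  obtain ⟨S, hS⟩ := exists_mixture _ (summable_norm_ket hψ A)
  have hTS : T = S := by
    refine ContinuousLinearMap.ext fun ξ => ?_
    refine dense.induction_on (p := fun ξ => T ξ = S ξ) ξ
      (isClosed_eq T.continuous S.continuous) fun s => ?_
    refine ext_inner_left ℂ fun η => ?_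
    refine dense.induction_on (p := fun η => ⟪η, T (ket s)⟫_ℂ = ⟪η, S (ket s)⟫_ℂ) η
      (isClosed_eq (by fun_prop) (by fun_prop)) fun s' => ?_
    rw [key φ T h₁ hT, key ψ S h₂ hS]
  subst hTS
  obtain ⟨w, b, -⟩ := exists_hilbertBasis ℂ (L2 E F)
  have := (tsum_norm_eq_of_mixture (summable_norm_ket hφ A) hT b).trans
    (tsum_norm_eq_of_mixture (summable_norm_ket hψ A) hS b).symm
  rwa [ENNReal.ofReal_eq_ofReal_iff (tsum_nonneg fun _ => by positivity)
    (tsum_nonneg fun _ => by positivity)] at this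

/-- The expectation of a symmetric operator may be computed from any decomposition of the state. -/
theorem State.expect_eq (ρ : State E F) {A : Op E F} (hA : IsSymm A) {φ : ℕ → 𝓢(E, F)}
    (hφ : IsSmoothEnsemble φ)
    (h : ∀ ξ : L2 E F, HasSum (fun n => ⟪ket (φ n), ξ⟫_ℂ • ket (φ n)) (ρ.op ξ)) :
    ρ.expect A = ∑' n, ⟪ket (φ n), ket (A (φ n))⟫_ℂ := by
  have hadd : IsSymm (A + 1) := fun φ ψ => by
    simp [inner_add_left, inner_add_right, hA φ ψ]
  have hsub : IsSymm (A - 1) := fun φ ψ => by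
    simp [inner_sub_left, inner_sub_right, hA φ ψ]
  have pol : ∀ s : 𝓢(E, F), ⟪ket s, ket (A s)⟫_ℂ =
      ((4⁻¹ * (‖ket ((A + 1) s)‖ ^ 2 - ‖ket ((A - 1) s)‖ ^ 2) : ℝ) : ℂ) := by
    intro s
    have e1 := inner_self_eq_norm_sq_to_K (𝕜 := ℂ) (ket ((A + 1) s))
    have e2 := inner_self_eq_norm_sq_to_K (𝕜 := ℂ) (ket ((A - 1) s))
    simp only [add_apply, sub_apply, one_apply_eq_self, map_add, map_sub, inner_add_left, inner_add_right,
      inner_sub_left, inner_sub_right, hA s s, Complex.coe_algebraMap] at e1 e2 ⊢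
    push_cast
    rw [← e1, ← e2]
    ring
  have val : ∀ φ : ℕ → 𝓢(E, F), IsSmoothEnsemble φ → ∑' n, ⟪ket (φ n), ket (A (φ n))⟫_ℂ =
      ((4⁻¹ * (∑' n, ‖ket ((A + 1) (φ n))‖ ^ 2 - ∑' n, ‖ket ((A - 1) (φ n))‖ ^ 2) : ℝ) : ℂ) := by
    intro φ hφ
    rw [← (summable_norm_ket hφ _).tsum_sub (summable_norm_ket hφ _), ← tsum_mul_left,
      Complex.ofReal_tsum]
    exact tsum_congr fun n => pol _
  obtain ⟨hψ, hs⟩ := ρ.exists_ensemble.choose_spec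
  rw [State.expect, val _ hψ, val _ hφ, tsum_norm_ket_eq hψ hφ hs h hadd,
    tsum_norm_ket_eq hψ hφ hs h hsub]

end Expect

/-- The qr-number value `a|_W` of an attribute `A` at the condition `W`: the real function
`ρ ↦ Tr ρ A` on `W`. -/
def qrValue (A : Op E F) (W : Set (State E F)) : W → ℝ := fun ρ => (ρ.1.expect A).re

/-- The trace norm `Tr |T|` of a bounded operator. -/
def traceNorm (T : L2 E F →L[ℂ] L2 E F) : ℝ≥0∞ :=
  ⨆ (n : ℕ) (e : Fin n → L2 E F) (f : Fin n → L2 E F) (_ : Orthonormal ℂ e)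
    (_ : Orthonormal ℂ f), ∑ i, ‖⟪e i, T (f i)⟫_ℂ‖ₑ

/-- The basic set `ν(ρ; δ)` of the states within trace-norm distance `δ` of `ρ`. -/
def nu (ρ : State E F) (δ : ℝ) : Set (State E F) :=
  {σ | traceNorm (σ.op - ρ.op) < ENNReal.ofReal δ}

/-- The set `𝒩(ρ; A; ε)` of the states at which the value of `A` is `ε`-close to the value at
`ρ`. -/
def scrN (ρ : State E F) (A : Op E F) (ε : ℝ) : Set (State E F) :=
  {σ | ‖σ.expect A - ρ.expect A‖ < ε}

/-- The Hamiltonian `H` generates a unitary one-parameter group `exp (-i t H / ℏ)` of the Hilbert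
space, which acts on the domain of the attributes by continuous operators and whose orbits in that
domain solve the Schrödinger equation. -/
structure Evolution (ħ : ℝ) (H : Op E F) where
  unitary : ℝ → (L2 E F ≃ₗᵢ[ℂ] L2 E F)
  smooth : ℝ → Op E F
  ket_smooth : ∀ (t : ℝ) (ψ : 𝓢(E, F)), ket (smooth t ψ) = unitary t (ket ψ)
  zero : ∀ ξ, unitary 0 ξ = ξ
  add : ∀ (s t : ℝ) (ξ), unitary (s + t) ξ = unitary s (unitary t ξ)
  schroedinger : ∀ ψ : 𝓢(E, F),
    Tendsto (fun t : ℝ => ((t : ℂ)⁻¹) • (smooth t ψ - ψ)) (𝓝[≠] 0)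
      (𝓝 ((-(Complex.I / (ħ : ℂ))) • H ψ))

/-- The evolution of states: `ρ ↦ U(t) ρ U(t)*`. -/
def Evolution.evolve {ħ : ℝ} {H : Op E F} (𝒰 : Evolution ħ H) (t : ℝ) (ρ : State E F) :
    State E F where
  op := ((𝒰.unitary t).toContinuousLinearEquiv : L2 E F →L[ℂ] L2 E F) ∘L ρ.op ∘L
    ((𝒰.unitary t).symm.toContinuousLinearEquiv : L2 E F →L[ℂ] L2 E F)
  exists_ensemble := by
    obtain ⟨φ, hφ, hs⟩ := ρ.exists_ensemble
    refine ⟨fun n => 𝒰.smooth t (φ n), ⟨fun p hp => ?_, ?_⟩, fun ξ => ?_⟩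
    · exact hφ.summable (p.comp (𝒰.smooth t : 𝓢(E, F) →ₗ[ℂ] 𝓢(E, F)))
        (hp.comp (𝒰.smooth t).continuous)
    · simpa [𝒰.ket_smooth] using hφ.trace_one
    · have h := (hs ((𝒰.unitary t).symm ξ)).mapL
        ((𝒰.unitary t).toContinuousLinearEquiv : L2 E F →L[ℂ] L2 E F)
      have key : ∀ n, ⟪𝒰.unitary t (ket (φ n)), ξ⟫_ℂ = ⟪ket (φ n), (𝒰.unitary t).symm ξ⟫_ℂ := by
        intro n
        rw [← (𝒰.unitary t).inner_map_map (ket (φ n)) ((𝒰.unitary t).symm ξ),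
          LinearIsometryEquiv.apply_symm_apply]
      simpa [𝒰.ket_smooth, key] using h

end System

/-! ### One particle -/

section Particle

/-- The physical space `ℝ^d`. -/
abbrev Pos (d : ℕ) := EuclideanSpace ℝ (Fin d)

/-- The internal space `ℂ^n` (`n = 1` for a spinless particle). -/
abbrev Spin (n : ℕ) := EuclideanSpace ℂ (Fin n)

variable {d n : ℕ}

/-- The position operator `Q i`: multiplication by the `i`th coordinate. -/
def positionOp (i : Fin d) : Op (Pos d) (Spin n) :=
  SchwartzMap.smulLeftCLM (Spin n) fun x : Pos d => ((x i : ℝ) : ℂ)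

/-- The momentum operator `P i = -iℏ ∂_i`. -/
def momentumOp (ħ : ℝ) (i : Fin d) : Op (Pos d) (Spin n) :=
  (-(Complex.I * (ħ : ℂ))) •
    LineDeriv.lineDerivOpCLM ℂ 𝓢(Pos d, Spin n) (EuclideanSpace.single i (1 : ℝ))

/-- The operator on wave functions given by an operator on the internal space. -/
def spinOp (M : Spin n →L[ℂ] Spin n) : Op (Pos d) (Spin n) := SchwartzMap.postcompCLM M

/-- The O*-algebra of a particle: the algebra of operators on `𝓢(ℝ^d, ℂ^n)` generated by the
positions, the momenta and the internal operators. -/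
def particleAlgebra (ħ : ℝ) (d n : ℕ) : Subalgebra ℂ (Op (Pos d) (Spin n)) :=
  Algebra.adjoin ℂ
    (Set.range positionOp ∪ Set.range (momentumOp ħ) ∪ Set.range spinOp)

/-- The physical attributes of a particle. -/
def IsAttribute (ħ : ℝ) (A : Op (Pos d) (Spin n)) : Prop :=
  A ∈ particleAlgebra ħ d n ∧ IsSymm A

/-- The topology of the smooth state space of a particle: it is generated by the sets `𝒩(ρ; A; ε)`,
where `A` is an attribute, and the sets `ν(ρ; δ)`. -/
@[reducible]
def stateTopology (ħ : ℝ) (d n : ℕ) : TopologicalSpace (State (Pos d) (Spin n)) :=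
  TopologicalSpace.generateFrom
    ({W | ∃ ρ A ε, IsAttribute ħ A ∧ 0 < ε ∧ W = scrN ρ A ε} ∪
      {W | ∃ ρ δ, 0 < δ ∧ W = nu ρ δ})

/-- A condition of a particle: a non-empty open subset of its smooth state space. -/
def IsCondition (ħ : ℝ) (W : Set (State (Pos d) (Spin n))) : Prop :=
  IsOpen[stateTopology ħ d n] W ∧ W.Nonempty

end Particle

/-! ### Two particles -/

section TwoParticles

variable {d₁ n₁ d₂ n₂ : ℕ}

/-- The configuration space of the two-particle system. -/
abbrev Pos₂ (d₁ d₂ : ℕ) := Pos d₁ × Pos d₂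

/-- The internal space `ℂ^n₁ ⊗ ℂ^n₂` of the two-particle system, so that
`L²(ℝ^d₁ × ℝ^d₂, ℂ^n₁ ⊗ ℂ^n₂)` is the tensor product of the Hilbert spaces of the particles. -/
abbrev Spin₂ (n₁ n₂ : ℕ) := EuclideanSpace ℂ (Fin n₁ × Fin n₂)

instance (d₁ d₂ : ℕ) : (volume : Measure (Pos₂ d₁ d₂)).IsAddHaarMeasure := by
  rw [Measure.volume_eq_prod]
  infer_instance

theorem norm_spin_mul (v : Spin n₁) (w : Spin n₂) :
    ‖(WithLp.toLp 2 fun ij => v ij.1 * w ij.2 : Spin₂ n₁ n₂)‖ = ‖v‖ * ‖w‖ := by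
  rw [EuclideanSpace.norm_eq, EuclideanSpace.norm_eq, EuclideanSpace.norm_eq,
    ← Real.sqrt_mul (by positivity), Finset.sum_mul_sum, Fintype.sum_prod_type]
  simp [mul_pow]

/-- The tensor product `ℂ^n₁ × ℂ^n₂ → ℂ^n₁ ⊗ ℂ^n₂` of internal vectors. -/
def spinTensor (n₁ n₂ : ℕ) : Spin n₁ →L[ℝ] Spin n₂ →L[ℝ] Spin₂ n₁ n₂ :=
  LinearMap.mkContinuous₂
    (LinearMap.mk₂ ℝ (fun v w => (WithLp.toLp 2 fun ij => v ij.1 * w ij.2 : Spin₂ n₁ n₂))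
      (fun _ _ _ => by ext; simp [add_mul]) (fun _ _ _ => by ext; simp [mul_assoc])
      (fun _ _ _ => by ext; simp [mul_add]) (fun _ _ _ => by ext; simp [mul_left_comm])) 1
    (fun v w => by simpa using (norm_spin_mul v w).le)

/-- The product wave function `(φ ⊗ χ)(x, y) = φ x ⊗ χ y`. -/
def tensor (φ : 𝓢(Pos d₁, Spin n₁)) (χ : 𝓢(Pos d₂, Spin n₂)) :
    𝓢(Pos₂ d₁ d₂, Spin₂ n₁ n₂) where
  toFun z := WithLp.toLp 2 fun ij => φ z.1 ij.1 * χ z.2 ij.2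
  smooth' := by
    change ContDiff ℝ _ fun z : Pos₂ d₁ d₂ => spinTensor n₁ n₂ (φ z.1) (χ z.2)
    exact ((spinTensor n₁ n₂).contDiff.comp ((φ.smooth _).comp contDiff_fst)).clm_apply
      ((χ.smooth _).comp contDiff_snd)
  decay' := by
    intro k n
    choose a ha using fun i => φ.decay k i
    choose a' ha' using fun i => φ.decay 0 i
    choose b hb using fun i => χ.decay k i
    choose b' hb' using fun i => χ.decay 0 i
    refine ⟨‖spinTensor n₁ n₂‖ * ∑ i ∈ Finset.range (n + 1),
      (n.choose i : ℝ) * (a i * b' (n - i) + a' i * b (n - i)), fun z => ?_⟩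
    have h1 : ∀ i, ‖iteratedFDeriv ℝ i (fun z : Pos₂ d₁ d₂ => φ z.1) z‖ ≤
        ‖iteratedFDeriv ℝ i φ z.1‖ := by
      intro i
      have := (ContinuousLinearMap.fst ℝ (Pos d₁) (Pos d₂)).iteratedFDeriv_comp_right
        (φ.smooth i) z le_rfl
      change ‖iteratedFDeriv ℝ i (φ ∘ ContinuousLinearMap.fst ℝ (Pos d₁) (Pos d₂)) z‖ ≤ _
      rw [this]
      refine (ContinuousMultilinearMap.norm_compContinuousLinearMap_le _ _).trans ?_
      refine mul_le_of_le_one_right (norm_nonneg _) ?_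
      exact Finset.prod_le_one (fun _ _ => norm_nonneg _)
        (fun _ _ => ContinuousLinearMap.norm_fst_le ..)
    have h2 : ∀ i, ‖iteratedFDeriv ℝ i (fun z : Pos₂ d₁ d₂ => χ z.2) z‖ ≤
        ‖iteratedFDeriv ℝ i χ z.2‖ := by
      intro i
      have := (ContinuousLinearMap.snd ℝ (Pos d₁) (Pos d₂)).iteratedFDeriv_comp_right
        (χ.smooth i) z le_rfl
      change ‖iteratedFDeriv ℝ i (χ ∘ ContinuousLinearMap.snd ℝ (Pos d₁) (Pos d₂)) z‖ ≤ _
      rw [this]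
      refine (ContinuousMultilinearMap.norm_compContinuousLinearMap_le _ _).trans ?_
      refine mul_le_of_le_one_right (norm_nonneg _) ?_
      exact Finset.prod_le_one (fun _ _ => norm_nonneg _)
        (fun _ _ => ContinuousLinearMap.norm_snd_le ..)
    have h3 := (spinTensor n₁ n₂).norm_iteratedFDeriv_le_of_bilinear
      (f := fun z : Pos₂ d₁ d₂ => φ z.1) (g := fun z : Pos₂ d₁ d₂ => χ z.2) (N := n)
      ((φ.smooth _).comp contDiff_fst) ((χ.smooth _).comp contDiff_snd) z le_rfl
    have hz : ‖z‖ ^ k ≤ ‖z.1‖ ^ k + ‖z.2‖ ^ k := by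
      rcases le_total ‖z.1‖ ‖z.2‖ with h | h
      · rw [Prod.norm_def, max_eq_right h]
        exact le_add_of_nonneg_left (by positivity)
      · rw [Prod.norm_def, max_eq_left h]
        exact le_add_of_nonneg_right (by positivity)
    refine (mul_le_mul_of_nonneg_left h3 (by positivity)).trans ?_
    rw [mul_left_comm, Finset.mul_sum]
    refine mul_le_mul_of_nonneg_left (Finset.sum_le_sum fun i _ => ?_)
      (ContinuousLinearMap.opNorm_nonneg _)
    rw [mul_assoc, mul_left_comm]
    refine mul_le_mul_of_nonneg_left ?_ (by positivity)
    have A := (ha i).2 z.1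
    have A' := (ha' i).2 z.1
    have B := (hb (n - i)).2 z.2
    have B' := (hb' (n - i)).2 z.2
    simp only [pow_zero, one_mul] at A' B'
    calc ‖z‖ ^ k * (‖iteratedFDeriv ℝ i (fun z : Pos₂ d₁ d₂ => φ z.1) z‖ *
          ‖iteratedFDeriv ℝ (n - i) (fun z : Pos₂ d₁ d₂ => χ z.2) z‖)
        ≤ (‖z.1‖ ^ k + ‖z.2‖ ^ k) *
          (‖iteratedFDeriv ℝ i φ z.1‖ * ‖iteratedFDeriv ℝ (n - i) χ z.2‖) := by
          gcongr
          · exact h1 i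
          · exact h2 _
      _ = (‖z.1‖ ^ k * ‖iteratedFDeriv ℝ i φ z.1‖) * ‖iteratedFDeriv ℝ (n - i) χ z.2‖ +
          ‖iteratedFDeriv ℝ i φ z.1‖ * (‖z.2‖ ^ k * ‖iteratedFDeriv ℝ (n - i) χ z.2‖) := by
          ring
      _ ≤ _ := by
          have p1 : 0 ≤ ‖z.1‖ ^ k * ‖iteratedFDeriv ℝ i φ z.1‖ := by positivity
          have p2 : 0 ≤ ‖iteratedFDeriv ℝ i φ z.1‖ := norm_nonneg _
          gcongr
          · exact p1.trans A
          · exact p2.trans A'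

/-- `C = A ⊗ B`: the symmetric operator on the domain with `C (φ ⊗ χ) = A φ ⊗ B χ`.  (There is at
most one, as the span of the product wave functions is dense.) -/
def IsTensorOp (A : Op (Pos d₁) (Spin n₁)) (B : Op (Pos d₂) (Spin n₂))
    (C : Op (Pos₂ d₁ d₂) (Spin₂ n₁ n₂)) : Prop :=
  IsSymm C ∧ ∀ φ χ, C (tensor φ χ) = tensor (A φ) (B χ)

/-- `C = A ⊗ I + I ⊗ B`. -/
def IsSumOp (A : Op (Pos d₁) (Spin n₁)) (B : Op (Pos d₂) (Spin n₂))
    (C : Op (Pos₂ d₁ d₂) (Spin₂ n₁ n₂)) : Prop :=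
  IsSymm C ∧ ∀ φ χ, C (tensor φ χ) = tensor (A φ) χ + tensor φ (B χ)

/-- A potential is separable if `V = V₁ ⊗ I + I ⊗ V₂` with a potential `V₁` for particle 1 and a
potential `V₂` for particle 2. -/
def IsSeparable (V : Op (Pos₂ d₁ d₂) (Spin₂ n₁ n₂)) : Prop :=
  ∃ (V₁ : Op (Pos d₁) (Spin n₁)) (V₂ : Op (Pos d₂) (Spin n₂)),
    IsSymm V₁ ∧ IsSymm V₂ ∧ IsSumOp V₁ V₂ V

/-- `ρ = ρ₁ ⊗ ρ₂`. -/
def IsTensorState (ρ₁ : State (Pos d₁) (Spin n₁)) (ρ₂ : State (Pos d₂) (Spin n₂))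
    (ρ : State (Pos₂ d₁ d₂) (Spin₂ n₁ n₂)) : Prop :=
  ∀ φ φ' χ χ', ⟪ket (tensor φ' χ'), ρ.op (ket (tensor φ χ))⟫_ℂ =
    ⟪ket φ', ρ₁.op (ket φ)⟫_ℂ * ⟪ket χ', ρ₂.op (ket χ)⟫_ℂ

/-- `W₁ ⊗ W₂ = {ρ₁ ⊗ ρ₂ | ρ₁ ∈ W₁, ρ₂ ∈ W₂}`. -/
def tensorCondition (W₁ : Set (State (Pos d₁) (Spin n₁))) (W₂ : Set (State (Pos d₂) (Spin n₂))) :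
    Set (State (Pos₂ d₁ d₂) (Spin₂ n₁ n₂)) :=
  {ρ | ∃ ρ₁ ∈ W₁, ∃ ρ₂ ∈ W₂, IsTensorState ρ₁ ρ₂ ρ}

/-- An orthonormal basis of the Hilbert space of a particle, with vectors in the domain. -/
def IsOrthonormalBasis {d n : ℕ} {κ : Type} (s : κ → 𝓢(Pos d, Spin n)) : Prop :=
  Orthonormal ℂ (fun k => ket (s k)) ∧
    (Submodule.span ℂ (Set.range fun k => ket (s k))).topologicalClosure = ⊤

/-- `ρ₁` is the reduced state of `ρ` for particle 1: the partial trace of `ρ` over an orthonormal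
basis of the Hilbert space of particle 2. -/
def IsReduced₁ (ρ : State (Pos₂ d₁ d₂) (Spin₂ n₁ n₂)) (ρ₁ : State (Pos d₁) (Spin n₁)) : Prop :=
  ∀ (κ : Type) (s : κ → 𝓢(Pos d₂, Spin n₂)), IsOrthonormalBasis s → ∀ φ φ',
    HasSum (fun k => ⟪ket (tensor φ' (s k)), ρ.op (ket (tensor φ (s k)))⟫_ℂ)
      ⟪ket φ', ρ₁.op (ket φ)⟫_ℂ

/-- `ρ₂` is the reduced state of `ρ` for particle 2. -/
def IsReduced₂ (ρ : State (Pos₂ d₁ d₂) (Spin₂ n₁ n₂)) (ρ₂ : State (Pos d₂) (Spin n₂)) : Prop :=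
  ∀ (κ : Type) (s : κ → 𝓢(Pos d₁, Spin n₁)), IsOrthonormalBasis s → ∀ χ χ',
    HasSum (fun k => ⟪ket (tensor (s k) χ'), ρ.op (ket (tensor (s k) χ))⟫_ℂ)
      ⟪ket χ', ρ₂.op (ket χ)⟫_ℂ

/-- The reduced condition of `W` for particle 1. -/
def reduced₁ (W : Set (State (Pos₂ d₁ d₂) (Spin₂ n₁ n₂))) : Set (State (Pos d₁) (Spin n₁)) :=
  {ρ₁ | ∃ ρ ∈ W, IsReduced₁ ρ ρ₁}

/-- The reduced condition of `W` for particle 2. -/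
def reduced₂ (W : Set (State (Pos₂ d₁ d₂) (Spin₂ n₁ n₂))) : Set (State (Pos d₂) (Spin n₂)) :=
  {ρ₂ | ∃ ρ ∈ W, IsReduced₂ ρ ρ₂}

/-- `W` is a product condition: for all attributes `A` of particle 1 and `B` of particle 2 the
qr-number value of `A ⊗ B` at `W` is the product of the values of `A` and `B` at the reduced
conditions.  The qr-numbers are compared as functions on `W`: a state `ρ` in `W` is paired with its
(unique) reduced states. -/
def IsProductCondition (ħ : ℝ) (W : Set (State (Pos₂ d₁ d₂) (Spin₂ n₁ n₂))) : Prop :=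
  ∀ ρ : W, ∃ (ρ₁ : reduced₁ W) (ρ₂ : reduced₂ W), IsReduced₁ ρ.1 ρ₁.1 ∧ IsReduced₂ ρ.1 ρ₂.1 ∧
    ∀ (A : Op (Pos d₁) (Spin n₁)) (B : Op (Pos d₂) (Spin n₂)) (C : Op (Pos₂ d₁ d₂) (Spin₂ n₁ n₂)),
      IsAttribute ħ A → IsAttribute ħ B → IsTensorOp A B C →
      qrValue C W ρ = qrValue A (reduced₁ W) ρ₁ * qrValue B (reduced₂ W) ρ₂

/-- `W` is an entangled condition: it is not a product condition. -/
def IsEntangled (ħ : ℝ) (W : Set (State (Pos₂ d₁ d₂) (Spin₂ n₁ n₂))) : Prop :=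
  ¬ IsProductCondition ħ W

end TwoParticles

end QR

end

/-!
The proof compares two independent copies of the pair. Let `S` be the operator that exchanges the
second particles of the copies, `S (a ⊗ b ⊗ c ⊗ d) = a ⊗ d ⊗ c ⊗ b`, and let
`exchForm p q w z = ⟨p ⊗ q, S (w ⊗ z)⟩` be its form on product vectors of the two copies. The two
copies evolve by `U t ⊗ U t`. Call a time `t` *preserving* if `U t ⊗ U t` commutes with `S`, and
*swapping* if it carries `S` to the exchange of the first particles (`Preserves`, `Swaps`). The
theorem follows from three facts.

* The interaction is separable if and only if all times are preserving. If `H = H₁ ⊗ I + I ⊗ H₂`,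
  then `S` commutes with `H ⊗ I + I ⊗ H`, so that the evolved exchange form has derivative zero
  (`evolvedExchForm_of_sumOp`). Conversely, if the form is constant, its derivative at time `0` says
  that `S` commutes with `H ⊗ I + I ⊗ H`, and contraction of this identity with unit vectors splits
  `H` into a sum of operators of the two particles (`exists_sum_of_evolvedExchForm`).

* At a preserving time `U t (a ⊗ b) = U₁ a ⊗ U₂ b`, since the matrix elements of `U t` between
  product vectors are of rank one; hence product states evolve to product states, and expectations
  multiply in these (`Preserves.exists_factor`, `IsTensorState.expect_mul`).

* If the pair is in a product condition at time `t`, then `t` is preserving or swapping. A condition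
  is open, so it contains small mixtures of its states with arbitrary pure states. The product rule
  for expectations in the evolved mixtures is a polynomial identity in the weight, hence holds for
  all evolved product vectors `U t (a ⊗ b)` (`re_inner_mul_of_isProductCondition`). In terms of the
  evolved attributes `α = U* (A ⊗ I) U` and `β = U* (I ⊗ B) U` it reads `⟨α⟩ ⟨β⟩ = ⟨α β⟩` in all
  product vectors; polarization and the absence of zero divisors among sesquilinear forms show that
  for each particle `α` or `β` does not act on it (`actsOn_of_expect_mul`, `orthogonal_dichotomy`).
  So the attributes of each particle evolve to observables of the same particle, or all of them to
  observables of the other one. Then the evolved exchange form has the same commutation relations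
  with the attributes of the four particles as `exchForm`, and Schur's lemma for the positions, the
  momenta and the internal operators, applied to each of the four factors, determines it up to a
  constant, which is one (`exists_eq_mul_inner`, `exists_eq_mul_exchForm`, `preserves_or_swaps`).

Preserving and swapping times together form a closed subgroup of the real line. If it were the whole
line, every `t = t / 2 + t / 2` would be preserving and the interaction separable. Otherwise the
subgroup is cyclic, and its generator is the period `p` (`exists_period`).

Vectors of the Hilbert spaces are handled through their Schwartz representatives: `box` is the
tensor product of Schwartz functions, and its adjoint `contr`, the contraction with a Schwartz
function, maps the domain of the pair to that of a particle. This allows identities on the domain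
to be checked on product functions, whose span is dense in the Hilbert space (`dense_span_box`).
-/

open scoped ContDiff

noncomputable section

namespace QR

/-! ### Sesquilinear forms -/

section Forms

variable {V H F G : Type*} [AddCommGroup V] [Module ℂ V] [NormedAddCommGroup H]
  [InnerProductSpace ℂ H] [AddCommGroup F] [Module ℂ F] [AddCommGroup G] [Module ℂ G]

/-- A sesquilinear map that vanishes on orthogonal pairs is a multiple of the inner product. -/
theorem eq_inner_smul_of_orthogonal (j : V →ₗ[ℂ] H) (a : V →ₗ⋆[ℂ] V →ₗ[ℂ] F)
    (h : ∀ w v, ⟪j w, j v⟫_ℂ = 0 → a w v = 0) {e : V} (he : ‖j e‖ = 1) (w v : V) :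
    a w v = ⟪j w, j v⟫_ℂ • a e e := by
  have hee : ⟪j e, j e⟫_ℂ = 1 := by
    rw [inner_self_eq_norm_sq_to_K, he]
    simp
  have key : ∀ w v : V, ⟪j e, j w⟫_ℂ = 0 → ⟪j e, j v⟫_ℂ = 0 → a w v = ⟪j w, j v⟫_ℂ • a e e := by
    intro w v hw hv
    have hw' : ⟪j w, j e⟫_ℂ = 0 := inner_eq_zero_symm.1 hw
    -- For `v`, `w` orthogonal to `e`, the vectors `⟨v, w⟩ e + w` and `e - v` are orthogonal.
    have := h (⟪j v, j w⟫_ℂ • e + w) (e - v) (by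
      simp only [map_add, map_sub, map_smul, inner_add_left, inner_sub_right, inner_smul_left, hee,
        hv, hw', inner_conj_symm]
      ring)
    simp only [map_add, map_sub, LinearMap.add_apply, map_smulₛₗ, LinearMap.smul_apply,
      h e v hv, h w e hw', inner_conj_symm] at this
    rw [smul_zero, add_zero, zero_add, sub_eq_zero] at this
    exact this.symm
  have dec : ∀ x : V, ⟪j e, j (x - ⟪j e, j x⟫_ℂ • e)⟫_ℂ = 0 := by
    intro x
    simp only [map_sub, map_smul, inner_sub_right, inner_smul_right, hee]
    ring
  have h1 := key _ _ (dec w) (dec v)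
  have h2 := h e _ (dec v)
  have h3 := h _ e (inner_eq_zero_symm.1 (dec w))
  simp only [map_sub, map_smulₛₗ, LinearMap.sub_apply, LinearMap.smul_apply, inner_sub_left,
    inner_sub_right, inner_smul_left, inner_smul_right, hee, inner_conj_symm, RingHom.id_apply]
    at h1 h2 h3
  rw [sub_eq_zero] at h2 h3
  rw [h2, h3, sub_self, smul_zero, sub_zero, sub_eq_iff_eq_add] at h1
  rw [h1, smul_smul, ← add_smul]
  congr 1
  ring

/-- Polarization: a relation between products of two sesquilinear forms, valid on the diagonal,
holds for all pairs of vectors. Both sides have degree two in `w` and in `v`. -/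
theorem mul_eq_mul_of_diag (f₁ f₂ f₃ f₄ : V →ₗ⋆[ℂ] V →ₗ[ℂ] ℂ)
    (h : ∀ v, f₁ v v * f₂ v v = f₃ v v * f₄ v v) (w v : V) :
    f₁ w v * f₂ w v = f₃ w v * f₄ w v := by
  -- The values at `v ± w` and `v ± i w` isolate the terms that are of degree two in `w` in one of
  -- the arguments only; replacing `w` by `(1 + i) w` then separates the two remaining terms.
  have key : ∀ w v : V, f₁ v w * f₂ v w + f₁ w v * f₂ w v = f₃ v w * f₄ v w + f₃ w v * f₄ w v := by
    intro w v
    have h1 := h (v + w)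
    have h2 := h (v - w)
    have h3 := h (v + Complex.I • w)
    have h4 := h (v - Complex.I • w)
    simp only [map_add, map_sub, map_smulₛₗ, LinearMap.add_apply, LinearMap.sub_apply,
      LinearMap.smul_apply, Complex.conj_I, smul_eq_mul, RingHom.id_apply] at h1 h2 h3 h4
    have hI := Complex.I_sq
    linear_combination (1 / 4 : ℂ) * (h1 + h2 - h3 - h4) +
      ((1 / 2 : ℂ) * (f₁ v w * f₂ v w - f₁ v w * f₂ w v - f₁ w v * f₂ v w + f₁ w v * f₂ w v
        - f₁ v v * f₂ w w - f₁ w w * f₂ v v + (Complex.I ^ 2 - 1) * (f₁ w w * f₂ w w)) -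
      (1 / 2 : ℂ) * (f₃ v w * f₄ v w - f₃ v w * f₄ w v - f₃ w v * f₄ v w + f₃ w v * f₄ w v
        - f₃ v v * f₄ w w - f₃ w w * f₄ v v + (Complex.I ^ 2 - 1) * (f₃ w w * f₄ w w))) * hI
  have h1 := key w v
  have h2 := key ((1 + Complex.I) • w) v
  simp only [map_smulₛₗ, LinearMap.smul_apply, smul_eq_mul, RingHom.id_apply, map_add, map_one,
    Complex.conj_I] at h2
  linear_combination (1 / 2 : ℂ) * h1 + (Complex.I / 4) * h2 +
    ((1 / 2 - Complex.I / 4) * (f₁ w v * f₂ w v - f₃ w v * f₄ w v) -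
      (1 / 2 + Complex.I / 4) * (f₁ v w * f₂ v w - f₃ v w * f₄ v w)) * Complex.I_sq

/-- A group is not the union of two proper subgroups, for kernels. -/
theorem forall_eq_zero_or_forall_eq_zero {M A B : Type*} [AddGroup M] [AddGroup A] [AddGroup B]
    (f : M → A) (g : M → B) (hf : ∀ x y, f (x + y) = f x + f y)
    (hg : ∀ x y, g (x + y) = g x + g y) (h : ∀ x, f x = 0 ∨ g x = 0) :
    (∀ x, f x = 0) ∨ ∀ x, g x = 0 := by
  by_contra! hc
  obtain ⟨⟨x, hx⟩, ⟨y, hy⟩⟩ := hc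
  have hx' := (h x).resolve_left hx
  have hy' := (h y).resolve_right hy
  rcases h (x + y) with h' | h'
  · rw [hf, hy', add_zero] at h'
    exact hx h'
  · rw [hg, hx', zero_add] at h'
    exact hy h'

/-- If the product of two sesquilinear forms vanishes, one of them vanishes: in each argument, the
space is the union of two kernels, so that one of these is the whole space. -/
theorem eq_zero_or_eq_zero_of_mul (f g : V →ₗ⋆[ℂ] V →ₗ[ℂ] ℂ) (h : ∀ w v, f w v * g w v = 0) :
    f = 0 ∨ g = 0 := by
  have h1 : ∀ w, f w = 0 ∨ g w = 0 := fun w => by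
    rcases forall_eq_zero_or_forall_eq_zero (f w) (g w) (map_add _) (map_add _)
      (fun v => mul_eq_zero.1 (h w v)) with h' | h'
    · exact Or.inl (LinearMap.ext h')
    · exact Or.inr (LinearMap.ext h')
  rcases forall_eq_zero_or_forall_eq_zero f g (map_add _) (map_add _) h1 with h' | h'
  · exact Or.inl (LinearMap.ext h')
  · exact Or.inr (LinearMap.ext h')

/-- Call `v` an eigenvector of the sesquilinear map `a` if `a w v = 0` for all `w` orthogonal to
`v`. If `x` and two generic combinations of `x` and `y` are eigenvectors of `a`, then so is `y`. -/
theorem eigenvector_of_three (j : V →ₗ[ℂ] H) (hj : Function.Injective j)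
    (a : V →ₗ⋆[ℂ] V →ₗ[ℂ] F) {x y : V} {p q p' q' : ℂ} (hq : q ≠ 0) (hq' : q' ≠ 0)
    (hpq : p * q' ≠ p' * q)
    (h₀ : ∀ w, ⟪j w, j x⟫_ℂ = 0 → a w x = 0)
    (h₁ : ∀ w, ⟪j w, j (p • x + q • y)⟫_ℂ = 0 → a w (p • x + q • y) = 0)
    (h₂ : ∀ w, ⟪j w, j (p' • x + q' • y)⟫_ℂ = 0 → a w (p' • x + q' • y) = 0) :
    ∀ w, ⟪j w, j y⟫_ℂ = 0 → a w y = 0 := by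
  -- An eigenvector has an eigenvalue `l`, which is a vector of the target of `a`.
  have eig : ∀ v : V, (∀ w, ⟪j w, j v⟫_ℂ = 0 → a w v = 0) →
      ∃ l : F, ∀ w, a w v = ⟪j w, j v⟫_ℂ • l := by
    intro v hv
    by_cases h0 : v = 0
    · exact ⟨0, fun w => by simp [h0]⟩
    have hn : ⟪j v, j v⟫_ℂ ≠ 0 := by
      rw [Ne, inner_self_eq_zero, map_eq_zero_iff j hj]
      exact h0
    refine ⟨(⟪j v, j v⟫_ℂ)⁻¹ • a v v, fun w => ?_⟩
    have := hv (w - (⟪j v, j w⟫_ℂ / ⟪j v, j v⟫_ℂ) • v) (by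
      rw [map_sub, map_smul, inner_sub_left, inner_smul_left, map_div₀, inner_conj_symm,
        inner_conj_symm, div_mul_cancel₀ _ hn, sub_self])
    simp only [map_sub, map_smulₛₗ, LinearMap.sub_apply, LinearMap.smul_apply, map_div₀,
      inner_conj_symm, sub_eq_zero] at this
    rw [this, smul_smul, div_eq_mul_inv]
  obtain ⟨l, hl⟩ := eig _ h₀
  obtain ⟨m, hm⟩ := eig _ h₁
  obtain ⟨m', hm'⟩ := eig _ h₂
  -- The two combinations give two expressions for `a w y`, whose comparison shows that all
  -- eigenvalues agree unless `w ⊥ y` implies `w ⊥ x`.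
  have e1 : ∀ w, a w y = ⟪j w, j y⟫_ℂ • m + (⟪j w, j x⟫_ℂ * (p / q)) • (m - l) := by
    intro w
    have := hm w
    simp only [map_add, map_smul, hl w, inner_add_right, inner_smul_right] at this
    have h' : q • a w y = q • (⟪j w, j y⟫_ℂ • m + (⟪j w, j x⟫_ℂ * (p / q)) • (m - l)) := by
      rw [eq_sub_of_add_eq' this]
      simp only [smul_add, smul_sub, smul_smul, add_smul]
      rw [show q * (⟪j w, j x⟫_ℂ * (p / q)) = p * ⟪j w, j x⟫_ℂ by field_simp]
      abel
    exact smul_right_injective F hq h'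
  have e2 : ∀ w, a w y = ⟪j w, j y⟫_ℂ • m' + (⟪j w, j x⟫_ℂ * (p' / q')) • (m' - l) := by
    intro w
    have := hm' w
    simp only [map_add, map_smul, hl w, inner_add_right, inner_smul_right] at this
    have h' : q' • a w y = q' • (⟪j w, j y⟫_ℂ • m' + (⟪j w, j x⟫_ℂ * (p' / q')) • (m' - l)) := by
      rw [eq_sub_of_add_eq' this]
      simp only [smul_add, smul_sub, smul_smul, add_smul]
      rw [show q' * (⟪j w, j x⟫_ℂ * (p' / q')) = p' * ⟪j w, j x⟫_ℂ by field_simp]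
      abel
    exact smul_right_injective F hq' h'
  intro w hw
  by_cases hwx : ⟪j w, j x⟫_ℂ = 0
  · rw [e1, hw, hwx]
    simp
  have hb : (p / q) • (m - l) = (p' / q') • (m' - l) := by
    have := (e1 w).symm.trans (e2 w)
    simp only [hw, zero_smul, zero_add, mul_smul] at this
    exact smul_right_injective F hwx this
  by_cases hy : y = 0
  · simp [hy]
  have hm : m = m' := by
    have := (e1 y).symm.trans (e2 y)
    simp only [mul_smul, hb] at this
    refine smul_right_injective F (r := ⟪j y, j y⟫_ℂ) ?_ (add_right_cancel this)
    rw [Ne, inner_self_eq_zero, map_eq_zero_iff j hj]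
    exact hy
  subst hm
  have h0 : (p / q - p' / q') • (m - l) = 0 := by rw [sub_smul, hb, sub_self]
  have h1 : p / q - p' / q' ≠ 0 := by
    rw [sub_ne_zero, Ne, div_eq_div_iff hq hq']
    exact hpq
  rw [e1, hw, (smul_eq_zero.1 h0).resolve_left h1]
  simp

/-- If for each orthogonal pair one of two sesquilinear maps vanishes, then one of them vanishes on
all orthogonal pairs: each vector is an eigenvector of one of them, and eigenvectors on a line
propagate. -/
theorem orthogonal_dichotomy (j : V →ₗ[ℂ] H) (hj : Function.Injective j)
    (a : V →ₗ⋆[ℂ] V →ₗ[ℂ] F) (b : V →ₗ⋆[ℂ] V →ₗ[ℂ] G)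
    (h : ∀ w v, ⟪j w, j v⟫_ℂ = 0 → a w v = 0 ∨ b w v = 0) :
    (∀ w v, ⟪j w, j v⟫_ℂ = 0 → a w v = 0) ∨ (∀ w v, ⟪j w, j v⟫_ℂ = 0 → b w v = 0) := by
  have h1 : ∀ v, (∀ w, ⟪j w, j v⟫_ℂ = 0 → a w v = 0) ∨ (∀ w, ⟪j w, j v⟫_ℂ = 0 → b w v = 0) := by
    intro v
    by_contra! hc
    obtain ⟨⟨w₁, o₁, n₁⟩, ⟨w₂, o₂, n₂⟩⟩ := hc
    have z₁ := (h w₁ v o₁).resolve_left n₁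
    have z₂ := (h w₂ v o₂).resolve_right n₂
    rcases h (w₁ + w₂) v (by simp [o₁, o₂]) with h' | h'
    · simp [z₂, n₁] at h'
    · simp [z₁, n₂] at h'
  by_contra! hc
  obtain ⟨⟨w₁, v₁, o₁, n₁⟩, ⟨w₂, v₂, o₂, n₂⟩⟩ := hc
  have b₁ := (h1 v₁).resolve_left fun h' => n₁ (h' w₁ o₁)
  have a₂ := (h1 v₂).resolve_right fun h' => n₂ (h' w₂ o₂)
  have A : ∀ s s' : ℂ, s ≠ s' →
      (∀ w, ⟪j w, j (s • v₂ + (1 : ℂ) • v₁)⟫_ℂ = 0 → a w (s • v₂ + (1 : ℂ) • v₁) = 0) →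
      (∀ w, ⟪j w, j (s' • v₂ + (1 : ℂ) • v₁)⟫_ℂ = 0 → a w (s' • v₂ + (1 : ℂ) • v₁) = 0) →
      False := fun s s' hs e e' =>
    n₁ (eigenvector_of_three j hj a one_ne_zero one_ne_zero (by simpa using hs) a₂ e e' w₁ o₁)
  have B : ∀ s s' : ℂ, s ≠ s' → s ≠ 0 → s' ≠ 0 →
      (∀ w, ⟪j w, j (s • v₂ + (1 : ℂ) • v₁)⟫_ℂ = 0 → b w (s • v₂ + (1 : ℂ) • v₁) = 0) →
      (∀ w, ⟪j w, j (s' • v₂ + (1 : ℂ) • v₁)⟫_ℂ = 0 → b w (s' • v₂ + (1 : ℂ) • v₁) = 0) →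
      False := fun s s' hs h0 h0' e e' => by
    rw [add_comm] at e e'
    exact n₂ (eigenvector_of_three j hj b h0 h0' (by simpa using hs.symm) b₁ e e' w₂ o₂)
  -- Of the three combinations `s v₂ + v₁` with `s = 1, 2, 3`, two are eigenvectors of the same map,
  -- which makes `v₁` an eigenvector of `a` or `v₂` one of `b`.
  rcases h1 ((1 : ℂ) • v₂ + (1 : ℂ) • v₁) with c1 | c1 <;>
  rcases h1 ((2 : ℂ) • v₂ + (1 : ℂ) • v₁) with c2 | c2 <;>
  rcases h1 ((3 : ℂ) • v₂ + (1 : ℂ) • v₁) with c3 | c3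
  · exact A 1 2 (by norm_num) c1 c2
  · exact A 1 2 (by norm_num) c1 c2
  · exact A 1 3 (by norm_num) c1 c3
  · exact B 2 3 (by norm_num) (by norm_num) (by norm_num) c2 c3
  · exact A 2 3 (by norm_num) c2 c3
  · exact B 1 3 (by norm_num) (by norm_num) (by norm_num) c1 c3
  · exact B 1 2 (by norm_num) (by norm_num) (by norm_num) c1 c2
  · exact B 1 2 (by norm_num) (by norm_num) (by norm_num) c1 c2

end Forms

/-! ### Partial integration of Schwartz functions -/

section PartialIntegral

set_option linter.unusedSectionVars false

variable {X Y : Type} [NormedAddCommGroup X] [NormedSpace ℝ X] [FiniteDimensional ℝ X]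
  [NormedAddCommGroup Y] [NormedSpace ℝ Y] [FiniteDimensional ℝ Y]
  [MeasureSpace Y] [BorelSpace Y] [(volume : Measure Y).IsAddHaarMeasure]

/-- The function `x ↦ ∫ Ψ (x, y) dy`. -/
def partialIntegral {F : Type} [NormedAddCommGroup F] [NormedSpace ℝ F] (Ψ : 𝓢(X × Y, F)) (x : X) :
    F := ∫ y, Ψ (x, y)

variable {F : Type} [NormedAddCommGroup F] [NormedSpace ℝ F]

/-- An integrable bound of `y ↦ ‖x‖ ^ k ‖Ψ (x, y)‖` that is uniform in `x` and given by a seminorm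
of `Ψ`. -/
theorem exists_pow_mul_norm_le (k : ℕ) : ∃ (s : Finset (ℕ × ℕ)) (C : ℝ), 0 ≤ C ∧
    ∀ (Ψ : 𝓢(X × Y, F)) x y, ‖x‖ ^ k * ‖Ψ (x, y)‖ ≤
      C * s.sup (schwartzSeminormFamily ℝ (X × Y) F) Ψ *
        (1 + ‖y‖) ^ (-((volume : Measure Y).integrablePower : ℝ)) := by
  set l := (volume : Measure Y).integrablePower
  refine ⟨Finset.Iic (k + l, 0), 2 ^ (k + l), by positivity, fun Ψ x y => ?_⟩
  have h := SchwartzMap.one_add_le_sup_seminorm_apply (𝕜 := ℝ) (m := (k + l, 0)) le_rfl le_rfl Ψ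
    (x, y)
  rw [norm_iteratedFDeriv_zero] at h
  have hy : 0 < 1 + ‖y‖ := by positivity
  rw [Real.rpow_neg hy.le, Real.rpow_natCast, ← div_eq_mul_inv, le_div_iff₀ (by positivity)]
  refine le_trans ?_ h
  have hx1 : ‖x‖ ≤ 1 + ‖(x, y)‖ := (norm_fst_le (x, y)).trans (by linarith)
  have hy1 : 1 + ‖y‖ ≤ 1 + ‖(x, y)‖ := by linarith [norm_snd_le (x, y)]
  calc ‖x‖ ^ k * ‖Ψ (x, y)‖ * (1 + ‖y‖) ^ l = ‖x‖ ^ k * (1 + ‖y‖) ^ l * ‖Ψ (x, y)‖ := by ring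
    _ ≤ (1 + ‖(x, y)‖) ^ k * (1 + ‖(x, y)‖) ^ l * ‖Ψ (x, y)‖ := by gcongr
    _ = _ := by rw [pow_add]

theorem integrable_slice (Ψ : 𝓢(X × Y, F)) (x : X) : Integrable fun y => Ψ (x, y) := by
  obtain ⟨s, C, hC, h⟩ := exists_pow_mul_norm_le (X := X) (Y := Y) (F := F) 0
  refine (Measure.integrable_pow_neg_integrablePower (volume : Measure Y)).const_mul
    (C * s.sup (schwartzSeminormFamily ℝ (X × Y) F) Ψ) |>.mono'
    (Ψ.continuous.comp (by fun_prop)).aestronglyMeasurable (.of_forall fun y => ?_)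
  simpa using h Ψ x y

/-- The derivative of a Schwartz function in the first variable. -/
def fstDeriv : 𝓢(X × Y, F) →L[ℝ] 𝓢(X × Y, X →L[ℝ] F) :=
  SchwartzMap.postcompCLM
    ((ContinuousLinearMap.compL ℝ X (X × Y) F).flip (ContinuousLinearMap.inl ℝ X Y)) ∘L
    SchwartzMap.fderivCLM ℝ (X × Y) F

theorem hasFDerivAt_partialIntegral (Ψ : 𝓢(X × Y, F)) (x : X) :
    HasFDerivAt (partialIntegral Ψ) (partialIntegral (fstDeriv Ψ) x) x := by
  obtain ⟨s, C, hC, h⟩ := exists_pow_mul_norm_le (X := X) (Y := Y) (F := X →L[ℝ] F) 0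
  refine hasFDerivAt_integral_of_dominated_of_fderiv_le (F := fun x y => Ψ (x, y))
    (F' := fun x y => fstDeriv Ψ (x, y)) (s := univ) univ_mem
    (.of_forall fun x => (integrable_slice Ψ x).aestronglyMeasurable) (integrable_slice Ψ x)
    (integrable_slice _ x).aestronglyMeasurable
    (bound := fun y => C * s.sup (schwartzSeminormFamily ℝ (X × Y) _) (fstDeriv Ψ) *
        (1 + ‖y‖) ^ (-((volume : Measure Y).integrablePower : ℝ)))
    (.of_forall fun y x _ => by simpa using h (fstDeriv Ψ) x y)
    ((Measure.integrable_pow_neg_integrablePower (volume : Measure Y)).const_mul _)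
    (.of_forall fun y x _ => ?_)
  exact (Ψ.hasFDerivAt (x, y)).comp x (hasFDerivAt_prodMk_left x y)

theorem contDiff_partialIntegral (n : ℕ) : ∀ {F : Type} [NormedAddCommGroup F] [NormedSpace ℝ F]
    (Ψ : 𝓢(X × Y, F)), ContDiff ℝ n (partialIntegral Ψ) := by
  induction n with
  | zero =>
    intro F _ _ Ψ
    rw [Nat.cast_zero, contDiff_zero]
    exact continuous_iff_continuousAt.2 fun x => (hasFDerivAt_partialIntegral Ψ x).continuousAt
  | succ n ih =>
    intro F _ _ Ψ
    rw [Nat.cast_succ, contDiff_succ_iff_hasFDerivAt]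
    refine ⟨_, ih (fstDeriv Ψ), hasFDerivAt_partialIntegral Ψ⟩

/-- The derivatives of the partial integral are the partial integrals of the derivatives in the
first variable, so that the Schwartz seminorms are estimated by induction on the order of the
derivative, for all target spaces at once. -/
theorem partialIntegral_decay (n : ℕ) : ∀ {F : Type} [NormedAddCommGroup F] [NormedSpace ℝ F]
    (k : ℕ), ∃ (s : Finset (ℕ × ℕ)) (C : ℝ), 0 ≤ C ∧ ∀ (Ψ : 𝓢(X × Y, F)) x,
      ‖x‖ ^ k * ‖iteratedFDeriv ℝ n (partialIntegral Ψ) x‖ ≤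
        C * s.sup (schwartzSeminormFamily ℝ (X × Y) F) Ψ := by
  induction n with
  | zero =>
    intro F _ _ k
    obtain ⟨s, C, hC, h⟩ := exists_pow_mul_norm_le (X := X) (Y := Y) (F := F) k
    set w : Y → ℝ := fun y => (1 + ‖y‖) ^ (-((volume : Measure Y).integrablePower : ℝ))
    have hw : Integrable w := Measure.integrable_pow_neg_integrablePower (volume : Measure Y)
    refine ⟨s, C * ∫ y, w y, mul_nonneg hC (integral_nonneg fun y => by positivity), fun Ψ x => ?_⟩
    rw [norm_iteratedFDeriv_zero]
    calc ‖x‖ ^ k * ‖∫ y, Ψ (x, y)‖ ≤ ‖x‖ ^ k * ∫ y, ‖Ψ (x, y)‖ := by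
          gcongr
          exact norm_integral_le_integral_norm _
      _ = ∫ y, ‖x‖ ^ k * ‖Ψ (x, y)‖ := (integral_const_mul _ _).symm
      _ ≤ ∫ y, C * s.sup (schwartzSeminormFamily ℝ (X × Y) F) Ψ * w y :=
          integral_mono ((integrable_slice Ψ x).norm.const_mul _) (hw.const_mul _) (h Ψ x)
      _ = _ := by rw [integral_const_mul]; ring
  | succ n ih =>
    intro F _ _ k
    obtain ⟨s, C, hC, h⟩ := ih (F := X →L[ℝ] F) k
    obtain ⟨s', C', -, h'⟩ := Seminorm.bound_of_continuous (schwartz_withSeminorms ℝ (X × Y) F)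
      ((s.sup (schwartzSeminormFamily ℝ (X × Y) (X →L[ℝ] F))).comp
        ((fstDeriv : 𝓢(X × Y, F) →L[ℝ] _) : 𝓢(X × Y, F) →ₗ[ℝ] 𝓢(X × Y, X →L[ℝ] F)))
      ((Seminorm.continuous_finsetSup fun i _ =>
        (schwartz_withSeminorms ℝ (X × Y) (X →L[ℝ] F)).continuous_seminorm i).comp
        fstDeriv.continuous)
    refine ⟨s', C * C', by positivity, fun Ψ x => ?_⟩
    rw [← norm_iteratedFDeriv_fderiv]
    have : fderiv ℝ (partialIntegral Ψ) = partialIntegral (fstDeriv Ψ) :=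
      funext fun x => (hasFDerivAt_partialIntegral Ψ x).fderiv
    rw [this, mul_assoc]
    exact (h _ x).trans (mul_le_mul_of_nonneg_left (h' Ψ) hC)

variable {F : Type} [NormedAddCommGroup F] [NormedSpace ℂ F]

/-- Integration over the second variable as an operator between Schwartz spaces. -/
def partialIntegralCLM : 𝓢(X × Y, F) →L[ℂ] 𝓢(X, F) where
  toFun Ψ := (SchwartzMap.mkCLM (𝕜 := ℝ) (𝕜' := ℝ) (σ := RingHom.id ℝ)
    (partialIntegral : 𝓢(X × Y, F) → X → F)
    (fun Ψ Φ x => integral_add (integrable_slice Ψ x) (integrable_slice Φ x))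
    (fun a Ψ x => integral_smul a _)
    (fun Ψ => contDiff_infty.2 fun n => contDiff_partialIntegral n Ψ)
    (fun n => partialIntegral_decay n.2 n.1)) Ψ
  map_add' := map_add _
  map_smul' c Ψ := by
    ext x
    exact integral_smul c _
  cont := ContinuousLinearMap.continuous _

end PartialIntegral

/-! ### Tensor products of Schwartz functions -/

section Box

variable {X Y : Type} [NormedAddCommGroup X] [NormedSpace ℝ X]
  [NormedAddCommGroup Y] [NormedSpace ℝ Y] {ι κ : Type} [Fintype ι] [Fintype κ]

/-- The tensor product of two vectors. -/
def vecTensor (ι κ : Type) [Fintype ι] [Fintype κ] :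
    EuclideanSpace ℂ ι →L[ℂ] EuclideanSpace ℂ κ →L[ℂ] EuclideanSpace ℂ (ι × κ) :=
  LinearMap.toContinuousLinearMap
    (LinearMap.toContinuousLinearMap.toLinearMap ∘ₗ
    (LinearMap.mk₂ ℂ (fun v w => (WithLp.toLp 2 fun ij => v ij.1 * w ij.2 :
        EuclideanSpace ℂ (ι × κ)))
      (fun _ _ _ => by ext; simp [add_mul]) (fun _ _ _ => by ext; simp [mul_assoc])
      (fun _ _ _ => by ext; simp [mul_add]) (fun _ _ _ => by ext; simp [mul_left_comm])))

@[simp]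
theorem vecTensor_apply (v : EuclideanSpace ℂ ι) (w : EuclideanSpace ℂ κ) (ij : ι × κ) :
    vecTensor ι κ v w ij = v ij.1 * w ij.2 := rfl

/-- Leibniz' rule and `max (a, b) ^ k ≤ a ^ k + b ^ k` bound a Schwartz seminorm of a product
function by seminorms of its factors. -/
theorem iteratedFDeriv_box_le (B : EuclideanSpace ℂ ι →L[ℂ] EuclideanSpace ℂ κ →L[ℂ]
    EuclideanSpace ℂ (ι × κ)) (f : 𝓢(X, EuclideanSpace ℂ ι)) (g : 𝓢(Y, EuclideanSpace ℂ κ))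
    (k n : ℕ) (z : X × Y) :
    ‖z‖ ^ k * ‖iteratedFDeriv ℝ n (fun z : X × Y => B (f z.1) (g z.2)) z‖ ≤
      (‖B‖ * ∑ i ∈ Finset.range (n + 1), (n.choose i : ℝ) * 2) *
      ((Finset.Iic (k, n)).sup (schwartzSeminormFamily ℂ X (EuclideanSpace ℂ ι)) f *
      (Finset.Iic (k, n)).sup (schwartzSeminormFamily ℂ Y (EuclideanSpace ℂ κ)) g) := by
  set P := (Finset.Iic (k, n)).sup (schwartzSeminormFamily ℂ X (EuclideanSpace ℂ ι)) f
  set Q := (Finset.Iic (k, n)).sup (schwartzSeminormFamily ℂ Y (EuclideanSpace ℂ κ)) g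
  have hP0 : 0 ≤ P := apply_nonneg _ _
  have hQ0 : 0 ≤ Q := apply_nonneg _ _
  have hP : ∀ a i, a ≤ k → i ≤ n → ∀ x, ‖x‖ ^ a * ‖iteratedFDeriv ℝ i f x‖ ≤ P :=
    fun a i ha hi x => (SchwartzMap.le_seminorm ℂ a i f x).trans
      (Seminorm.le_finset_sup_apply (p := schwartzSeminormFamily ℂ X (EuclideanSpace ℂ ι))
        (i := (a, i)) (Finset.mem_Iic.2 ⟨ha, hi⟩))
  have hQ : ∀ a i, a ≤ k → i ≤ n → ∀ x, ‖x‖ ^ a * ‖iteratedFDeriv ℝ i g x‖ ≤ Q :=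
    fun a i ha hi x => (SchwartzMap.le_seminorm ℂ a i g x).trans
      (Seminorm.le_finset_sup_apply (p := schwartzSeminormFamily ℂ Y (EuclideanSpace ℂ κ))
        (i := (a, i)) (Finset.mem_Iic.2 ⟨ha, hi⟩))
  have h1 : ∀ i, ‖iteratedFDeriv ℝ i (fun z : X × Y => f z.1) z‖ ≤ ‖iteratedFDeriv ℝ i f z.1‖ := by
    intro i
    have := (ContinuousLinearMap.fst ℝ X Y).iteratedFDeriv_comp_right (f.smooth i) z le_rfl
    change ‖iteratedFDeriv ℝ i (f ∘ ContinuousLinearMap.fst ℝ X Y) z‖ ≤ _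
    rw [this]
    refine (ContinuousMultilinearMap.norm_compContinuousLinearMap_le _ _).trans ?_
    exact mul_le_of_le_one_right (norm_nonneg _) (Finset.prod_le_one (fun _ _ => norm_nonneg _)
      (fun _ _ => ContinuousLinearMap.norm_fst_le ..))
  have h2 : ∀ i, ‖iteratedFDeriv ℝ i (fun z : X × Y => g z.2) z‖ ≤ ‖iteratedFDeriv ℝ i g z.2‖ := by
    intro i
    have := (ContinuousLinearMap.snd ℝ X Y).iteratedFDeriv_comp_right (g.smooth i) z le_rfl
    change ‖iteratedFDeriv ℝ i (g ∘ ContinuousLinearMap.snd ℝ X Y) z‖ ≤ _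
    rw [this]
    refine (ContinuousMultilinearMap.norm_compContinuousLinearMap_le _ _).trans ?_
    exact mul_le_of_le_one_right (norm_nonneg _) (Finset.prod_le_one (fun _ _ => norm_nonneg _)
      (fun _ _ => ContinuousLinearMap.norm_snd_le ..))
  have h3 := (B.bilinearRestrictScalars ℝ).norm_iteratedFDeriv_le_of_bilinear
    (f := fun z : X × Y => f z.1) (g := fun z : X × Y => g z.2) (N := n)
    ((f.smooth _).comp contDiff_fst) ((g.smooth _).comp contDiff_snd) z le_rfl
  rw [ContinuousLinearMap.norm_bilinearRestrictScalars] at h3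
  have hz : ‖z‖ ^ k ≤ ‖z.1‖ ^ k + ‖z.2‖ ^ k := by
    rcases le_total ‖z.1‖ ‖z.2‖ with h | h
    · rw [Prod.norm_def, max_eq_right h]
      exact le_add_of_nonneg_left (by positivity)
    · rw [Prod.norm_def, max_eq_left h]
      exact le_add_of_nonneg_right (by positivity)
  refine (mul_le_mul_of_nonneg_left h3 (by positivity)).trans ?_
  rw [mul_left_comm, Finset.mul_sum, mul_assoc ‖B‖, Finset.sum_mul]
  refine mul_le_mul_of_nonneg_left (Finset.sum_le_sum fun i hi => ?_)
    (ContinuousLinearMap.opNorm_nonneg _)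
  have hi' : i ≤ n := Nat.lt_succ_iff.1 (Finset.mem_range.1 hi)
  rw [mul_assoc, mul_left_comm, mul_assoc]
  refine mul_le_mul_of_nonneg_left ?_ (by positivity)
  have A := hP k i le_rfl hi' z.1
  have A' := hP 0 i (Nat.zero_le _) hi' z.1
  have C := hQ k (n - i) le_rfl (Nat.sub_le _ _) z.2
  have C' := hQ 0 (n - i) (Nat.zero_le _) (Nat.sub_le _ _) z.2
  simp only [pow_zero, one_mul] at A' C'
  calc ‖z‖ ^ k * (‖iteratedFDeriv ℝ i (fun z : X × Y => f z.1) z‖ *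
        ‖iteratedFDeriv ℝ (n - i) (fun z : X × Y => g z.2) z‖)
      ≤ (‖z.1‖ ^ k + ‖z.2‖ ^ k) *
        (‖iteratedFDeriv ℝ i f z.1‖ * ‖iteratedFDeriv ℝ (n - i) g z.2‖) := by
        gcongr
        · exact h1 i
        · exact h2 _
    _ = (‖z.1‖ ^ k * ‖iteratedFDeriv ℝ i f z.1‖) * ‖iteratedFDeriv ℝ (n - i) g z.2‖ +
        ‖iteratedFDeriv ℝ i f z.1‖ * (‖z.2‖ ^ k * ‖iteratedFDeriv ℝ (n - i) g z.2‖) := by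
        ring
    _ ≤ P * Q + P * Q := by gcongr
    _ = 2 * (P * Q) := by ring

/-- The tensor product `(f ⊠ g) (x, y) = f x ⊗ g y`, as a bilinear map. -/
def box : 𝓢(X, EuclideanSpace ℂ ι) →ₗ[ℂ] 𝓢(Y, EuclideanSpace ℂ κ) →ₗ[ℂ]
    𝓢(X × Y, EuclideanSpace ℂ (ι × κ)) :=
  LinearMap.mk₂ ℂ (fun f g =>
    { toFun := fun z => vecTensor ι κ (f z.1) (g z.2)
      smooth' := by
        exact ((vecTensor ι κ).bilinearRestrictScalars ℝ).isBoundedBilinearMap.contDiff.comp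
          (((f.smooth _).comp contDiff_fst).prodMk ((g.smooth _).comp contDiff_snd))
      decay' := fun k n => ⟨_, iteratedFDeriv_box_le _ f g k n⟩ })
    (fun f f' g => SchwartzMap.ext fun z =>
      show vecTensor ι κ (f z.1 + f' z.1) (g z.2) =
        vecTensor ι κ (f z.1) (g z.2) + vecTensor ι κ (f' z.1) (g z.2) by
      rw [map_add]; rfl)
    (fun c f g => SchwartzMap.ext fun z =>
      show vecTensor ι κ (c • f z.1) (g z.2) = c • vecTensor ι κ (f z.1) (g z.2) by
      rw [map_smul]; rfl)
    (fun f g g' => SchwartzMap.ext fun z =>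
      show vecTensor ι κ (f z.1) (g z.2 + g' z.2) =
        vecTensor ι κ (f z.1) (g z.2) + vecTensor ι κ (f z.1) (g' z.2) by
      rw [map_add])
    (fun c f g => SchwartzMap.ext fun z =>
      show vecTensor ι κ (f z.1) (c • g z.2) = c • vecTensor ι κ (f z.1) (g z.2) by
      rw [map_smul])

theorem box_apply (f : 𝓢(X, EuclideanSpace ℂ ι)) (g : 𝓢(Y, EuclideanSpace ℂ κ)) (z : X × Y) :
    box f g z = vecTensor ι κ (f z.1) (g z.2) := rfl

/-- The tensor product is jointly continuous. -/
theorem exists_seminorm_box_le (p : Seminorm ℂ 𝓢(X × Y, EuclideanSpace ℂ (ι × κ)))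
    (hp : Continuous p) : ∃ (q : Seminorm ℂ 𝓢(X, EuclideanSpace ℂ ι))
      (q' : Seminorm ℂ 𝓢(Y, EuclideanSpace ℂ κ)), Continuous q ∧ Continuous q' ∧
      ∃ C : ℝ, 0 ≤ C ∧ ∀ f g, p (box f g) ≤ C * (q f * q' g) := by
  obtain ⟨s, C, -, h⟩ := Seminorm.bound_of_continuous
    (schwartz_withSeminorms ℂ (X × Y) (EuclideanSpace ℂ (ι × κ))) p hp
  let m : ℕ × ℕ := (s.sup Prod.fst, s.sup Prod.snd)
  have hc : ∀ {Z : Type} [NormedAddCommGroup Z] [NormedSpace ℝ Z] {ν : Type} [Fintype ν],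
      Continuous (((Finset.Iic m).sup (schwartzSeminormFamily ℂ Z (EuclideanSpace ℂ ν)) :
        Seminorm ℂ 𝓢(Z, EuclideanSpace ℂ ν)) : 𝓢(Z, EuclideanSpace ℂ ν) → ℝ) :=
    fun {Z} _ _ {ν} _ => Seminorm.continuous_finsetSup fun i _ =>
      (schwartz_withSeminorms ℂ Z (EuclideanSpace ℂ ν)).continuous_seminorm i
  refine ⟨_, _, hc, hc, C * ∑ j ∈ s, (‖vecTensor ι κ‖ *
    ∑ i ∈ Finset.range (j.2 + 1), (j.2.choose i : ℝ) * 2), by positivity, fun f g => ?_⟩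
  refine (h _).trans ?_
  rw [smul_apply, NNReal.smul_def, smul_eq_mul, mul_assoc]
  refine mul_le_mul_of_nonneg_left ?_ C.2
  refine Seminorm.finset_sup_apply_le (by positivity) fun j hj => ?_
  have hjm : Finset.Iic j ⊆ Finset.Iic m := Finset.Iic_subset_Iic.2
    ⟨Finset.le_sup (f := Prod.fst) hj, Finset.le_sup (f := Prod.snd) hj⟩
  refine (SchwartzMap.seminorm_le_bound ℂ j.1 j.2 (box f g) (by positivity)
    (iteratedFDeriv_box_le (vecTensor ι κ) f g j.1 j.2)).trans ?_
  refine mul_le_mul ?_ ?_ (by positivity) (by positivity)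
  · exact Finset.single_le_sum (f := fun j : ℕ × ℕ => ‖vecTensor ι κ‖ *
      ∑ i ∈ Finset.range (j.2 + 1), (j.2.choose i : ℝ) * 2) (fun _ _ => by positivity) hj
  · exact mul_le_mul (Seminorm.le_def.1 (Finset.sup_mono hjm) f)
      (Seminorm.le_def.1 (Finset.sup_mono hjm) g) (by positivity) (by positivity)

end Box

section Inner

set_option linter.unusedSectionVars false

variable {X Y : Type} [NormedAddCommGroup X] [NormedSpace ℝ X] [FiniteDimensional ℝ X]
  [MeasureSpace X] [BorelSpace X] [(volume : Measure X).IsAddHaarMeasure]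
  [NormedAddCommGroup Y] [NormedSpace ℝ Y] [FiniteDimensional ℝ Y]
  [MeasureSpace Y] [BorelSpace Y] [(volume : Measure Y).IsAddHaarMeasure]
  {F : Type} [NormedAddCommGroup F] [InnerProductSpace ℂ F]
  {ι κ : Type} [Fintype ι] [Fintype κ]

theorem inner_ket (f g : 𝓢(X, F)) : ⟪ket f, ket g⟫_ℂ = ∫ x, ⟪f x, g x⟫_ℂ :=
  SchwartzMap.inner_toL2_toL2_eq f g

theorem ket_injective : Function.Injective (ket : 𝓢(X, F) → L2 X F) :=
  SchwartzMap.injective_toLp 2 volume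

/-- For spaces that are finite-dimensional but not assumed to be second countable. -/
scoped instance prod_isAddHaarMeasure : (volume : Measure (X × Y)).IsAddHaarMeasure := by
  have := FiniteDimensional.proper_real X
  have := FiniteDimensional.proper_real Y
  rw [Measure.volume_eq_prod]
  infer_instance

scoped instance prod_borelSpace : BorelSpace (X × Y) := by
  have := FiniteDimensional.proper_real X
  infer_instance

theorem inner_vecTensor (v v' : EuclideanSpace ℂ ι) (w w' : EuclideanSpace ℂ κ) :
    ⟪vecTensor ι κ v w, vecTensor ι κ v' w'⟫_ℂ = ⟪v, v'⟫_ℂ * ⟪w, w'⟫_ℂ := by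
  simp only [PiLp.inner_apply, vecTensor_apply, Fintype.sum_prod_type, Finset.sum_mul_sum,
    RCLike.inner_apply, map_mul]
  refine Finset.sum_congr rfl fun i _ => Finset.sum_congr rfl fun k _ => ?_
  ring

theorem inner_box (f f' : 𝓢(X, EuclideanSpace ℂ ι)) (g g' : 𝓢(Y, EuclideanSpace ℂ κ)) :
    ⟪ket (box f g), ket (box f' g')⟫_ℂ = ⟪ket f, ket f'⟫_ℂ * ⟪ket g, ket g'⟫_ℂ := by
  have := FiniteDimensional.proper_real X
  have := FiniteDimensional.proper_real Y
  simp only [inner_ket, box_apply, inner_vecTensor]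
  rw [Measure.volume_eq_prod]
  exact integral_prod_mul (fun x => ⟪f x, f' x⟫_ℂ) (fun y => ⟪g y, g' y⟫_ℂ)

theorem norm_ket_box (f : 𝓢(X, EuclideanSpace ℂ ι)) (g : 𝓢(Y, EuclideanSpace ℂ κ)) :
    ‖ket (box f g)‖ = ‖ket f‖ * ‖ket g‖ := by
  have h := inner_box f f g g
  simp only [inner_self_eq_norm_sq_to_K] at h
  norm_cast at h
  rw [← mul_pow] at h
  exact (pow_left_inj₀ (norm_nonneg _) (by positivity) two_ne_zero).1 h

/-- The contraction of a vector of `ℂ^(ι × κ)` with a vector of `ℂ^κ`. -/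
def vecContract (ι κ : Type) [Fintype ι] [Fintype κ] :
    EuclideanSpace ℂ (ι × κ) →L[ℂ] EuclideanSpace ℂ κ →L[ℂ] EuclideanSpace ℂ ι :=
  LinearMap.toContinuousLinearMap
    (LinearMap.toContinuousLinearMap.toLinearMap ∘ₗ
    (LinearMap.mk₂ ℂ (fun v w => (WithLp.toLp 2 fun i => ∑ k, v (i, k) * w k :
        EuclideanSpace ℂ ι))
      (fun _ _ _ => by ext; simp [add_mul, Finset.sum_add_distrib])
      (fun _ _ _ => by ext; simp [mul_assoc, Finset.mul_sum])
      (fun _ _ _ => by ext; simp [mul_add, Finset.sum_add_distrib])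
      (fun _ _ _ => by ext; simp [mul_left_comm, Finset.mul_sum])))

theorem vecContract_apply (v : EuclideanSpace ℂ (ι × κ)) (w : EuclideanSpace ℂ κ) (i : ι) :
    vecContract ι κ v w i = ∑ k, v (i, k) * w k := rfl

/-- Complex conjugation on `ℂ^κ`. -/
def vecConj (κ : Type) [Fintype κ] : EuclideanSpace ℂ κ →L[ℝ] EuclideanSpace ℂ κ :=
  LinearMap.toContinuousLinearMap
    { toFun := fun w => WithLp.toLp 2 fun k => starRingEnd ℂ (w k)
      map_add' := fun _ _ => by ext; simp
      map_smul' := fun _ _ => by ext; simp }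

theorem vecConj_apply (w : EuclideanSpace ℂ κ) (k : κ) :
    vecConj κ w k = starRingEnd ℂ (w k) := rfl

theorem conj_snd_hasTemperateGrowth (g : 𝓢(Y, EuclideanSpace ℂ κ)) :
    (fun z : X × Y => vecConj κ (g z.2)).HasTemperateGrowth :=
  ((vecConj κ).hasTemperateGrowth.comp g.hasTemperateGrowth).comp
    (ContinuousLinearMap.snd ℝ X Y).hasTemperateGrowth

/-- The contraction of a two-particle wave function with a wave function `g` of the second particle,
that is, the adjoint of `f ↦ f ⊠ g`. -/
def contr (g : 𝓢(Y, EuclideanSpace ℂ κ)) :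
    𝓢(X × Y, EuclideanSpace ℂ (ι × κ)) →L[ℂ] 𝓢(X, EuclideanSpace ℂ ι) :=
  partialIntegralCLM ∘L
    SchwartzMap.bilinLeftCLM (vecContract ι κ) (conj_snd_hasTemperateGrowth g)

theorem inner_contr (f : 𝓢(X, EuclideanSpace ℂ ι)) (g : 𝓢(Y, EuclideanSpace ℂ κ))
    (Ψ : 𝓢(X × Y, EuclideanSpace ℂ (ι × κ))) :
    ⟪ket f, ket (contr g Ψ)⟫_ℂ = ⟪ket (box f g), ket Ψ⟫_ℂ := by
  have := FiniteDimensional.proper_real X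
  have := FiniteDimensional.proper_real Y
  have hpt : ∀ x y, ⟪box f g (x, y), Ψ (x, y)⟫_ℂ =
      ⟪f x, SchwartzMap.bilinLeftCLM (vecContract ι κ) (conj_snd_hasTemperateGrowth g) Ψ
        (x, y)⟫_ℂ := by
    intro x y
    rw [SchwartzMap.bilinLeftCLM_apply]
    simp only [box_apply, PiLp.inner_apply, vecTensor_apply, Fintype.sum_prod_type,
      RCLike.inner_apply, map_mul, vecContract_apply, vecConj_apply, Finset.sum_mul]
    refine Finset.sum_congr rfl fun i _ => Finset.sum_congr rfl fun k _ => ?_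
    ring
  have hint : Integrable (fun z : X × Y => ⟪box f g z, Ψ z⟫_ℂ) (volume.prod volume) := by
    rw [← Measure.volume_eq_prod]
    exact (L2.integrable_inner (𝕜 := ℂ) (ket (box f g)) (ket Ψ)).congr (by
      filter_upwards [(box f g).coeFn_toLp 2 volume, Ψ.coeFn_toLp 2 volume] with z h1 h2
      exact congrArg₂ _ h1 h2)
  rw [inner_ket, inner_ket, Measure.volume_eq_prod, integral_prod _ hint]
  refine integral_congr_ae (.of_forall fun x => ?_)
  simp only [hpt]
  exact (integral_inner (integrable_slice _ x) (f x)).symm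

end Inner

/-! ### Exchange of the factors, and density of the product functions -/

section Perm

set_option linter.unusedSectionVars false

variable {X X' : Type} [NormedAddCommGroup X] [NormedSpace ℝ X] [FiniteDimensional ℝ X]
  [MeasureSpace X] [BorelSpace X] [(volume : Measure X).IsAddHaarMeasure]
  [NormedAddCommGroup X'] [NormedSpace ℝ X'] [FiniteDimensional ℝ X']
  [MeasureSpace X'] [BorelSpace X'] [(volume : Measure X').IsAddHaarMeasure]
  {ι ι' : Type} [Fintype ι] [Fintype ι']

/-- Relabelling of the position variables and of the internal indices of a wave function. -/
def relabel (e : X' ≃L[ℝ] X) (σ : ι' ≃ ι) :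
    𝓢(X, EuclideanSpace ℂ ι) →L[ℂ] 𝓢(X', EuclideanSpace ℂ ι') :=
  SchwartzMap.postcompCLM
    ((LinearIsometryEquiv.piLpCongrLeft 2 ℂ ℂ σ.symm).toContinuousLinearEquiv :
      EuclideanSpace ℂ ι →L[ℂ] EuclideanSpace ℂ ι') ∘L
    SchwartzMap.compCLMOfContinuousLinearEquiv ℂ e

theorem relabel_apply (e : X' ≃L[ℝ] X) (σ : ι' ≃ ι) (f : 𝓢(X, EuclideanSpace ℂ ι)) (x : X')
    (i : ι') : relabel e σ f x i = f (e x) (σ i) := rfl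

theorem inner_relabel (e : X' ≃L[ℝ] X) (he : MeasurePreserving e) (σ : ι' ≃ ι)
    (f g : 𝓢(X, EuclideanSpace ℂ ι)) :
    ⟪ket (relabel e σ f), ket (relabel e σ g)⟫_ℂ = ⟪ket f, ket g⟫_ℂ := by
  rw [inner_ket, inner_ket, ← he.integral_comp e.toHomeomorph.measurableEmbedding]
  refine integral_congr_ae (.of_forall fun x => ?_)
  simp only [PiLp.inner_apply, relabel_apply]
  exact Equiv.sum_comp σ fun i => ⟪f (e x) i, g (e x) i⟫_ℂ

end Perm

section Contr₁

set_option linter.unusedSectionVars false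

variable {X Y : Type} [NormedAddCommGroup X] [NormedSpace ℝ X] [FiniteDimensional ℝ X]
  [MeasureSpace X] [BorelSpace X] [(volume : Measure X).IsAddHaarMeasure]
  [NormedAddCommGroup Y] [NormedSpace ℝ Y] [FiniteDimensional ℝ Y]
  [MeasureSpace Y] [BorelSpace Y] [(volume : Measure Y).IsAddHaarMeasure]
  {ι κ : Type} [Fintype ι] [Fintype κ]

/-- The exchange of the two factors. -/
def flip₁₂ : 𝓢(X × Y, EuclideanSpace ℂ (ι × κ)) →L[ℂ] 𝓢(Y × X, EuclideanSpace ℂ (κ × ι)) :=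
  relabel (ContinuousLinearEquiv.prodComm ℝ Y X) (Equiv.prodComm κ ι)

theorem flip₁₂_box (f : 𝓢(X, EuclideanSpace ℂ ι)) (g : 𝓢(Y, EuclideanSpace ℂ κ)) :
    flip₁₂ (box f g) = box g f := by
  ext x i
  exact mul_comm _ _

theorem inner_flip₁₂ (Φ Ψ : 𝓢(X × Y, EuclideanSpace ℂ (ι × κ))) :
    ⟪ket (flip₁₂ Φ), ket (flip₁₂ Ψ)⟫_ℂ = ⟪ket Φ, ket Ψ⟫_ℂ := by
  have := FiniteDimensional.proper_real X
  have := FiniteDimensional.proper_real Y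
  refine inner_relabel _ ?_ _ _ _
  exact Measure.measurePreserving_swap (μ := (volume : Measure Y)) (ν := (volume : Measure X))

/-- The contraction of a two-particle wave function with a wave function of the first particle. -/
def contr₁ (f : 𝓢(X, EuclideanSpace ℂ ι)) :
    𝓢(X × Y, EuclideanSpace ℂ (ι × κ)) →L[ℂ] 𝓢(Y, EuclideanSpace ℂ κ) :=
  contr f ∘L flip₁₂

theorem inner_contr₁ (f : 𝓢(X, EuclideanSpace ℂ ι)) (g : 𝓢(Y, EuclideanSpace ℂ κ))
    (Ψ : 𝓢(X × Y, EuclideanSpace ℂ (ι × κ))) :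
    ⟪ket g, ket (contr₁ f Ψ)⟫_ℂ = ⟪ket (box f g), ket Ψ⟫_ℂ := by
  rw [contr₁, ContinuousLinearMap.comp_apply, inner_contr, ← flip₁₂_box, inner_flip₁₂]

/-- A vector multiplied by a real test function. -/
def testVec {F : Type} [NormedAddCommGroup F] [NormedSpace ℝ F] {φ : X → ℝ}
    (hφ : HasCompactSupport φ) (hs : ContDiff ℝ ∞ φ) (v : F) : 𝓢(X, F) :=
  HasCompactSupport.toSchwartzMap (f := fun x => φ x • v) hφ.smul_right (hs.smul contDiff_const)

theorem testVec_apply {F : Type} [NormedAddCommGroup F] [NormedSpace ℝ F] {φ : X → ℝ}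
    (hφ : HasCompactSupport φ) (hs : ContDiff ℝ ∞ φ) (v : F) (x : X) :
    testVec hφ hs v x = φ x • v := rfl

theorem inner_ket_left {F : Type} [NormedAddCommGroup F] [InnerProductSpace ℂ F] (f : 𝓢(X, F))
    (η : L2 X F) : ⟪ket f, η⟫_ℂ = ∫ x, ⟪f x, η x⟫_ℂ := by
  rw [L2.inner_def]
  refine integral_congr_ae ?_
  filter_upwards [f.coeFn_toLp 2 volume] with x hx
  exact congrArg (⟪·, η x⟫_ℂ) hx

/-- A square integrable function that is orthogonal to all product functions vanishes: its
integrals over products of balls, which are the balls of the product space, vanish. -/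
theorem eq_zero_of_inner_box [DecidableEq ι] [DecidableEq κ]
    (η : L2 (X × Y) (EuclideanSpace ℂ (ι × κ)))
    (h : ∀ (f : 𝓢(X, EuclideanSpace ℂ ι)) (g : 𝓢(Y, EuclideanSpace ℂ κ)),
      ⟪ket (box f g), η⟫_ℂ = 0) : η = 0 := by
  have := FiniteDimensional.proper_real X
  have := FiniteDimensional.proper_real Y
  have loc : ∀ ik, LocallyIntegrable fun z => η z ik := fun ik =>
    ((EuclideanSpace.proj ik : EuclideanSpace ℂ (ι × κ) →L[ℂ] ℂ).comp_memLp' (Lp.memLp η)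
      ).locallyIntegrable (by norm_num)
  have ball : ∀ (ik : ι × κ) (z : X × Y) (r : ℝ), 0 < r →
      ∫ w in Metric.closedBall z r, η w ik = 0 := by
    intro ik z r hr
    have hn : ∀ n : ℕ, r < r + 1 / ((n : ℝ) + 1) := fun n => by
      have : (0 : ℝ) < 1 / ((n : ℝ) + 1) := by positivity
      linarith
    -- The indicator function of the ball, which is a product of balls for the maximum norm, is the
    -- limit of products of smooth bump functions.
    let φ : ℕ → ContDiffBump z.1 := fun n => ⟨r, r + 1 / ((n : ℝ) + 1), hr, hn n⟩
    let χ : ℕ → ContDiffBump z.2 := fun n => ⟨r, r + 1 / ((n : ℝ) + 1), hr, hn n⟩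
    have zero : ∀ n, ∫ w : X × Y, (φ n w.1 * χ n w.2) • η w ik = 0 := by
      intro n
      rw [← h (testVec (φ n).hasCompactSupport (φ n).contDiff (EuclideanSpace.single ik.1 1))
        (testVec (χ n).hasCompactSupport (χ n).contDiff (EuclideanSpace.single ik.2 1)),
        inner_ket_left]
      refine integral_congr_ae (.of_forall fun w => ?_)
      simp only [box_apply, testVec_apply, PiLp.inner_apply, vecTensor_apply, RCLike.inner_apply]
      rw [Finset.sum_eq_single ik]
      · simp [mul_comm]
      · rintro ⟨i, k⟩ - hb
        have : i ≠ ik.1 ∨ k ≠ ik.2 := by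
          by_contra! hc
          exact hb (Prod.ext hc.1 hc.2)
        rcases this with h' | h' <;> simp [h']
      · simp
    have lim : Tendsto (fun n => ∫ w : X × Y, (φ n w.1 * χ n w.2) • η w ik) atTop
        (𝓝 (∫ w, (Metric.closedBall z r).indicator (fun w => η w ik) w)) := by
      refine tendsto_integral_of_dominated_convergence
        ((Metric.closedBall z (r + 1)).indicator fun w => ‖η w ik‖) (fun n => ?_) ?_
        (fun n => .of_forall fun w => ?_) (.of_forall fun w => ?_)
      · exact (((φ n).continuous.comp continuous_fst).mul
          ((χ n).continuous.comp continuous_snd)).aestronglyMeasurable.smul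
          (loc ik).aestronglyMeasurable
      · rw [integrable_indicator_iff Metric.isClosed_closedBall.measurableSet]
        exact ((loc ik).integrableOn_isCompact (isCompact_closedBall z (r + 1))).norm
      · have hle : 1 / ((n : ℝ) + 1) ≤ 1 := by
          rw [div_le_one (by positivity)]
          linarith [(Nat.cast_nonneg n : (0 : ℝ) ≤ n)]
        by_cases hw : w ∈ Metric.closedBall z (r + 1)
        · rw [indicator_of_mem hw, norm_smul]
          refine mul_le_of_le_one_left (norm_nonneg _) ?_
          rw [Real.norm_of_nonneg (mul_nonneg (φ n).nonneg (χ n).nonneg)]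
          exact mul_le_one₀ (φ n).le_one (χ n).nonneg (χ n).le_one
        · rw [indicator_of_notMem hw]
          rw [Metric.mem_closedBall, Prod.dist_eq, max_le_iff, not_and_or] at hw
          rcases hw with hw | hw
          · rw [(φ n).zero_of_le_dist (by change r + 1 / ((n : ℝ) + 1) ≤ _; linarith)]
            simp
          · rw [(χ n).zero_of_le_dist (by change r + 1 / ((n : ℝ) + 1) ≤ _; linarith)]
            simp
      · by_cases hw : w ∈ Metric.closedBall z r
        · rw [indicator_of_mem hw]
          rw [Metric.mem_closedBall, Prod.dist_eq, max_le_iff] at hw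
          refine tendsto_const_nhds.congr fun n => ?_
          rw [(φ n).one_of_mem_closedBall hw.1, (χ n).one_of_mem_closedBall hw.2, mul_one, one_smul]
        · rw [indicator_of_notMem hw]
          rw [Metric.mem_closedBall, Prod.dist_eq, not_le] at hw
          have ev : ∀ᶠ n : ℕ in atTop,
              r + 1 / ((n : ℝ) + 1) < max (dist w.1 z.1) (dist w.2 z.2) := by
            have := (tendsto_one_div_add_atTop_nhds_zero_nat (𝕜 := ℝ)).const_add r
            rw [add_zero] at this
            exact this.eventually_lt_const hw
          refine tendsto_const_nhds.congr' ?_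
          filter_upwards [ev] with n hn
          rcases lt_max_iff.1 hn with hn | hn
          · rw [(φ n).zero_of_le_dist hn.le]
            simp
          · rw [(χ n).zero_of_le_dist hn.le]
            simp
    simp only [zero] at lim
    rw [integral_indicator Metric.isClosed_closedBall.measurableSet] at lim
    exact (tendsto_nhds_unique tendsto_const_nhds lim).symm
  -- Lebesgue's differentiation theorem.
  have ae : ∀ ik, ∀ᵐ z : X × Y, η z ik = 0 := by
    intro ik
    filter_upwards [IsUnifLocDoublingMeasure.ae_tendsto_average volume (loc ik) 1] with z hz
    have := hz (fun _ : ℕ => z) (fun n : ℕ => 1 / ((n : ℝ) + 1))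
      (tendsto_nhdsWithin_iff.2 ⟨tendsto_one_div_add_atTop_nhds_zero_nat,
        .of_forall fun n => mem_Ioi.2 (by positivity)⟩)
      (.of_forall fun n => Metric.mem_closedBall_self (by positivity))
    refine (tendsto_nhds_unique tendsto_const_nhds (this.congr fun n => ?_)).symm
    rw [setAverage_eq, ball ik z _ (by positivity), smul_zero]
  refine (Lp.eq_zero_iff_ae_eq_zero).2 ?_
  filter_upwards [ae_all_iff.2 ae] with z hz
  ext ik
  exact hz ik

/-- The span of the product functions is dense. -/
theorem dense_span_box [DecidableEq ι] [DecidableEq κ] :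
    (Submodule.span ℂ (range fun p : 𝓢(X, EuclideanSpace ℂ ι) × 𝓢(Y, EuclideanSpace ℂ κ) =>
      (ket (box p.1 p.2) : L2 (X × Y) (EuclideanSpace ℂ (ι × κ))))).topologicalClosure = ⊤ := by
  rw [Submodule.topologicalClosure_eq_top_iff, Submodule.eq_bot_iff]
  intro η hη
  exact eq_zero_of_inner_box η fun f g =>
    (Submodule.mem_orthogonal _ _).1 hη _ (Submodule.subset_span ⟨(f, g), rfl⟩)

end Contr₁

/-! ### Two copies of a pair, and the exchange of their second particles -/

section Exchange

set_option linter.unusedSectionVars false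

variable {X Y : Type} [NormedAddCommGroup X] [NormedSpace ℝ X] [FiniteDimensional ℝ X]
  [MeasureSpace X] [BorelSpace X] [(volume : Measure X).IsAddHaarMeasure]
  [NormedAddCommGroup Y] [NormedSpace ℝ Y] [FiniteDimensional ℝ Y]
  [MeasureSpace Y] [BorelSpace Y] [(volume : Measure Y).IsAddHaarMeasure]
  {ι κ : Type} [Fintype ι] [Fintype κ]

/-- The exchange of the second coordinates of two pairs. -/
def exchEquiv {X Y : Type} [NormedAddCommGroup X] [NormedSpace ℝ X] [NormedAddCommGroup Y]
    [NormedSpace ℝ Y] : ((X × Y) × (X × Y)) ≃L[ℝ] ((X × Y) × (X × Y)) where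
  toFun z := ((z.1.1, z.2.2), (z.2.1, z.1.2))
  invFun z := ((z.1.1, z.2.2), (z.2.1, z.1.2))
  map_add' _ _ := rfl
  map_smul' _ _ := rfl
  left_inv _ := rfl
  right_inv _ := rfl
  continuous_toFun := by fun_prop
  continuous_invFun := by fun_prop

/-- The exchange is an involution, so that its determinant is `±1`. -/
theorem measurePreserving_exchEquiv :
    MeasurePreserving (exchEquiv : ((X × Y) × (X × Y)) ≃L[ℝ] ((X × Y) × (X × Y))) := by
  refine ⟨exchEquiv.continuous.measurable, ?_⟩
  let f : ((X × Y) × (X × Y)) →ₗ[ℝ] ((X × Y) × (X × Y)) := exchEquiv.toLinearEquiv.toLinearMap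
  have hf : LinearMap.det f * LinearMap.det f = 1 := by
    rw [← LinearMap.det_comp]
    exact LinearMap.det_id
  have habs : |(LinearMap.det f)⁻¹| = 1 := by
    rcases mul_self_eq_one_iff.1 hf with h | h <;> rw [h] <;> norm_num
  have := Measure.map_linearMap_addHaar_eq_smul_addHaar
    (volume : Measure ((X × Y) × (X × Y))) (f := f) (by
      intro h
      rw [h] at hf
      simp at hf)
  rw [habs, ENNReal.ofReal_one, one_smul] at this
  exact this

/-- The exchange of the second index of two pairs. -/
def exchIdx (ι κ : Type) : ((ι × κ) × (ι × κ)) ≃ ((ι × κ) × (ι × κ)) where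
  toFun z := ((z.1.1, z.2.2), (z.2.1, z.1.2))
  invFun z := ((z.1.1, z.2.2), (z.2.1, z.1.2))
  left_inv _ := rfl
  right_inv _ := rfl

/-- The exchange of the second particles of two pairs. -/
def exch : 𝓢((X × Y) × (X × Y), EuclideanSpace ℂ ((ι × κ) × (ι × κ))) →L[ℂ]
    𝓢((X × Y) × (X × Y), EuclideanSpace ℂ ((ι × κ) × (ι × κ))) :=
  relabel exchEquiv (exchIdx ι κ)

theorem exch_box (a c : 𝓢(X, EuclideanSpace ℂ ι)) (b d : 𝓢(Y, EuclideanSpace ℂ κ)) :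
    exch (box (box a b) (box c d)) = box (box a d) (box c b) := by
  ext z i
  change (a z.1.1 i.1.1 * b z.2.2 i.2.2) * (c z.2.1 i.2.1 * d z.1.2 i.1.2) =
    (a z.1.1 i.1.1 * d z.1.2 i.1.2) * (c z.2.1 i.2.1 * b z.2.2 i.2.2)
  ring

theorem exch_exch (Ψ : 𝓢((X × Y) × (X × Y), EuclideanSpace ℂ ((ι × κ) × (ι × κ)))) :
    exch (exch Ψ) = Ψ := by
  ext z i
  rfl

theorem inner_exch_exch (Φ Ψ : 𝓢((X × Y) × (X × Y), EuclideanSpace ℂ ((ι × κ) × (ι × κ)))) :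
    ⟪ket (exch Φ), ket (exch Ψ)⟫_ℂ = ⟪ket Φ, ket Ψ⟫_ℂ :=
  inner_relabel _ measurePreserving_exchEquiv _ _ _

theorem inner_exch (Φ Ψ : 𝓢((X × Y) × (X × Y), EuclideanSpace ℂ ((ι × κ) × (ι × κ)))) :
    ⟪ket Φ, ket (exch Ψ)⟫_ℂ = ⟪ket (exch Φ), ket Ψ⟫_ℂ := by
  rw [← inner_exch_exch Φ, exch_exch]

/-- The exchange form `β(p, q; w, z) = ⟨p ⊗ q, S (w ⊗ z)⟩`, where `S` exchanges the second particles
of the two pairs. -/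
def exchForm (p q w z : 𝓢(X × Y, EuclideanSpace ℂ (ι × κ))) : ℂ :=
  ⟪ket (box p q), ket (exch (box w z))⟫_ℂ

/-- The exchange of the second particles commutes with the swap of the two pairs. -/
theorem exchForm_comm (p q w z : 𝓢(X × Y, EuclideanSpace ℂ (ι × κ))) :
    exchForm q p z w = exchForm p q w z := by
  have : exch (box z w) = flip₁₂ (exch (box w z)) := by
    ext x i
    exact mul_comm _ _
  rw [exchForm, exchForm, this, ← flip₁₂_box, inner_flip₁₂]

/-- On product functions, the exchange `S (a ⊗ b ⊗ c ⊗ d) = a ⊗ d ⊗ c ⊗ b` can be carried out. -/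
theorem exchForm_box_box (a c : 𝓢(X, EuclideanSpace ℂ ι)) (b d : 𝓢(Y, EuclideanSpace ℂ κ))
    (w z : 𝓢(X × Y, EuclideanSpace ℂ (ι × κ))) :
    exchForm (box a b) (box c d) w z = ⟪ket (box a d), ket w⟫_ℂ * ⟪ket (box c b), ket z⟫_ℂ := by
  rw [exchForm, inner_exch, exch_box, inner_box]

theorem exchForm_right_box_box (a c : 𝓢(X, EuclideanSpace ℂ ι)) (b d : 𝓢(Y, EuclideanSpace ℂ κ))
    (p q : 𝓢(X × Y, EuclideanSpace ℂ (ι × κ))) :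
    exchForm p q (box a b) (box c d) = ⟪ket p, ket (box a d)⟫_ℂ * ⟪ket q, ket (box c b)⟫_ℂ := by
  rw [exchForm, exch_box, inner_box]

theorem eq_zero_of_inner_ket_box [DecidableEq ι] [DecidableEq κ]
    (Θ : 𝓢(X × Y, EuclideanSpace ℂ (ι × κ))) (h : ∀ (f : 𝓢(X, EuclideanSpace ℂ ι))
      (g : 𝓢(Y, EuclideanSpace ℂ κ)), ⟪ket (box f g), ket Θ⟫_ℂ = 0) : Θ = 0 :=
  ket_injective ((eq_zero_of_inner_box _ h).trans (map_zero _).symm)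

/-- An identity between sesquilinear forms on two copies of a pair may be checked on product
functions. Contraction turns it into the vanishing of a vector of the domain, so that
the density of the product functions in the Hilbert space is enough. -/
theorem inner_box_add_eq_of_products [DecidableEq ι] [DecidableEq κ]
    {A B : Op (X × Y) (EuclideanSpace ℂ (ι × κ))} (hA : IsSymm A) (hB : IsSymm B)
    (Ψ Ψ' : 𝓢((X × Y) × (X × Y), EuclideanSpace ℂ ((ι × κ) × (ι × κ))))
    (h : ∀ (a c : 𝓢(X, EuclideanSpace ℂ ι)) (b d : 𝓢(Y, EuclideanSpace ℂ κ)),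
      ⟪ket (box (A (box a b)) (box c d)), ket Ψ⟫_ℂ + ⟪ket (box (box a b) (B (box c d))), ket Ψ⟫_ℂ =
        ⟪ket (box (box a b) (box c d)), ket Ψ'⟫_ℂ)
    (p q : 𝓢(X × Y, EuclideanSpace ℂ (ι × κ))) :
    ⟪ket (box (A p) q), ket Ψ⟫_ℂ + ⟪ket (box p (B q)), ket Ψ⟫_ℂ = ⟪ket (box p q), ket Ψ'⟫_ℂ := by
  have h1 : ∀ (p : 𝓢(X × Y, EuclideanSpace ℂ (ι × κ))) (c : 𝓢(X, EuclideanSpace ℂ ι))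
      (d : 𝓢(Y, EuclideanSpace ℂ κ)), ⟪ket (box (A p) (box c d)), ket Ψ⟫_ℂ +
        ⟪ket (box p (B (box c d))), ket Ψ⟫_ℂ = ⟪ket (box p (box c d)), ket Ψ'⟫_ℂ := by
    intro p c d
    have z := eq_zero_of_inner_ket_box (A (contr (box c d) Ψ) + contr (B (box c d)) Ψ -
      contr (box c d) Ψ') fun a b => by
        rw [map_sub, map_add, inner_sub_right, inner_add_right, ← hA, inner_contr, inner_contr,
          inner_contr, h, sub_self]
    have : ⟪ket p, ket (A (contr (box c d) Ψ) + contr (B (box c d)) Ψ -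
      contr (box c d) Ψ')⟫_ℂ = 0 := by rw [z, map_zero, inner_zero_right]
    simp only [map_add, map_sub, inner_add_right, inner_sub_right, sub_eq_zero] at this
    simpa only [← inner_contr, hA p] using this
  have z := eq_zero_of_inner_ket_box (contr₁ (A p) Ψ + B (contr₁ p Ψ) - contr₁ p Ψ') fun c d => by
    rw [map_sub, map_add, inner_sub_right, inner_add_right, ← hB, inner_contr₁, inner_contr₁,
      inner_contr₁, h1, sub_self]
  have : ⟪ket q, ket (contr₁ (A p) Ψ + B (contr₁ p Ψ) - contr₁ p Ψ')⟫_ℂ = 0 := by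
    rw [z, map_zero, inner_zero_right]
  simp only [map_add, map_sub, inner_add_right, inner_sub_right, sub_eq_zero] at this
  simpa only [← inner_contr₁, hB q] using this

/-- If `H = H₁ ⊗ I + I ⊗ H₂`, the exchange of the second particles of two pairs commutes with the
Hamiltonian `H ⊗ I + I ⊗ H` of two independent pairs. -/
theorem exchForm_sumOp [DecidableEq ι] [DecidableEq κ]
    {H : Op (X × Y) (EuclideanSpace ℂ (ι × κ))} (hH : IsSymm H)
    (H₁ : 𝓢(X, EuclideanSpace ℂ ι) → 𝓢(X, EuclideanSpace ℂ ι))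
    (H₂ : 𝓢(Y, EuclideanSpace ℂ κ) → 𝓢(Y, EuclideanSpace ℂ κ))
    (h : ∀ a b, H (box a b) = box (H₁ a) b + box a (H₂ b))
    (p q w z : 𝓢(X × Y, EuclideanSpace ℂ (ι × κ))) :
    exchForm (H p) q w z + exchForm p (H q) w z = exchForm p q (H w) z + exchForm p q w (H z) := by
  have := inner_box_add_eq_of_products hH hH (exch (box w z)) (exch (box (H w) z + box w (H z)))
    (fun a c b d => by
      rw [inner_exch, inner_exch, inner_exch, ← inner_add_left, ← ket.map_add]
      have e : exch (box (H (box a b)) (box c d)) + exch (box (box a b) (H (box c d))) =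
          box (H (box a d)) (box c b) + box (box a d) (H (box c b)) := by
        simp only [h, map_add, LinearMap.add_apply, exch_box]
        abel
      rw [e, exch_box]
      simp only [map_add, inner_add_left, inner_add_right, inner_box, hH _ w, hH _ z]) p q
  simpa only [exchForm, map_add, inner_add_right] using this

/-- An operator `Λ ⊗ I` moves through the exchange within its copy. -/
theorem exchForm_fst_op [DecidableEq ι] [DecidableEq κ]
    {A : Op (X × Y) (EuclideanSpace ℂ (ι × κ))} (hA : IsSymm A)
    (Λ : 𝓢(X, EuclideanSpace ℂ ι) → 𝓢(X, EuclideanSpace ℂ ι))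
    (h : ∀ a b, A (box a b) = box (Λ a) b) (p q w z : 𝓢(X × Y, EuclideanSpace ℂ (ι × κ))) :
    exchForm (A p) q w z = exchForm p q (A w) z := by
  have h0 : IsSymm (0 : Op (X × Y) (EuclideanSpace ℂ (ι × κ))) := fun _ _ => by simp
  have := inner_box_add_eq_of_products hA h0 (exch (box w z)) (exch (box (A w) z))
    (fun a c b d => by
      have e : exch (box (A (box a b)) (box c d)) = box (A (box a d)) (box c b) := by
        rw [h, h, exch_box]
      rw [inner_exch, inner_exch, inner_exch, e, exch_box]
      simp [inner_box, hA _ w]) p q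
  simpa [exchForm] using this

/-- An operator `I ⊗ Λ` is carried by the exchange to the other copy. -/
theorem exchForm_snd_op [DecidableEq ι] [DecidableEq κ]
    {A : Op (X × Y) (EuclideanSpace ℂ (ι × κ))} (hA : IsSymm A)
    (Λ : 𝓢(Y, EuclideanSpace ℂ κ) → 𝓢(Y, EuclideanSpace ℂ κ))
    (h : ∀ a b, A (box a b) = box a (Λ b)) (p q w z : 𝓢(X × Y, EuclideanSpace ℂ (ι × κ))) :
    exchForm (A p) q w z = exchForm p q w (A z) := by
  have h0 : IsSymm (0 : Op (X × Y) (EuclideanSpace ℂ (ι × κ))) := fun _ _ => by simp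
  have := inner_box_add_eq_of_products hA h0 (exch (box w z)) (exch (box w (A z)))
    (fun a c b d => by
      have e : exch (box (A (box a b)) (box c d)) = box (box a d) (A (box c b)) := by
        rw [h, h, exch_box]
      rw [inner_exch, inner_exch, inner_exch, e, exch_box]
      simp [inner_box, hA _ z]) p q
  simpa [exchForm] using this

end Exchange

/-! ### Unitary evolution on the domain -/

section EvolutionLemmas

set_option linter.unusedSectionVars false

variable {E F : Type} [NormedAddCommGroup E] [NormedSpace ℝ E] [FiniteDimensional ℝ E]
  [MeasureSpace E] [BorelSpace E] [(volume : Measure E).IsAddHaarMeasure]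
  [NormedAddCommGroup F] [InnerProductSpace ℂ F] [CompleteSpace F]
  {ħ : ℝ} {H : Op E F} (𝒰 : Evolution ħ H)

theorem Evolution.smooth_zero (ψ : 𝓢(E, F)) : 𝒰.smooth 0 ψ = ψ :=
  ket_injective (by rw [𝒰.ket_smooth, 𝒰.zero])

theorem Evolution.smooth_add (s t : ℝ) (ψ : 𝓢(E, F)) :
    𝒰.smooth (s + t) ψ = 𝒰.smooth s (𝒰.smooth t ψ) :=
  ket_injective (by rw [𝒰.ket_smooth, 𝒰.add, 𝒰.ket_smooth, 𝒰.ket_smooth])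

theorem Evolution.smooth_neg_smooth (t : ℝ) (ψ : 𝓢(E, F)) :
    𝒰.smooth (-t) (𝒰.smooth t ψ) = ψ := by
  rw [← 𝒰.smooth_add, neg_add_cancel, 𝒰.smooth_zero]

theorem Evolution.smooth_smooth_neg (t : ℝ) (ψ : 𝓢(E, F)) :
    𝒰.smooth t (𝒰.smooth (-t) ψ) = ψ := by
  rw [← 𝒰.smooth_add, add_neg_cancel, 𝒰.smooth_zero]

theorem Evolution.inner_smooth_smooth (t : ℝ) (φ ψ : 𝓢(E, F)) :
    ⟪ket (𝒰.smooth t φ), ket (𝒰.smooth t ψ)⟫_ℂ = ⟪ket φ, ket ψ⟫_ℂ := by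
  rw [𝒰.ket_smooth, 𝒰.ket_smooth, LinearIsometryEquiv.inner_map_map]

theorem Evolution.inner_smooth_left (t : ℝ) (φ ψ : 𝓢(E, F)) :
    ⟪ket (𝒰.smooth t φ), ket ψ⟫_ℂ = ⟪ket φ, ket (𝒰.smooth (-t) ψ)⟫_ℂ := by
  rw [← 𝒰.inner_smooth_smooth t φ, 𝒰.smooth_smooth_neg]

theorem Evolution.norm_ket_smooth (t : ℝ) (φ : 𝓢(E, F)) : ‖ket (𝒰.smooth t φ)‖ = ‖ket φ‖ := by
  rw [𝒰.ket_smooth, LinearIsometryEquiv.norm_map]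

theorem Evolution.hasDerivAt_ket_smooth (t : ℝ) (ψ : 𝓢(E, F)) :
    HasDerivAt (fun s => ket (𝒰.smooth s ψ)) (ket ((-(Complex.I / (ħ : ℂ))) • H (𝒰.smooth t ψ)))
      t := by
  rw [hasDerivAt_iff_tendsto_slope_zero]
  refine ((ket.continuous.tendsto _).comp (𝒰.schroedinger (𝒰.smooth t ψ))).congr fun s => ?_
  rw [Function.comp_apply, map_smul, map_sub, add_comm t s, 𝒰.smooth_add, ← Complex.ofReal_inv]
  rfl

variable {E' F' : Type} [NormedAddCommGroup E'] [NormedSpace ℝ E'] [FiniteDimensional ℝ E']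
  [MeasureSpace E'] [BorelSpace E'] [(volume : Measure E').IsAddHaarMeasure]
  [NormedAddCommGroup F'] [InnerProductSpace ℂ F']

/-- A bilinear map between Schwartz spaces that is bounded in the Hilbert space norms is continuous
along sequences of functions that converge in the Hilbert space norms. -/
theorem tendsto_ket_bilin (B : 𝓢(E, F) →ₗ[ℂ] 𝓢(E, F) →ₗ[ℂ] 𝓢(E', F'))
    (hB : ∀ f g, ‖ket (B f g)‖ ≤ ‖ket f‖ * ‖ket g‖) {α : Type} {l : Filter α} {f g : α → 𝓢(E, F)}
    {f₀ g₀ : 𝓢(E, F)} (hf : Tendsto (fun s => ket (f s)) l (𝓝 (ket f₀)))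
    (hg : Tendsto (fun s => ket (g s)) l (𝓝 (ket g₀))) :
    Tendsto (fun s => ket (B (f s) (g s))) l (𝓝 (ket (B f₀ g₀))) := by
  rw [tendsto_iff_norm_sub_tendsto_zero] at hf ⊢
  have hg' := tendsto_iff_norm_sub_tendsto_zero.1 hg
  have h := (hf.mul hg.norm).add (hg'.const_mul ‖ket f₀‖)
  rw [zero_mul, mul_zero, add_zero] at h
  refine squeeze_zero (fun _ => norm_nonneg _) (fun s => ?_) h
  have e : ket (B (f s) (g s)) - ket (B f₀ g₀) =
      ket (B (f s - f₀) (g s)) + ket (B f₀ (g s - g₀)) := by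
    simp only [map_sub, LinearMap.sub_apply]
    abel
  rw [e]
  refine (norm_add_le _ _).trans (add_le_add ?_ ?_)
  · simpa only [map_sub] using hB (f s - f₀) (g s)
  · simpa only [map_sub] using hB f₀ (g s - g₀)

/-- The product rule for a bilinear map that is bounded in the Hilbert space norms. -/
theorem hasDerivAt_ket_bilin (B : 𝓢(E, F) →ₗ[ℂ] 𝓢(E, F) →ₗ[ℂ] 𝓢(E', F'))
    (hB : ∀ f g, ‖ket (B f g)‖ ≤ ‖ket f‖ * ‖ket g‖) {f g : ℝ → 𝓢(E, F)} {f' g' : 𝓢(E, F)} {t : ℝ}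
    (hf : HasDerivAt (fun s => ket (f s)) (ket f') t)
    (hg : HasDerivAt (fun s => ket (g s)) (ket g') t) :
    HasDerivAt (fun s => ket (B (f s) (g s))) (ket (B f' (g t)) + ket (B (f t) g')) t := by
  have hgc : Tendsto (fun s => ket (g (t + s))) (𝓝[≠] 0) (𝓝 (ket (g t))) := by
    have h1 : Tendsto (fun s : ℝ => t + s) (𝓝[≠] 0) (𝓝 t) := by
      have : Tendsto (fun s : ℝ => t + s) (𝓝 0) (𝓝 (t + 0)) :=
        (continuous_const.add continuous_id).tendsto 0
      rw [add_zero] at this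
      exact this.mono_left nhdsWithin_le_nhds
    exact hg.continuousAt.tendsto.comp h1
  rw [hasDerivAt_iff_tendsto_slope_zero] at hf hg ⊢
  have hf1 : Tendsto (fun s : ℝ => ket ((s : ℂ)⁻¹ • (f (t + s) - f t))) (𝓝[≠] 0) (𝓝 (ket f')) := by
    refine hf.congr fun s => ?_
    rw [map_smul, map_sub, ← Complex.ofReal_inv]
    rfl
  have hg1 : Tendsto (fun s : ℝ => ket ((s : ℂ)⁻¹ • (g (t + s) - g t))) (𝓝[≠] 0) (𝓝 (ket g')) := by
    refine hg.congr fun s => ?_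
    rw [map_smul, map_sub, ← Complex.ofReal_inv]
    rfl
  refine ((tendsto_ket_bilin B hB hf1 hgc).add
    (tendsto_ket_bilin B hB tendsto_const_nhds hg1)).congr fun s => ?_
  have e : ∀ ψ : 𝓢(E', F'), s⁻¹ • ket ψ = ket ((s : ℂ)⁻¹ • ψ) := by
    intro ψ
    rw [map_smul, ← Complex.ofReal_inv]
    rfl
  rw [← map_sub, e, ← map_add]
  congr 1
  simp only [map_sub, map_smul, LinearMap.sub_apply, LinearMap.smul_apply, ← smul_add]
  congr 1
  abel

end EvolutionLemmas

section ExchangeEvolution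

set_option linter.unusedSectionVars false

variable {X Y : Type} [NormedAddCommGroup X] [NormedSpace ℝ X] [FiniteDimensional ℝ X]
  [MeasureSpace X] [BorelSpace X] [(volume : Measure X).IsAddHaarMeasure]
  [NormedAddCommGroup Y] [NormedSpace ℝ Y] [FiniteDimensional ℝ Y]
  [MeasureSpace Y] [BorelSpace Y] [(volume : Measure Y).IsAddHaarMeasure]
  {ι κ : Type} [Fintype ι] [Fintype κ]
  {ħ : ℝ} {H : Op (X × Y) (EuclideanSpace ℂ (ι × κ))} (𝒰 : Evolution ħ H)

/-- The exchange form of the evolved functions. -/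
def evolvedExchForm (t : ℝ) (p q w z : 𝓢(X × Y, EuclideanSpace ℂ (ι × κ))) : ℂ :=
  exchForm (𝒰.smooth t p) (𝒰.smooth t q) (𝒰.smooth t w) (𝒰.smooth t z)

theorem norm_ket_exch (Ψ : 𝓢((X × Y) × (X × Y), EuclideanSpace ℂ ((ι × κ) × (ι × κ)))) :
    ‖ket (exch Ψ)‖ = ‖ket Ψ‖ := by
  have h := inner_exch_exch Ψ Ψ
  simp only [inner_self_eq_norm_sq_to_K] at h
  norm_cast at h
  exact (pow_left_inj₀ (norm_nonneg _) (norm_nonneg _) two_ne_zero).1 h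

theorem hasDerivAt_evolvedExchForm (t : ℝ) (p q w z : 𝓢(X × Y, EuclideanSpace ℂ (ι × κ))) :
    HasDerivAt (fun s => evolvedExchForm 𝒰 s p q w z)
      ((Complex.I / ħ) *
        (exchForm (H (𝒰.smooth t p)) (𝒰.smooth t q) (𝒰.smooth t w) (𝒰.smooth t z) +
          exchForm (𝒰.smooth t p) (H (𝒰.smooth t q)) (𝒰.smooth t w) (𝒰.smooth t z) -
          (exchForm (𝒰.smooth t p) (𝒰.smooth t q) (H (𝒰.smooth t w)) (𝒰.smooth t z) +
          exchForm (𝒰.smooth t p) (𝒰.smooth t q) (𝒰.smooth t w) (H (𝒰.smooth t z))))) t := by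
  have h1 := hasDerivAt_ket_bilin box (fun f g => (norm_ket_box f g).le)
    (𝒰.hasDerivAt_ket_smooth t p) (𝒰.hasDerivAt_ket_smooth t q)
  have h2 := hasDerivAt_ket_bilin (box.compr₂ (exch : 𝓢((X × Y) × (X × Y), _) →L[ℂ] _).toLinearMap)
    (fun f g => by
      simpa using ((norm_ket_exch (box f g)).trans (norm_ket_box f g)).le)
    (𝒰.hasDerivAt_ket_smooth t w) (𝒰.hasDerivAt_ket_smooth t z)
  refine (h1.inner ℂ h2).congr_deriv ?_
  have hc : starRingEnd ℂ (-(Complex.I / (ħ : ℂ))) = Complex.I / ħ := by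
    simp [neg_div]
  simp only [LinearMap.compr₂_apply, ContinuousLinearMap.coe_coe, map_smul, LinearMap.smul_apply,
    inner_add_left, inner_add_right, inner_smul_left, inner_smul_right, hc, exchForm]
  ring

/-- If the Hamiltonian is `H₁ ⊗ I + I ⊗ H₂`, the exchange form is a constant of the motion. -/
theorem evolvedExchForm_of_sumOp [DecidableEq ι] [DecidableEq κ] (hH : IsSymm H)
    (H₁ : 𝓢(X, EuclideanSpace ℂ ι) → 𝓢(X, EuclideanSpace ℂ ι))
    (H₂ : 𝓢(Y, EuclideanSpace ℂ κ) → 𝓢(Y, EuclideanSpace ℂ κ))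
    (h : ∀ a b, H (box a b) = box (H₁ a) b + box a (H₂ b)) (t : ℝ)
    (p q w z : 𝓢(X × Y, EuclideanSpace ℂ (ι × κ))) :
    evolvedExchForm 𝒰 t p q w z = exchForm p q w z := by
  have hd : ∀ s, HasDerivAt (fun s => evolvedExchForm 𝒰 s p q w z) 0 s := fun s =>
    (hasDerivAt_evolvedExchForm 𝒰 s p q w z).congr_deriv (by
      rw [exchForm_sumOp hH H₁ H₂ h, sub_self, mul_zero])
  have := is_const_of_deriv_eq_zero (fun s => (hd s).differentiableAt) (fun s => (hd s).deriv) t 0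
  simpa [evolvedExchForm, 𝒰.smooth_zero] using this

/-- If the exchange form is a constant of the motion, its derivative at time `0` vanishes: the
exchange commutes with the Hamiltonian of two independent pairs. -/
theorem exchForm_hamiltonian (hħ : ħ ≠ 0)
    (h : ∀ t p q w z, evolvedExchForm 𝒰 t p q w z = exchForm p q w z)
    (p q w z : 𝓢(X × Y, EuclideanSpace ℂ (ι × κ))) :
    exchForm (H p) q w z + exchForm p (H q) w z = exchForm p q (H w) z + exchForm p q w (H z) := by
  have h1 := hasDerivAt_evolvedExchForm 𝒰 0 p q w z
  simp only [h, 𝒰.smooth_zero] at h1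
  have := h1.unique (hasDerivAt_const _ _)
  rcases mul_eq_zero.1 this with h2 | h2
  · simp [hħ] at h2
  · exact sub_eq_zero.1 h2

theorem continuous_evolvedExchForm (p q w z : 𝓢(X × Y, EuclideanSpace ℂ (ι × κ))) :
    Continuous fun t => evolvedExchForm 𝒰 t p q w z :=
  continuous_iff_continuousAt.2 fun t => (hasDerivAt_evolvedExchForm 𝒰 t p q w z).continuousAt

/-- The tensor product with a fixed second factor, as a continuous operator. -/
def boxRight (g : 𝓢(Y, EuclideanSpace ℂ κ)) :
    𝓢(X, EuclideanSpace ℂ ι) →L[ℂ] 𝓢(X × Y, EuclideanSpace ℂ (ι × κ)) where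
  toLinearMap := box.flip g
  cont := by
    refine WithSeminorms.continuous_of_continuous_comp
      (schwartz_withSeminorms ℂ (X × Y) (EuclideanSpace ℂ (ι × κ))) _ fun i => ?_
    obtain ⟨q, q', hq, -, C, hC, h⟩ := exists_seminorm_box_le (ι := ι) (κ := κ)
      (schwartzSeminormFamily ℂ (X × Y) (EuclideanSpace ℂ (ι × κ)) i)
      ((schwartz_withSeminorms ℂ (X × Y) (EuclideanSpace ℂ (ι × κ))).continuous_seminorm i)
    refine Seminorm.continuous_of_le (q := (C * q' g).toNNReal • q) ?_ fun f => ?_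
    · exact continuous_const.mul hq
    · refine (h f g).trans (le_of_eq ?_)
      rw [_root_.smul_apply, NNReal.smul_def,
        Real.coe_toNNReal _ (mul_nonneg hC (apply_nonneg q' g)), smul_eq_mul]
      ring

/-- The tensor product with a fixed first factor, as a continuous operator. -/
def boxLeft (f : 𝓢(X, EuclideanSpace ℂ ι)) :
    𝓢(Y, EuclideanSpace ℂ κ) →L[ℂ] 𝓢(X × Y, EuclideanSpace ℂ (ι × κ)) :=
  flip₁₂ ∘L boxRight f

theorem boxLeft_apply (f : 𝓢(X, EuclideanSpace ℂ ι)) (g : 𝓢(Y, EuclideanSpace ℂ κ)) :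
    boxLeft f g = box f g := flip₁₂_box g f

/-- A Hamiltonian whose evolution preserves the exchange form is a sum of Hamiltonians of the two
particles: these are obtained by contraction with unit vectors. -/
theorem exists_sum_of_evolvedExchForm [DecidableEq ι] [DecidableEq κ] (hħ : ħ ≠ 0) (hH : IsSymm H)
    (h : ∀ t p q w z, evolvedExchForm 𝒰 t p q w z = exchForm p q w z)
    {e' : 𝓢(X, EuclideanSpace ℂ ι)} {e : 𝓢(Y, EuclideanSpace ℂ κ)} (he' : ‖ket e'‖ = 1)
    (he : ‖ket e‖ = 1) :
    ∃ (H₁ : Op X (EuclideanSpace ℂ ι)) (H₂ : Op Y (EuclideanSpace ℂ κ)), IsSymm H₁ ∧ IsSymm H₂ ∧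
      ∀ a b, H (box a b) = box (H₁ a) b + box a (H₂ b) := by
  have i1 : ⟪ket e, ket e⟫_ℂ = 1 := by simp [inner_self_eq_norm_sq_to_K, he]
  have i2 : ⟪ket e', ket e'⟫_ℂ = 1 := by simp [inner_self_eq_norm_sq_to_K, he']
  set h₀ : ℂ := ⟪ket (box e' e), ket (H (box e' e))⟫_ℂ with hh₀
  have hreal : starRingEnd ℂ h₀ = h₀ := by rw [hh₀, inner_conj_symm, hH]
  let G₁ : Op X (EuclideanSpace ℂ ι) := contr e ∘L H ∘L boxRight e
  let G₂ : Op Y (EuclideanSpace ℂ κ) := contr₁ e' ∘L H ∘L boxLeft e'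
  have g1 : ∀ a c, ⟪ket a, ket (G₁ c)⟫_ℂ = ⟪ket (box a e), ket (H (box c e))⟫_ℂ :=
    fun a c => inner_contr _ _ _
  have g2 : ∀ b d, ⟪ket b, ket (G₂ d)⟫_ℂ = ⟪ket (box e' b), ket (H (box e' d))⟫_ℂ := by
    intro b d
    rw [← boxLeft_apply e' d]
    exact inner_contr₁ _ _ _
  have s1 : IsSymm G₁ := fun a c => by
    rw [g1, ← inner_conj_symm, g1, inner_conj_symm, hH]
  have s2 : IsSymm G₂ := fun a c => by
    rw [g2, ← inner_conj_symm, g2, inner_conj_symm, hH]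
  -- The expectation `h₀` of `H` in `e' ⊗ e` is contained in both contractions.
  refine ⟨G₁ - h₀ • 1, G₂, fun a c => ?_, s2, fun c d => ?_⟩
  · simp only [sub_apply, map_sub, inner_sub_left, inner_sub_right, s1 a c,
      smul_apply, one_apply_eq_self, map_smul, inner_smul_left,
      inner_smul_right, hreal]
  · have key : H (box c d) - (box ((G₁ - h₀ • 1) c) d + box c (G₂ d)) = 0 := by
      refine eq_zero_of_inner_ket_box _ fun a b => ?_
      -- In the copies `a ⊗ b`, `e' ⊗ e` on the left and `c ⊗ e`, `e' ⊗ d` on the right, the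
      -- exchange pairs `a ⊗ b` with `c ⊗ d`, and the other factors with unit vectors.
      have := exchForm_hamiltonian 𝒰 hħ h (box a b) (box e' e) (box c e) (box e' d)
      simp only [exchForm_right_box_box, exchForm_box_box, inner_box, hH _ (box c d), i1, i2,
        mul_one, one_mul, hH (box e' e), ← g1, ← g2] at this
      rw [show ⟪ket e', ket (G₁ e')⟫_ℂ = h₀ from g1 e' e'] at this
      simp only [sub_apply, map_sub, map_add, inner_sub_right, inner_add_right, inner_box, map_smul,
        smul_apply, one_apply_eq_self, inner_smul_right, LinearMap.sub_apply,
        LinearMap.smul_apply]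
      linear_combination this
    exact sub_eq_zero.1 key

end ExchangeEvolution

/-! ### The times at which the exchange form returns -/

section Period

set_option linter.unusedSectionVars false

variable {X Y : Type} [NormedAddCommGroup X] [NormedSpace ℝ X] [FiniteDimensional ℝ X]
  [MeasureSpace X] [BorelSpace X] [(volume : Measure X).IsAddHaarMeasure]
  [NormedAddCommGroup Y] [NormedSpace ℝ Y] [FiniteDimensional ℝ Y]
  [MeasureSpace Y] [BorelSpace Y] [(volume : Measure Y).IsAddHaarMeasure]
  {ι κ : Type} [Fintype ι] [Fintype κ]
  {ħ : ℝ} {H : Op (X × Y) (EuclideanSpace ℂ (ι × κ))} (𝒰 : Evolution ħ H)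

/-- The evolution of two independent pairs up to time `t` commutes with the exchange `S` of the
second particles. -/
def Preserves (t : ℝ) : Prop := ∀ p q w z, evolvedExchForm 𝒰 t p q w z = exchForm p q w z

/-- The evolution of two independent pairs up to time `t` carries the exchange `S` of the second
particles to the exchange of the first particles (`S` followed by the swap of the two pairs). -/
def Swaps (t : ℝ) : Prop := ∀ p q w z, evolvedExchForm 𝒰 t p q w z = exchForm q p w z

variable {𝒰}

theorem evolvedExchForm_add (s t : ℝ) (p q w z : 𝓢(X × Y, EuclideanSpace ℂ (ι × κ))) :
    evolvedExchForm 𝒰 (s + t) p q w z =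
      evolvedExchForm 𝒰 s (𝒰.smooth t p) (𝒰.smooth t q) (𝒰.smooth t w) (𝒰.smooth t z) := by
  simp only [evolvedExchForm, 𝒰.smooth_add]

theorem Preserves.add_preserves {s t : ℝ} (hs : Preserves 𝒰 s) (ht : Preserves 𝒰 t) :
    Preserves 𝒰 (s + t) := fun p q w z => by
  rw [evolvedExchForm_add, hs]
  exact ht p q w z

theorem Preserves.add_swaps {s t : ℝ} (hs : Preserves 𝒰 s) (ht : Swaps 𝒰 t) :
    Swaps 𝒰 (s + t) := fun p q w z => by
  rw [evolvedExchForm_add, hs]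
  exact ht p q w z

theorem Swaps.add_preserves {s t : ℝ} (hs : Swaps 𝒰 s) (ht : Preserves 𝒰 t) :
    Swaps 𝒰 (s + t) := fun p q w z => by
  rw [evolvedExchForm_add, hs]
  exact ht q p w z

theorem Swaps.add_swaps {s t : ℝ} (hs : Swaps 𝒰 s) (ht : Swaps 𝒰 t) :
    Preserves 𝒰 (s + t) := fun p q w z => by
  rw [evolvedExchForm_add, hs]
  exact ht q p w z

variable (𝒰) in
theorem preserves_zero : Preserves 𝒰 0 := fun p q w z => by
  simp only [evolvedExchForm, 𝒰.smooth_zero]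

theorem Preserves.neg {t : ℝ} (ht : Preserves 𝒰 t) : Preserves 𝒰 (-t) := fun p q w z => by
  rw [evolvedExchForm, ← ht, evolvedExchForm]
  simp only [𝒰.smooth_smooth_neg]

theorem Swaps.neg {t : ℝ} (ht : Swaps 𝒰 t) : Swaps 𝒰 (-t) := fun p q w z => by
  rw [evolvedExchForm, ← ht, evolvedExchForm]
  simp only [𝒰.smooth_smooth_neg]

variable (𝒰) in
/-- The group of the times at which the exchange of the second particles is carried to the exchange
of the second or of the first particles. -/
def returnTimes : AddSubgroup ℝ where
  carrier := {t | Preserves 𝒰 t ∨ Swaps 𝒰 t}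
  zero_mem' := .inl (preserves_zero 𝒰)
  neg_mem' := Or.imp Preserves.neg Swaps.neg
  add_mem' := by
    rintro s t (hs | hs) (ht | ht)
    · exact .inl (hs.add_preserves ht)
    · exact .inr (hs.add_swaps ht)
    · exact .inr (hs.add_preserves ht)
    · exact .inl (hs.add_swaps ht)

variable (𝒰) in
theorem isClosed_returnTimes : IsClosed (returnTimes 𝒰 : Set ℝ) := by
  have h (f : 𝓢(X × Y, EuclideanSpace ℂ (ι × κ)) → 𝓢(X × Y, EuclideanSpace ℂ (ι × κ)) →
      𝓢(X × Y, EuclideanSpace ℂ (ι × κ)) → 𝓢(X × Y, EuclideanSpace ℂ (ι × κ)) → ℂ) :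
      IsClosed {t | ∀ p q w z, evolvedExchForm 𝒰 t p q w z = f p q w z} := by
    have e : {t | ∀ p q w z, evolvedExchForm 𝒰 t p q w z = f p q w z} =
        ⋂ p, ⋂ q, ⋂ w, ⋂ z, {t | evolvedExchForm 𝒰 t p q w z = f p q w z} := by
      ext
      simp
    rw [e]
    exact isClosed_iInter fun p => isClosed_iInter fun q => isClosed_iInter fun w =>
      isClosed_iInter fun z => isClosed_eq (continuous_evolvedExchForm 𝒰 p q w z) continuous_const
  exact (h _).union (h fun p q w z => exchForm q p w z)

/-- A closed subgroup of the line is discrete unless it is the whole line, and in that case the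
exchange is preserved at each time `t = t / 2 + t / 2`. -/
theorem exists_period (h : ¬ ∀ t, Preserves 𝒰 t) :
    ∃ p : ℝ, 0 < p ∧ ∀ t, Preserves 𝒰 t ∨ Swaps 𝒰 t → ∃ k : ℤ, t = k * p := by
  rcases (returnTimes 𝒰).dense_or_cyclic with hd | ⟨a, ha⟩
  · refine absurd (fun t => ?_) h
    have hu : (t / 2) ∈ (returnTimes 𝒰 : Set ℝ) := by
      rw [← (isClosed_returnTimes 𝒰).closure_eq]
      exact hd (t / 2)
    rw [← add_halves t]
    rcases hu with hu | hu
    · exact hu.add_preserves hu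
    · exact hu.add_swaps hu
  · rw [← AddSubgroup.zmultiples_eq_closure] at ha
    have hm : ∀ t, Preserves 𝒰 t ∨ Swaps 𝒰 t → ∃ k : ℤ, k • a = t := fun t ht => by
      rw [← AddSubgroup.mem_zmultiples_iff, ← ha]
      exact ht
    rcases lt_trichotomy a 0 with h0 | h0 | h0
    · refine ⟨-a, neg_pos.2 h0, fun t ht => ?_⟩
      obtain ⟨k, rfl⟩ := hm t ht
      exact ⟨-k, by simp⟩
    · refine ⟨1, one_pos, fun t ht => ?_⟩
      obtain ⟨k, rfl⟩ := hm t ht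
      exact ⟨0, by simp [h0]⟩
    · refine ⟨a, h0, fun t ht => ?_⟩
      obtain ⟨k, rfl⟩ := hm t ht
      exact ⟨k, by simp⟩

end Period

/-! ### Bounded forms that commute with positions and momenta -/

section ScalarSchur

variable {d : ℕ}

/-- `f` vanishes outside the ball of radius `R`. -/
def SuppIn (R : ℝ) (f : 𝓢(Pos d, ℝ)) : Prop := ∀ x, R < ‖x‖ → f x = 0

theorem SuppIn.hasCompactSupport {R : ℝ} {f : 𝓢(Pos d, ℝ)} (hf : SuppIn R f) :
    HasCompactSupport f :=
  HasCompactSupport.intro (isCompact_closedBall 0 R) fun x hx => hf x (by simpa using hx)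

theorem SuppIn.mono {R S : ℝ} (h : R ≤ S) {f : 𝓢(Pos d, ℝ)} (hf : SuppIn R f) : SuppIn S f :=
  fun x hx => hf x (h.trans_lt hx)

/-- The integral of a function with vanishing weak gradient against a test function does not change
when the test function is translated: as a function of the translation it is a convolution, which is
smooth and whose gradient vanishes on a ball. -/
theorem integral_translate_eq {μ : Pos d → ℂ} (hμ : LocallyIntegrable μ) {ρ : ℝ} (hρ : 0 ≤ ρ)
    (hd : ∀ k : 𝓢(Pos d, ℝ), SuppIn (2 * ρ + 1) k → ∀ i : Fin d,
      ∫ x, (∂_{EuclideanSpace.single i (1 : ℝ)} k) x • μ x = 0)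
    {h : 𝓢(Pos d, ℝ)} (hh : SuppIn ρ h) {y : Pos d} (hy : ‖y‖ ≤ ρ) :
    ∫ x, h (x - y) • μ x = ∫ x, h x • μ x := by
  let L : ℂ →L[ℝ] ℝ →L[ℝ] ℂ := (ContinuousLinearMap.lsmul ℝ ℝ).flip
  have hL : ∀ (a : ℂ) (b : ℝ), L a b = b • a := fun _ _ => rfl
  let g : Pos d → ℝ := fun z => h (-z)
  have hgc : HasCompactSupport g :=
    hh.hasCompactSupport.comp_homeomorph (Homeomorph.neg (Pos d))
  have hgs : ContDiff ℝ 1 g := (h.smooth 1).comp contDiff_neg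
  have hF := hgc.hasFDerivAt_convolution_right L hμ hgs
  have hval : ∀ y, (MeasureTheory.convolution μ g L volume) y = ∫ x, h (x - y) • μ x := by
    intro y
    rw [MeasureTheory.convolution_def]
    simp only [hL, g, neg_sub]
  have hzero : ∀ y ∈ Metric.ball (0 : Pos d) (ρ + 1),
      (MeasureTheory.convolution μ (fderiv ℝ g) (L.precompR (Pos d)) volume) y = 0 := by
    intro y hy
    have hy' : ‖y‖ < ρ + 1 := by simpa using hy
    refine ContinuousLinearMap.coe_injective ?_
    refine (EuclideanSpace.basisFun (Fin d) ℝ).toBasis.ext fun i => ?_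
    have hk := hd (SchwartzMap.compSubConstCLM ℝ y h) (fun x hx => by
      rw [SchwartzMap.compSubConstCLM_apply]
      refine hh _ ?_
      have := norm_sub_norm_le x y
      linarith) i
    simp only [OrthonormalBasis.coe_toBasis, EuclideanSpace.basisFun_apply,
      ContinuousLinearMap.coe_coe, ContinuousLinearMap.toLinearMap_zero, LinearMap.zero_apply]
    rw [convolution_precompR_apply L hμ (hgc.fderiv ℝ) (hgs.continuous_fderiv one_ne_zero)]
    rw [MeasureTheory.convolution_def, ← neg_eq_zero, ← integral_neg, ← hk]
    refine integral_congr_ae (.of_forall fun t => ?_)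
    simp only [hL, SchwartzMap.lineDerivOp_apply_eq_fderiv]
    have e1 : fderiv ℝ g (y - t) = -fderiv ℝ h (t - y) := by
      have := (h.hasFDerivAt (-(y - t))).comp (y - t) (hasFDerivAt_id (y - t)).neg
      rw [show g = h ∘ Neg.neg from rfl, this.fderiv, neg_sub]
      ext
      simp
    have e2 : fderiv ℝ (SchwartzMap.compSubConstCLM ℝ y h) t = fderiv ℝ h (t - y) := by
      have : (SchwartzMap.compSubConstCLM ℝ y h : Pos d → ℝ) = fun x => h (x - y) := by
        ext x
        exact SchwartzMap.compSubConstCLM_apply ..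
      rw [this, fderiv_comp_sub]
    rw [e1, e2, neg_apply, neg_smul, neg_neg]
  have hc := (convex_ball (0 : Pos d) (ρ + 1)).is_const_of_fderivWithin_eq_zero (𝕜 := ℝ)
    (f := MeasureTheory.convolution μ g L volume)
    (fun z _ => (hF z).differentiableAt.differentiableWithinAt)
    (fun z hz => by
      rw [fderivWithin_of_isOpen Metric.isOpen_ball hz, (hF z).fderiv, hzero z hz])
    (x := y) (y := 0) (by simpa using hy.trans_lt (lt_add_one ρ))
    (by simpa using hρ.trans_lt (lt_add_one ρ))
  simpa only [hval, sub_zero] using hc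

/-- A function with vanishing weak gradient integrates test functions like a constant: the double
integral of `g y * h (x - y) * μ x` is symmetric in `g` and `h`. -/
theorem integral_mul_eq_of_weak_gradient {μ : Pos d → ℂ} (hμ : LocallyIntegrable μ) {ρ : ℝ}
    (hρ : 0 ≤ ρ)
    (hd : ∀ k : 𝓢(Pos d, ℝ), SuppIn (2 * ρ + 1) k → ∀ i : Fin d,
      ∫ x, (∂_{EuclideanSpace.single i (1 : ℝ)} k) x • μ x = 0)
    {h g : 𝓢(Pos d, ℝ)} (hh : SuppIn ρ h) (hg : SuppIn ρ g) :
    (∫ x, g x) • ∫ x, h x • μ x = (∫ x, h x) • ∫ x, g x • μ x := by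
  have step : ∀ {h g : 𝓢(Pos d, ℝ)}, SuppIn ρ h → SuppIn ρ g →
      ∫ y, g y • ∫ x, h (x - y) • μ x = (∫ x, g x) • ∫ x, h x • μ x := by
    intro h g hh hg
    rw [← integral_smul_const]
    refine integral_congr_ae (.of_forall fun y => ?_)
    rcases le_or_gt ‖y‖ ρ with hy | hy
    · simp only [integral_translate_eq hμ hρ hd hh hy]
    · simp only [hg y hy, zero_smul]
  have hint : ∀ {h g : 𝓢(Pos d, ℝ)}, SuppIn ρ h → SuppIn ρ g →
      Integrable (Function.uncurry fun x y => (g y * h (x - y)) • μ x)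
        ((volume : Measure (Pos d)).prod volume) := by
    intro h g hh hg
    have i1 : Integrable ((Metric.closedBall (0 : Pos d) (2 * ρ)).indicator μ) :=
      (hμ.integrableOn_isCompact (isCompact_closedBall _ _)).integrable_indicator
        measurableSet_closedBall
    have i2 := (i1.mul_prod (g.integrable (μ := volume)).ofReal).bdd_mul
      (f := fun z : Pos d × Pos d => ((h (z.1 - z.2) : ℝ) : ℂ))
      (c := SchwartzMap.seminorm ℝ 0 0 h)
      (Complex.continuous_ofReal.comp
        (h.continuous.comp (continuous_fst.sub continuous_snd))).aestronglyMeasurable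
      (.of_forall fun z => by
        rw [Complex.norm_real]
        exact SchwartzMap.norm_le_seminorm ℝ h _)
    refine i2.congr (.of_forall fun z => ?_)
    simp only [Function.uncurry, Complex.real_smul, Complex.ofReal_mul, Complex.coe_algebraMap]
    by_cases hz : z.1 ∈ Metric.closedBall (0 : Pos d) (2 * ρ)
    · rw [indicator_of_mem hz]
      ring
    · have h0 : g z.2 * h (z.1 - z.2) = 0 := by
        rcases le_or_gt ‖z.2‖ ρ with hy | hy
        · rw [hh, mul_zero]
          have := norm_sub_norm_le z.1 z.2
          have : 2 * ρ < ‖z.1‖ := by simpa using hz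
          linarith
        · rw [hg _ hy, zero_mul]
      rw [indicator_of_notMem hz, ← Complex.ofReal_mul, h0]
      simp
  rw [← step hh hg, ← step hg hh]
  have e : ∀ h g : 𝓢(Pos d, ℝ), ∫ y, g y • ∫ x, h (x - y) • μ x =
      ∫ y, ∫ x, (g y * h (x - y)) • μ x := by
    intro h g
    refine integral_congr_ae (.of_forall fun y => ?_)
    simp only [← integral_smul, smul_smul]
  rw [e, e, ← integral_integral_swap (hint hh hg), ← integral_integral_swap (hint hg hh)]
  refine integral_congr_ae (.of_forall fun x => ?_)
  simp only
  rw [← integral_sub_left_eq_self _ volume x]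
  refine integral_congr_ae (.of_forall fun y => ?_)
  simp only [sub_sub_cancel, mul_comm]

/-- A smooth cutoff: `1` on the ball of radius `R` and `0` outside the ball of radius `R + 1`. -/
theorem exists_cutoff (d : ℕ) {R : ℝ} (hR : 0 < R) : ∃ θ : 𝓢(Pos d, ℝ), SuppIn (R + 1) θ ∧
    (∀ x, ‖x‖ ≤ R → θ x = 1) ∧ 0 < ∫ x, θ x := by
  let f : ContDiffBump (0 : Pos d) := ⟨R, R + 1, hR, lt_add_one R⟩
  refine ⟨f.hasCompactSupport.toSchwartzMap f.contDiff, fun x hx => ?_, fun x hx => ?_,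
    f.integral_pos⟩
  · exact f.zero_of_le_dist (by simpa using hx.le)
  · exact f.one_of_mem_closedBall (by simpa using hx)

/-- The pointwise product of two Schwartz functions. -/
def mulFn (f g : 𝓢(Pos d, ℝ)) : 𝓢(Pos d, ℝ) := SchwartzMap.smulLeftCLM ℝ f g

theorem mulFn_apply (f g : 𝓢(Pos d, ℝ)) (x : Pos d) : mulFn f g x = f x * g x :=
  SchwartzMap.smulLeftCLM_apply_apply f.hasTemperateGrowth g x

theorem mulFn_comm (f g : 𝓢(Pos d, ℝ)) : mulFn f g = mulFn g f := by
  ext x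
  rw [mulFn_apply, mulFn_apply, mul_comm]

theorem mulFn_eq_of_cutoff {R : ℝ} {θ f : 𝓢(Pos d, ℝ)} (hθ : ∀ x, ‖x‖ ≤ R → θ x = 1)
    (hf : SuppIn R f) : mulFn θ f = f := by
  ext x
  rw [mulFn_apply]
  rcases le_or_gt ‖x‖ R with hx | hx
  · rw [hθ x hx, one_mul]
  · rw [hf x hx, mul_zero]

theorem SuppIn.mulFn {R : ℝ} {f : 𝓢(Pos d, ℝ)} (hf : SuppIn R f) (g : 𝓢(Pos d, ℝ)) :
    SuppIn R (mulFn f g) := fun x hx => by rw [mulFn_apply, hf x hx, zero_mul]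

/-- A form on test functions that commutes with multiplications and for which differentiation is
skew is a multiple of the scalar product, if it is given by integration in one argument: it is then
the integral against a function with vanishing weak gradient. -/
theorem exists_eq_mul_integral (γ : 𝓢(Pos d, ℝ) →ₗ[ℝ] 𝓢(Pos d, ℝ) →ₗ[ℝ] ℂ)
    (hm : ∀ (R : ℝ) (f u v : 𝓢(Pos d, ℝ)), SuppIn R u → SuppIn R v →
      γ (mulFn f u) v = γ u (mulFn f v))
    (hd : ∀ (i : Fin d) (u v : 𝓢(Pos d, ℝ)), γ (∂_{EuclideanSpace.single i (1 : ℝ)} u) v =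
      -γ u (∂_{EuclideanSpace.single i (1 : ℝ)} v))
    (hr : ∀ u, ∃ μ : Pos d → ℂ, LocallyIntegrable μ ∧ ∀ v, γ u v = ∫ x, v x • μ x) :
    ∃ c : ℂ, ∀ (R : ℝ) (u v : 𝓢(Pos d, ℝ)), SuppIn R u → SuppIn R v →
      γ u v = c * ((∫ x, u x * v x : ℝ) : ℂ) := by
  -- the value `γ θ k` is the same for all cutoffs `θ` that are `1` on the support of `k`
  have indep : ∀ (R S : ℝ) (θ θ' k : 𝓢(Pos d, ℝ)), SuppIn S θ → SuppIn S θ' → SuppIn R k →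
      (∀ x, ‖x‖ ≤ R → θ x = 1) → (∀ x, ‖x‖ ≤ R → θ' x = 1) → γ θ k = γ θ' k := by
    intro R S θ θ' k hS hS' hk h1 h1'
    have hk' : SuppIn (max R S) k := hk.mono (le_max_left _ _)
    have e1 := hm _ θ' θ k (hS.mono (le_max_right R S)) hk'
    have e2 := hm _ θ θ' k (hS'.mono (le_max_right R S)) hk'
    rw [mulFn_eq_of_cutoff h1' hk, mulFn_comm] at e1
    rw [mulFn_eq_of_cutoff h1 hk] at e2
    rw [← e1, ← e2]
  have key : ∀ ρ : ℝ, 0 ≤ ρ → ∃ θ : 𝓢(Pos d, ℝ), SuppIn (2 * ρ + 4) θ ∧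
      (∀ x, ‖x‖ ≤ 2 * ρ + 3 → θ x = 1) ∧ ∀ h g : 𝓢(Pos d, ℝ), SuppIn ρ h → SuppIn ρ g →
        (∫ x, g x) • γ θ h = (∫ x, h x) • γ θ g := by
    intro ρ hρ
    obtain ⟨θ, hθs, hθ, -⟩ := exists_cutoff d (R := 2 * ρ + 3) (by linarith)
    obtain ⟨η, hηs, hη, -⟩ := exists_cutoff d (R := 2 * ρ + 1) (by linarith)
    have hθs' : SuppIn (2 * ρ + 4) θ := hθs.mono (by linarith)
    refine ⟨θ, hθs', hθ, fun h g hh hg => ?_⟩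
    obtain ⟨μ, hμ, hγ⟩ := hr θ
    rw [hγ, hγ]
    refine integral_mul_eq_of_weak_gradient hμ hρ (fun k hk i => ?_) hh hg
    rw [← hγ, ← neg_neg (γ θ _), ← hd]
    have hdθ : SuppIn (2 * ρ + 4) (∂_{EuclideanSpace.single i (1 : ℝ)} θ) := fun x hx => by
      rw [SchwartzMap.lineDerivOp_apply_eq_fderiv]
      have : (θ : Pos d → ℝ) =ᶠ[𝓝 x] fun _ => 0 := by
        filter_upwards [(isOpen_lt continuous_const continuous_norm).mem_nhds hx] with z hz
        exact hθs' z hz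
      rw [this.fderiv_eq, fderiv_const_apply, zero_apply]
    -- the derivative of the cutoff vanishes on the support of `k`
    have h0 : mulFn η (∂_{EuclideanSpace.single i (1 : ℝ)} θ) = 0 := by
      ext x
      rw [mulFn_apply, zero_apply]
      rcases lt_or_ge ‖x‖ (2 * ρ + 3) with hx | hx
      · have : (θ : Pos d → ℝ) =ᶠ[𝓝 x] fun _ => 1 := by
          filter_upwards [(isOpen_lt continuous_norm continuous_const).mem_nhds hx] with z hz
          exact hθ z hz.le
        rw [SchwartzMap.lineDerivOp_apply_eq_fderiv, this.fderiv_eq, fderiv_const_apply,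
          zero_apply, mul_zero]
      · rw [hηs x (by linarith), zero_mul]
    rw [← mulFn_eq_of_cutoff hη hk, ← hm _ η _ k hdθ (hk.mono (by linarith)), h0, map_zero,
      LinearMap.zero_apply, neg_zero]
  obtain ⟨g₀, hg₀s, -, hg₀⟩ := exists_cutoff d one_pos
  have hg₀s : SuppIn 2 g₀ := hg₀s.mono (by norm_num)
  obtain ⟨θ₀, hθ₀s, hθ₀, -⟩ := key 2 (by norm_num)
  refine ⟨γ θ₀ g₀ / ((∫ x, g₀ x : ℝ) : ℂ), fun R u v hu hv => ?_⟩
  obtain ⟨θ, hθs, hθ, h⟩ := key (max R 2) (le_max_of_le_right (by norm_num))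
  have hu' : SuppIn (max R 2) u := hu.mono (le_max_left _ _)
  have hR := le_max_left R 2
  have h2 := le_max_right R 2
  have e1 : γ u v = γ θ (mulFn u v) := by
    rw [← hm (2 * max R 2 + 4) u θ v hθs (hv.mono (by linarith)), mulFn_comm,
      mulFn_eq_of_cutoff hθ (hu.mono (by linarith))]
  have e2 : γ θ g₀ = γ θ₀ g₀ := indep 2 (2 * max R 2 + 4) θ θ₀ g₀ hθs (hθ₀s.mono (by linarith)) hg₀s
    (fun x hx => hθ x (by linarith)) fun x hx => hθ₀ x (by linarith)
  have e3 := h (mulFn u v) g₀ (hu'.mulFn v) (hg₀s.mono h2)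
  rw [e2, ← e1, Complex.real_smul, Complex.real_smul] at e3
  have hne : ((∫ x, g₀ x : ℝ) : ℂ) ≠ 0 := Complex.ofReal_ne_zero.2 hg₀.ne'
  rw [div_mul_eq_mul_div, eq_div_iff hne, mul_comm, e3, mul_comm]
  simp only [mulFn_apply]

end ScalarSchur

/-! ### Schur's lemma for the attributes of a particle -/

section Schur

variable {d n : ℕ}

/-- A functional on the domain that is bounded in the Hilbert space norm is given by a vector. -/
theorem exists_inner_eq {E F : Type} [NormedAddCommGroup E] [NormedSpace ℝ E]
    [FiniteDimensional ℝ E] [MeasureSpace E] [BorelSpace E] [(volume : Measure E).IsAddHaarMeasure]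
    [NormedAddCommGroup F] [InnerProductSpace ℂ F] [CompleteSpace F]
    (l : 𝓢(E, F) →ₗ[ℂ] ℂ) (C : ℝ) (hl : ∀ ψ, ‖l ψ‖ ≤ C * ‖ket ψ‖) :
    ∃ η : L2 E F, ∀ ψ, l ψ = ⟪η, ket ψ⟫_ℂ := by
  let e := LinearEquiv.ofInjective (ket : 𝓢(E, F) →L[ℂ] L2 E F).toLinearMap ket_injective
  let g : LinearMap.range (ket : 𝓢(E, F) →L[ℂ] L2 E F).toLinearMap →L[ℂ] ℂ :=
    (l ∘ₗ e.symm.toLinearMap).mkContinuous C fun x => by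
      obtain ⟨ψ, rfl⟩ := e.surjective x
      change ‖l (e.symm (e ψ))‖ ≤ C * ‖ket ψ‖
      rw [e.symm_apply_apply]
      exact hl ψ
  obtain ⟨G, hG, -⟩ := exists_extension_norm_eq _ g
  refine ⟨(InnerProductSpace.toDual ℂ _).symm G, fun ψ => ?_⟩
  rw [InnerProductSpace.toDual_symm_apply]
  have := hG (e ψ)
  rw [show ((e ψ : LinearMap.range (ket : 𝓢(E, F) →L[ℂ] L2 E F).toLinearMap) : L2 E F) = ket ψ
    from rfl] at this
  rw [this]
  simp [g]

/-- A vector of the internal space multiplied by a real Schwartz function. -/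
def vec (e : Spin n) : 𝓢(Pos d, ℝ) →L[ℝ] 𝓢(Pos d, Spin n) :=
  SchwartzMap.postcompCLM (ContinuousLinearMap.toSpanSingleton ℝ e)

theorem vec_apply (e : Spin n) (u : 𝓢(Pos d, ℝ)) (x : Pos d) : vec e u x = u x • e := rfl

theorem inner_ket_vec (b : Spin n) (v : 𝓢(Pos d, ℝ)) (η : L2 (Pos d) (Spin n)) :
    ⟪η, ket (vec b v)⟫_ℂ = ∫ x, v x • ⟪η x, b⟫_ℂ := by
  rw [← inner_conj_symm, inner_ket_left, ← integral_conj]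
  refine integral_congr_ae (.of_forall fun x => ?_)
  simp only [inner_conj_symm, vec_apply, inner_smul_right_eq_smul]

/-- The span of the test functions with values on a line is dense. -/
theorem eq_zero_of_inner_vec {η : L2 (Pos d) (Spin n)}
    (h : ∀ (b : Spin n) (R : ℝ) (v : 𝓢(Pos d, ℝ)), SuppIn R v → ⟪η, ket (vec b v)⟫_ℂ = 0) :
    η = 0 := by
  have hη : LocallyIntegrable η volume := (Lp.memLp η).locallyIntegrable (by norm_num)
  have h0 : ∀ᵐ x, η x = 0 := by
    refine ae_eq_zero_of_integral_contDiff_smul_eq_zero hη fun g hg hgc => ?_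
    have hgi : Integrable (fun x => g x • η x) := hη.integrable_smul_left_of_hasCompactSupport
      hg.continuous hgc
    refine ext_inner_left ℂ fun b => ?_
    rw [← integral_inner hgi, inner_zero_right]
    obtain ⟨R, hR⟩ := hgc.isCompact.isBounded.subset_closedBall (0 : Pos d)
    have := h b R (hgc.toSchwartzMap hg) fun x hx => by
      refine image_eq_zero_of_notMem_tsupport (f := g) fun hx' => ?_
      have := hR hx'
      rw [mem_closedBall_zero_iff] at this
      linarith
    rw [← inner_conj_symm, map_eq_zero, inner_ket_left] at this
    rw [← this]
    refine integral_congr_ae (.of_forall fun x => ?_)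
    simp only
    rw [show vec b (hgc.toSchwartzMap hg) x = g x • b from rfl, inner_smul_right_eq_smul,
      RCLike.real_smul_eq_coe_smul (K := ℂ) (g x) b, inner_smul_left, RCLike.conj_ofReal]
    rfl
  refine Lp.ext ?_
  filter_upwards [h0, Lp.coeFn_zero (Spin n) 2 (volume : Measure (Pos d))] with x h1 h2
  rw [h1, h2]
  rfl

theorem eq_zero_of_forall_vec (l : 𝓢(Pos d, Spin n) →ₗ[ℂ] ℂ) (C : ℝ)
    (hl : ∀ ψ, ‖l ψ‖ ≤ C * ‖ket ψ‖)
    (h : ∀ (b : Spin n) (R : ℝ) (v : 𝓢(Pos d, ℝ)), SuppIn R v → l (vec b v) = 0)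
    (ψ : 𝓢(Pos d, Spin n)) : l ψ = 0 := by
  obtain ⟨η, hη⟩ := exists_inner_eq l C hl
  rw [hη, eq_zero_of_inner_vec fun b R v hv => (hη _).symm.trans (h b R v hv), inner_zero_left]

theorem norm_ket_smulLeft_le {f : Pos d → ℝ} (hf : f.HasTemperateGrowth) {ε R : ℝ}
    {w : 𝓢(Pos d, Spin n)} (hw : ∀ x, R < ‖x‖ → w x = 0) (h : ∀ x, ‖x‖ ≤ R → |f x| ≤ ε) :
    ‖ket (SchwartzMap.smulLeftCLM (Spin n) f w)‖ ≤ ε * ‖ket w‖ := by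
  refine Lp.norm_le_mul_norm_of_ae_le_mul ?_
  filter_upwards [(SchwartzMap.smulLeftCLM (Spin n) f w).coeFn_toLp 2 volume,
    w.coeFn_toLp 2 volume] with x h1 h2
  change ‖(SchwartzMap.smulLeftCLM (Spin n) f w).toLp 2 volume x‖ ≤ ε * ‖w.toLp 2 volume x‖
  rw [h1, h2, SchwartzMap.smulLeftCLM_apply_apply hf, norm_smul, Real.norm_eq_abs]
  rcases le_or_gt ‖x‖ R with hx | hx
  · exact mul_le_mul_of_nonneg_right (h x hx) (norm_nonneg _)
  · simp [hw x hx]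

variable (r : 𝓢(Pos d, Spin n) →ₗ⋆[ℂ] 𝓢(Pos d, Spin n) →ₗ[ℂ] ℂ)

/-- By the Weierstrass approximation theorem, a bounded form that commutes with the coordinates
commutes with the multiplication by functions, on functions of compact support. -/
theorem form_smulLeft {C : ℝ} (hr : ∀ w v, ‖r w v‖ ≤ C * (‖ket w‖ * ‖ket v‖))
    (hQ : ∀ i w v, r (positionOp i w) v = r w (positionOp i v)) {f : Pos d → ℝ}
    (hf : f.HasTemperateGrowth) {R : ℝ} {w v : 𝓢(Pos d, Spin n)}
    (hw : ∀ x, R < ‖x‖ → w x = 0) (hv : ∀ x, R < ‖x‖ → v x = 0) :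
    r (SchwartzMap.smulLeftCLM (Spin n) f w) v = r w (SchwartzMap.smulLeftCLM (Spin n) f v) := by
  let q : Fin d → C(Pos d, ℝ) := fun i => ⟨fun x => x i, by fun_prop⟩
  have hq : ∀ i, (q i : Pos d → ℝ).HasTemperateGrowth := fun i =>
    (EuclideanSpace.proj (𝕜 := ℝ) i : Pos d →L[ℝ] ℝ).hasTemperateGrowth
  have hpoly : ∀ g ∈ Algebra.adjoin ℝ (range q), (g : Pos d → ℝ).HasTemperateGrowth ∧
      ∀ w v, r (SchwartzMap.smulLeftCLM (Spin n) g w) v =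
        r w (SchwartzMap.smulLeftCLM (Spin n) g v) := by
    intro g hg
    induction hg using Algebra.adjoin_induction with
    | mem g hg =>
      obtain ⟨i, rfl⟩ := hg
      refine ⟨hq i, fun w v => ?_⟩
      rw [← SchwartzMap.smulLeftCLM_ofReal ℂ (hq i), ← SchwartzMap.smulLeftCLM_ofReal ℂ (hq i)]
      exact hQ i w v
    | algebraMap c =>
      have hc : ((algebraMap ℝ C(Pos d, ℝ) c : C(Pos d, ℝ)) : Pos d → ℝ) = fun _ => c := rfl
      rw [hc]
      refine ⟨by fun_prop, fun w v => ?_⟩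
      have : ∀ w : 𝓢(Pos d, Spin n), SchwartzMap.smulLeftCLM (Spin n) (fun _ : Pos d => c) w =
          (c : ℂ) • w := fun w => by
        ext x
        simp
      rw [this, this, map_smulₛₗ, map_smul, LinearMap.smul_apply, Complex.conj_ofReal]
    | add g g' _ _ hg hg' =>
      refine ⟨hg.1.add hg'.1, fun w v => ?_⟩
      have := SchwartzMap.smulLeftCLM_add (F := Spin n) hg.1 hg'.1
      rw [ContinuousMap.coe_add, this]
      simp only [add_apply, map_add, LinearMap.add_apply, hg.2, hg'.2]
    | mul g g' _ _ hg hg' =>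
      refine ⟨hg.1.mul hg'.1, fun w v => ?_⟩
      rw [ContinuousMap.coe_mul, ← SchwartzMap.smulLeftCLM_smulLeftCLM_apply hg.1 hg'.1, hg.2,
        hg'.2, SchwartzMap.smulLeftCLM_smulLeftCLM_apply hg'.1 hg.1, mul_comm]
  have hsep : (Algebra.adjoin ℝ (range q)).SeparatesPoints := by
    intro x y hxy
    obtain ⟨i, hi⟩ : ∃ i, x i ≠ y i := by
      by_contra! h
      exact hxy (PiLp.ext h)
    exact ⟨q i, ⟨q i, Algebra.subset_adjoin ⟨i, rfl⟩, rfl⟩, hi⟩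
  have hC : ∀ w v, ‖r w v‖ ≤ |C| * (‖ket w‖ * ‖ket v‖) := fun w v =>
    (hr w v).trans (mul_le_mul_of_nonneg_right (le_abs_self C) (by positivity))
  refine sub_eq_zero.1 (norm_eq_zero.1 (le_antisymm (le_of_forall_pos_le_add fun δ hδ => ?_)
    (norm_nonneg _)))
  set M := 2 * (|C| * (‖ket w‖ * ‖ket v‖)) with hM
  have hM0 : 0 ≤ M := by positivity
  obtain ⟨g, hg, hfg⟩ :=
    ContinuousMap.exists_mem_subalgebra_near_continuous_of_isCompact_of_separatesPoints hsep
      ⟨f, hf.1.continuous⟩ (isCompact_closedBall (0 : Pos d) R) (ε := δ / (M + 1)) (by positivity)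
  obtain ⟨hg1, hg2⟩ := hpoly g hg
  have hs : ∀ w : 𝓢(Pos d, Spin n), SchwartzMap.smulLeftCLM (Spin n) f w =
      SchwartzMap.smulLeftCLM (Spin n) g w +
        SchwartzMap.smulLeftCLM (Spin n) (f - (g : Pos d → ℝ)) w := fun w => by
    rw [SchwartzMap.smulLeftCLM_sub hf hg1]
    simp
  have hb : ∀ {w : 𝓢(Pos d, Spin n)}, (∀ x, R < ‖x‖ → w x = 0) →
      ‖ket (SchwartzMap.smulLeftCLM (Spin n) (f - (g : Pos d → ℝ)) w)‖ ≤
        δ / (M + 1) * ‖ket w‖ := fun hw =>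
    norm_ket_smulLeft_le (hf.sub hg1) hw fun x hx => by
      rw [Pi.sub_apply, abs_sub_comm]
      exact (hfg x (by simpa using hx)).le
  have e : r (SchwartzMap.smulLeftCLM (Spin n) f w) v - r w (SchwartzMap.smulLeftCLM (Spin n) f v) =
      r (SchwartzMap.smulLeftCLM (Spin n) (f - (g : Pos d → ℝ)) w) v -
        r w (SchwartzMap.smulLeftCLM (Spin n) (f - (g : Pos d → ℝ)) v) := by
    rw [hs w, hs v, map_add, map_add, LinearMap.add_apply, hg2]
    ring
  rw [e, zero_add]
  calc _ ≤ |C| * (δ / (M + 1) * ‖ket w‖ * ‖ket v‖) + |C| * (‖ket w‖ * (δ / (M + 1) * ‖ket v‖)) := by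
        refine (norm_sub_le _ _).trans (add_le_add ((hC _ _).trans ?_) ((hC _ _).trans ?_))
        · have := hb hw
          gcongr
        · have := hb hv
          gcongr
    _ = M * (δ / (M + 1)) := by rw [hM]; ring
    _ ≤ δ := by
        rw [mul_div_assoc', div_le_iff₀ (by positivity)]
        nlinarith

/-- An operator of the internal space is `A + i B` with `A`, `B` self-adjoint. -/
theorem form_spinOp_adjoint
    (hS : ∀ M : Spin n →L[ℂ] Spin n, IsSelfAdjoint M →
      ∀ w v, r (spinOp M w) v = r w (spinOp M v)) (M : Spin n →L[ℂ] Spin n)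
    (w v : 𝓢(Pos d, Spin n)) :
    r (spinOp (ContinuousLinearMap.adjoint M) w) v = r w (spinOp M v) := by
  set N := ContinuousLinearMap.adjoint M with hN
  have hNM : ContinuousLinearMap.adjoint N = M := ContinuousLinearMap.adjoint_adjoint M
  have h1 := hS (M + N) (by
    rw [IsSelfAdjoint, ContinuousLinearMap.star_eq_adjoint, map_add, hNM, add_comm]) w v
  have h2 := hS (Complex.I • (M - N)) (by
    rw [IsSelfAdjoint, ContinuousLinearMap.star_eq_adjoint, map_smulₛₗ, map_sub, hNM, ← hN,
      Complex.conj_I, neg_smul, ← smul_neg, neg_sub]) w v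
  have a1 : ∀ w : 𝓢(Pos d, Spin n), spinOp (M + N) w = spinOp M w + spinOp N w := fun _ => rfl
  have a2 : ∀ w : 𝓢(Pos d, Spin n), spinOp (Complex.I • (M - N)) w =
      Complex.I • (spinOp M w - spinOp N w) := fun _ => rfl
  rw [a1, a1, map_add, map_add, LinearMap.add_apply] at h1
  rw [a2, a2, map_smulₛₗ, map_smul, LinearMap.smul_apply, map_sub, map_sub, LinearMap.sub_apply,
    Complex.conj_I, smul_eq_mul, smul_eq_mul, neg_mul, ← mul_neg] at h2
  have h3 := mul_left_cancel₀ Complex.I_ne_zero h2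
  linear_combination (h1 + h3) / 2

/-- **Schur's lemma** for the positions, the momenta and the internal operators: a bounded form that
commutes with them is a multiple of the scalar product. -/
theorem exists_eq_mul_inner {C ħ : ℝ} (hħ : ħ ≠ 0)
    (hr : ∀ w v, ‖r w v‖ ≤ C * (‖ket w‖ * ‖ket v‖))
    (hQ : ∀ i w v, r (positionOp i w) v = r w (positionOp i v))
    (hP : ∀ i w v, r (momentumOp ħ i w) v = r w (momentumOp ħ i v))
    (hS : ∀ M : Spin n →L[ℂ] Spin n, IsSelfAdjoint M →
      ∀ w v, r (spinOp M w) v = r w (spinOp M v)) :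
    ∃ c : ℂ, ∀ w v, r w v = c * ⟪ket w, ket v⟫_ℂ := by
  rcases isEmpty_or_nonempty (Fin n) with hn | ⟨⟨j⟩⟩
  · refine ⟨0, fun w v => ?_⟩
    have : w = 0 := by
      ext x i
      exact isEmptyElim i
    rw [this, map_zero, LinearMap.zero_apply, zero_mul]
  -- The form is first determined on scalar functions times a fixed unit vector `e` of the internal
  -- space; the rank-one operators `|b⟩⟨e|` then give its values on all vector-valued test
  -- functions.
  set e : Spin n := EuclideanSpace.single j 1 with he
  have hee : ⟪e, e⟫_ℂ = 1 := by simp [he]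
  have hD : ∀ (i : Fin d) (w v : 𝓢(Pos d, Spin n)), r (∂_{EuclideanSpace.single i (1 : ℝ)} w) v =
      -r w (∂_{EuclideanSpace.single i (1 : ℝ)} v) := by
    intro i w v
    have h : r ((-(Complex.I * (ħ : ℂ))) • ∂_{EuclideanSpace.single i (1 : ℝ)} w) v =
      r w ((-(Complex.I * (ħ : ℂ))) • ∂_{EuclideanSpace.single i (1 : ℝ)} v) := hP i w v
    rw [map_smulₛₗ, map_smul, LinearMap.smul_apply, smul_eq_mul, smul_eq_mul, map_neg, map_mul,
      Complex.conj_I, Complex.conj_ofReal] at h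
    have h0 : Complex.I * (ħ : ℂ) ≠ 0 := mul_ne_zero Complex.I_ne_zero (by exact_mod_cast hħ)
    refine mul_left_cancel₀ h0 ?_
    linear_combination h
  have hsm : ∀ (c : ℝ) (w : 𝓢(Pos d, Spin n)), c • w = (c : ℂ) • w := fun c w => rfl
  let γ : 𝓢(Pos d, ℝ) →ₗ[ℝ] 𝓢(Pos d, ℝ) →ₗ[ℝ] ℂ := LinearMap.mk₂ ℝ
    (fun u v => r (vec e u) (vec e v))
    (fun u u' v => by rw [map_add, map_add, LinearMap.add_apply])
    (fun c u v => by
      rw [map_smul, hsm, map_smulₛₗ, LinearMap.smul_apply, Complex.conj_ofReal]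
      rfl)
    (fun u v v' => by rw [map_add, map_add])
    (fun c u v => by
      rw [map_smul, hsm, map_smul]
      rfl)
  have hγ : ∀ u v, γ u v = r (vec e u) (vec e v) := fun _ _ => rfl
  have hvec : ∀ (b : Spin n) {R : ℝ} {u : 𝓢(Pos d, ℝ)}, SuppIn R u → ∀ x, R < ‖x‖ → vec b u x = 0 :=
    fun b R u hu x hx => by rw [vec_apply, hu x hx, zero_smul]
  obtain ⟨c, hc⟩ := exists_eq_mul_integral γ
    (fun R f u v hu hv => by
      have hmul : ∀ u, vec e (mulFn f u) =
          SchwartzMap.smulLeftCLM (Spin n) f (vec e u) := fun u => by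
        ext1 x
        rw [SchwartzMap.smulLeftCLM_apply_apply f.hasTemperateGrowth, vec_apply, vec_apply,
          mulFn_apply, mul_smul]
      rw [hγ, hγ, hmul, hmul]
      exact form_smulLeft r hr hQ f.hasTemperateGrowth (hvec e hu) (hvec e hv))
    (fun i u v => by
      have hder : ∀ u : 𝓢(Pos d, ℝ), vec e (∂_{EuclideanSpace.single i (1 : ℝ)} u) =
          ∂_{EuclideanSpace.single i (1 : ℝ)} (vec e u) := fun u => by
        ext1 x
        rw [vec_apply, SchwartzMap.lineDerivOp_apply_eq_fderiv,
          SchwartzMap.lineDerivOp_apply_eq_fderiv, show (vec e u : Pos d → Spin n) =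
          fun x => u x • e from rfl, fderiv_smul_const (u.hasFDerivAt x).differentiableAt]
        rfl
      rw [hγ, hγ, hder, hder, hD])
    (fun u => by
      obtain ⟨η, hη⟩ := exists_inner_eq (r (vec e u)) (C * ‖ket (vec e u)‖)
        (fun ψ => (hr _ _).trans_eq (mul_assoc _ _ _).symm)
      refine ⟨fun x => ⟪η x, e⟫_ℂ, ?_, fun v => by rw [hγ, hη, inner_ket_vec]⟩
      have : MemLp (fun x => ⟪η x, e⟫_ℂ) 2 volume := (Lp.memLp η).inner_const e
      exact this.locallyIntegrable (by norm_num))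
  have hrank : ∀ (a b : Spin n) (u v : 𝓢(Pos d, ℝ)), r (vec a u) (vec b v) =
      ⟪a, b⟫_ℂ * r (vec e u) (vec e v) := by
    intro a b u v
    have h1 : vec b v = spinOp (InnerProductSpace.rankOne ℂ b e) (vec e v) := by
      ext1 x
      change v x • b = InnerProductSpace.rankOne ℂ b e (v x • e)
      rw [InnerProductSpace.rankOne_apply, inner_smul_right_eq_smul, hee]
      simp
    have h2 : spinOp (InnerProductSpace.rankOne ℂ e b) (vec a u) = ⟪b, a⟫_ℂ • vec e u := by
      ext1 x
      change InnerProductSpace.rankOne ℂ e b (u x • a) = ⟪b, a⟫_ℂ • (u x • e)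
      rw [InnerProductSpace.rankOne_apply, inner_smul_right_eq_smul, smul_comm, smul_assoc]
    rw [h1, ← form_spinOp_adjoint r hS, InnerProductSpace.adjoint_rankOne, h2, map_smulₛₗ,
      LinearMap.smul_apply, inner_conj_symm, smul_eq_mul]
  have htest : ∀ (a b : Spin n) (R S : ℝ) (u v : 𝓢(Pos d, ℝ)), SuppIn R u → SuppIn S v →
      r (vec a u) (vec b v) = c * ⟪ket (vec a u), ket (vec b v)⟫_ℂ := by
    intro a b R S u v hu hv
    rw [hrank, ← hγ, hc (max R S) u v (hu.mono (le_max_left _ _)) (hv.mono (le_max_right _ _)),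
      inner_ket, ← integral_complex_ofReal, mul_left_comm, mul_comm ⟪a, b⟫_ℂ,
        ← integral_mul_const]
    congr 1
    refine integral_congr_ae (.of_forall fun x => ?_)
    simp only [vec_apply, inner_smul_left_eq_smul, inner_smul_right_eq_smul, Complex.real_smul,
      Complex.ofReal_mul]
    ring
  refine ⟨c, ?_⟩
  have hcs : ∀ w v : 𝓢(Pos d, Spin n), ‖r w v - c * ⟪ket w, ket v⟫_ℂ‖ ≤
      (C + ‖c‖) * (‖ket w‖ * ‖ket v‖) := fun w v => by
    refine (norm_sub_le _ _).trans ?_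
    rw [add_mul, norm_mul]
    exact add_le_add (hr w v) (mul_le_mul_of_nonneg_left (norm_inner_le_norm _ _) (norm_nonneg _))
  -- The identity extends from test functions to the domain, in one argument after the other.
  have half : ∀ (a : Spin n) (R : ℝ) (u : 𝓢(Pos d, ℝ)), SuppIn R u → ∀ v,
      r (vec a u) v = c * ⟪ket (vec a u), ket v⟫_ℂ := by
    intro a R u hu v
    refine sub_eq_zero.1 (eq_zero_of_forall_vec
      (r (vec a u) - c • (innerₛₗ ℂ (ket (vec a u)) ∘ₗ ket.toLinearMap))
      ((C + ‖c‖) * ‖ket (vec a u)‖) (fun ψ => ?_) (fun b S v hv => ?_) v)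
    · exact (hcs _ _).trans_eq (mul_assoc _ _ _).symm
    · exact sub_eq_zero.2 (htest a b R S u v hu hv)
  intro w v
  let l : 𝓢(Pos d, Spin n) →ₗ[ℂ] ℂ :=
    { toFun := fun w => starRingEnd ℂ (r w v - c * ⟪ket w, ket v⟫_ℂ)
      map_add' := fun w w' => by
        simp only [map_add, map_sub, map_mul, LinearMap.add_apply, inner_add_left]
        ring
      map_smul' := fun k w => by
        simp only [map_smulₛₗ, map_sub, map_mul, LinearMap.smul_apply, inner_smul_left,
          smul_eq_mul, Complex.conj_conj, RingHom.id_apply]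
        ring }
  have := eq_zero_of_forall_vec l ((C + ‖c‖) * ‖ket v‖)
    (fun ψ => by
      change ‖starRingEnd ℂ _‖ ≤ _
      rw [RCLike.norm_conj, mul_assoc, mul_comm ‖ket v‖]
      exact hcs ψ v)
    (fun b R u hu => by
      change starRingEnd ℂ _ = 0
      rw [half b R u hu, sub_self, map_zero]) w
  exact sub_eq_zero.1 ((map_eq_zero (starRingEnd ℂ)).1 this)

end Schur

/-! ### Attributes of a particle, as operators of the pair -/

section Symmetric

set_option linter.unusedSectionVars false

variable {E F : Type} [NormedAddCommGroup E] [NormedSpace ℝ E] [FiniteDimensional ℝ E]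
  [MeasureSpace E] [BorelSpace E] [(volume : Measure E).IsAddHaarMeasure]
  [NormedAddCommGroup F] [InnerProductSpace ℂ F] [CompleteSpace F]

theorem isSymm_smulLeftCLM {f : E → ℝ} (hf : f.HasTemperateGrowth) :
    IsSymm (SchwartzMap.smulLeftCLM F fun x => ((f x : ℝ) : ℂ)) := by
  have h : ∀ (φ : 𝓢(E, F)) x, SchwartzMap.smulLeftCLM F (fun x => ((f x : ℝ) : ℂ)) φ x =
      ((f x : ℝ) : ℂ) • φ x := fun φ x => by
    have := SchwartzMap.smulLeftCLM_ofReal ℂ hf φ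
    refine (DFunLike.congr_fun this x).trans ?_
    rw [SchwartzMap.smulLeftCLM_apply_apply hf]
    rfl
  intro φ ψ
  rw [inner_ket, inner_ket]
  refine integral_congr_ae (.of_forall fun x => ?_)
  simp only [h, inner_smul_left, inner_smul_right, Complex.conj_ofReal]

theorem isSymm_postcompCLM {M : F →L[ℂ] F} (hM : ∀ a b, ⟪M a, b⟫_ℂ = ⟪a, M b⟫_ℂ) :
    IsSymm (SchwartzMap.postcompCLM M : Op E F) := by
  intro φ ψ
  rw [inner_ket, inner_ket]
  exact integral_congr_ae (.of_forall fun x => hM _ _)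

theorem isSymm_lineDeriv (ħ : ℝ) (m : E) :
    IsSymm ((-(Complex.I * (ħ : ℂ))) • LineDeriv.lineDerivOpCLM ℂ 𝓢(E, F) m) := by
  intro φ ψ
  let L : F →L[ℝ] F →L[ℝ] ℂ := LinearMap.mkContinuous₂
    (LinearMap.mk₂ ℝ (fun a b => ⟪a, b⟫_ℂ) (fun _ _ _ => inner_add_left _ _ _)
      (fun _ _ _ => inner_smul_left_eq_smul _ _ _) (fun _ _ _ => inner_add_right _ _ _)
      (fun _ _ _ => inner_smul_right_eq_smul _ _ _)) 1
    (fun a b => by simpa using norm_inner_le_norm a b)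
  have h : ∫ x, ⟪φ x, (∂_{m} ψ) x⟫_ℂ = -∫ x, ⟪(∂_{m} φ) x, ψ x⟫_ℂ :=
    SchwartzMap.integral_bilinear_lineDerivOp_right_eq_neg_left φ ψ L m
  have h1 : ⟪ket φ, ket (∂_{m} ψ)⟫_ℂ = -⟪ket (∂_{m} φ), ket ψ⟫_ℂ := by
    rw [inner_ket, inner_ket, h]
  change ⟪ket ((-(Complex.I * (ħ : ℂ))) • ∂_{m} φ), ket ψ⟫_ℂ =
    ⟪ket φ, ket ((-(Complex.I * (ħ : ℂ))) • ∂_{m} ψ)⟫_ℂ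
  rw [map_smul, map_smul, inner_smul_left, inner_smul_right, h1, map_neg, map_mul, Complex.conj_I,
    Complex.conj_ofReal]
  ring

end Symmetric

section Lift

set_option linter.unusedSectionVars false

variable {X Y : Type} [NormedAddCommGroup X] [NormedSpace ℝ X] [FiniteDimensional ℝ X]
  [MeasureSpace X] [BorelSpace X] [(volume : Measure X).IsAddHaarMeasure]
  [NormedAddCommGroup Y] [NormedSpace ℝ Y] [FiniteDimensional ℝ Y]
  [MeasureSpace Y] [BorelSpace Y] [(volume : Measure Y).IsAddHaarMeasure]
  {ι κ : Type} [Fintype ι] [Fintype κ]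

/-- `C = A ⊗ I`. -/
def IsLift₁ (A : Op X (EuclideanSpace ℂ ι)) (C : Op (X × Y) (EuclideanSpace ℂ (ι × κ))) : Prop :=
  IsSymm C ∧ ∀ (a : 𝓢(X, EuclideanSpace ℂ ι)) (b : 𝓢(Y, EuclideanSpace ℂ κ)),
    C (box a b) = box (A a) b

/-- `C = I ⊗ B`. -/
def IsLift₂ (B : Op Y (EuclideanSpace ℂ κ)) (C : Op (X × Y) (EuclideanSpace ℂ (ι × κ))) : Prop :=
  IsSymm C ∧ ∀ (a : 𝓢(X, EuclideanSpace ℂ ι)) (b : 𝓢(Y, EuclideanSpace ℂ κ)),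
    C (box a b) = box a (B b)

/-- Exchanging the factors turns `A ⊗ I` into `I ⊗ A`. -/
theorem IsLift₁.flip {A : Op X (EuclideanSpace ℂ ι)} {C : Op (X × Y) (EuclideanSpace ℂ (ι × κ))}
    (h : IsLift₁ A C) :
    IsLift₂ A (flip₁₂ ∘L C ∘L flip₁₂ : Op (Y × X) (EuclideanSpace ℂ (κ × ι))) := by
  have hff : ∀ Ψ : 𝓢(Y × X, EuclideanSpace ℂ (κ × ι)), flip₁₂ (flip₁₂ Ψ) = Ψ := fun Ψ => by
    ext x i
    rfl
  refine ⟨fun φ ψ => ?_, fun b a => ?_⟩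
  · simp only [ContinuousLinearMap.comp_apply]
    nth_rw 1 [← hff ψ]
    nth_rw 2 [← hff φ]
    rw [inner_flip₁₂, inner_flip₁₂, h.1]
  · simp only [ContinuousLinearMap.comp_apply]
    rw [flip₁₂_box, h.2, flip₁₂_box]

/-- `A ⊗ I` and `I ⊗ B` commute. -/
theorem comm_of_isLift [DecidableEq ι] [DecidableEq κ] {A : Op X (EuclideanSpace ℂ ι)}
    {B : Op Y (EuclideanSpace ℂ κ)} {C D : Op (X × Y) (EuclideanSpace ℂ (ι × κ))}
    (hC : IsLift₁ A C) (hD : IsLift₂ B D) (Ψ : 𝓢(X × Y, EuclideanSpace ℂ (ι × κ))) :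
    C (D Ψ) = D (C Ψ) := by
  refine sub_eq_zero.1 (eq_zero_of_inner_ket_box _ fun a b => ?_)
  rw [map_sub, inner_sub_right, ← hC.1, ← hD.1, ← hD.1, ← hC.1, hC.2, hD.2, hD.2, hC.2, sub_self]

end Lift

section ParticleLift

set_option linter.unusedSectionVars false

variable {d n : ℕ}
  {Y : Type} [NormedAddCommGroup Y] [NormedSpace ℝ Y] [FiniteDimensional ℝ Y]
  [MeasureSpace Y] [BorelSpace Y] [(volume : Measure Y).IsAddHaarMeasure]
  {κ : Type} [Fintype κ]

variable (Y κ) in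
theorem exists_isLift₁_positionOp (i : Fin d) :
    ∃ C : Op (Pos d × Y) (EuclideanSpace ℂ (Fin n × κ)), IsLift₁ (positionOp i) C := by
  have h1 : (fun x : Pos d => x i).HasTemperateGrowth :=
    (EuclideanSpace.proj (𝕜 := ℝ) i : Pos d →L[ℝ] ℝ).hasTemperateGrowth
  have h2 : (fun z : Pos d × Y => z.1 i).HasTemperateGrowth :=
    ((EuclideanSpace.proj (𝕜 := ℝ) i : Pos d →L[ℝ] ℝ) ∘L
      ContinuousLinearMap.fst ℝ (Pos d) Y).hasTemperateGrowth
  refine ⟨SchwartzMap.smulLeftCLM _ fun z : Pos d × Y => ((z.1 i : ℝ) : ℂ), isSymm_smulLeftCLM h2,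
    fun a b => ?_⟩
  ext z j
  rw [positionOp, box_apply, vecTensor_apply, SchwartzMap.smulLeftCLM_apply_apply (by fun_prop),
    SchwartzMap.smulLeftCLM_apply_apply (by fun_prop)]
  simp only [PiLp.smul_apply, smul_eq_mul, box_apply, vecTensor_apply, mul_assoc]

variable (Y κ) in
theorem exists_isLift₁_momentumOp (ħ : ℝ) (i : Fin d) :
    ∃ C : Op (Pos d × Y) (EuclideanSpace ℂ (Fin n × κ)), IsLift₁ (momentumOp ħ i) C := by
  refine ⟨(-(Complex.I * (ħ : ℂ))) • LineDeriv.lineDerivOpCLM ℂ 𝓢(Pos d × Y, _)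
    (EuclideanSpace.single i (1 : ℝ), (0 : Y)), isSymm_lineDeriv ħ _, fun a b => ?_⟩
  have h : ∂_{(EuclideanSpace.single i (1 : ℝ), (0 : Y))} (box a b) =
      box (∂_{EuclideanSpace.single i (1 : ℝ)} a) b := by
    ext1 z
    rw [SchwartzMap.lineDerivOp_apply_eq_fderiv, box_apply, SchwartzMap.lineDerivOp_apply_eq_fderiv]
    have h1 := (a.hasFDerivAt z.1).comp z hasFDerivAt_fst
    have h2 := (b.hasFDerivAt z.2).comp z hasFDerivAt_snd
    have h3 := ((vecTensor (Fin n) κ).bilinearRestrictScalars ℝ).hasFDerivAt_of_bilinear h1 h2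
    have h4 : HasFDerivAt (box a b) _ z := h3
    rw [h4.fderiv]
    simp
  change (-(Complex.I * (ħ : ℂ))) • ∂_{(EuclideanSpace.single i (1 : ℝ), (0 : Y))} (box a b) =
    box ((-(Complex.I * (ħ : ℂ))) • ∂_{EuclideanSpace.single i (1 : ℝ)} a) b
  rw [h, map_smul, LinearMap.smul_apply]

/-- The operator `M ⊗ I` on `ℂ^n ⊗ ℂ^κ`. -/
def spinLift (κ : Type) [Fintype κ] (M : Spin n →L[ℂ] Spin n) :
    EuclideanSpace ℂ (Fin n × κ) →L[ℂ] EuclideanSpace ℂ (Fin n × κ) :=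
  LinearMap.toContinuousLinearMap
    { toFun := fun v => WithLp.toLp 2 fun ik => M (WithLp.toLp 2 fun i => v (i, ik.2)) ik.1
      map_add' := fun v w => by
        ext ik
        change M (WithLp.toLp 2 fun i => (v + w) (i, ik.2)) ik.1 = _
        rw [show (WithLp.toLp 2 fun i => (v + w) (i, ik.2) : Spin n) =
          (WithLp.toLp 2 fun i => v (i, ik.2)) + WithLp.toLp 2 fun i => w (i, ik.2) from rfl,
          map_add]
        rfl
      map_smul' := fun c v => by
        ext ik
        change M (WithLp.toLp 2 fun i => (c • v) (i, ik.2)) ik.1 = _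
        rw [show (WithLp.toLp 2 fun i => (c • v) (i, ik.2) : Spin n) =
          c • (WithLp.toLp 2 fun i => v (i, ik.2)) from rfl, map_smul]
        rfl }

variable (Y κ) in
theorem exists_isLift₁_spinOp {M : Spin n →L[ℂ] Spin n} (hM : ∀ a b, ⟪M a, b⟫_ℂ = ⟪a, M b⟫_ℂ) :
    ∃ C : Op (Pos d × Y) (EuclideanSpace ℂ (Fin n × κ)), IsLift₁ (spinOp M) C := by
  refine ⟨SchwartzMap.postcompCLM (spinLift κ M), isSymm_postcompCLM fun a b => ?_, fun a b => ?_⟩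
  · have h : ∀ a b : EuclideanSpace ℂ (Fin n × κ), ⟪a, b⟫_ℂ =
        ∑ k, ⟪(WithLp.toLp 2 fun i => a (i, k) : Spin n), WithLp.toLp 2 fun i => b (i, k)⟫_ℂ := by
      intro a b
      simp only [PiLp.inner_apply, Fintype.sum_prod_type_right]
    have e : ∀ (v : EuclideanSpace ℂ (Fin n × κ)) k,
        (WithLp.toLp 2 fun i => spinLift κ M v (i, k) : Spin n) =
          M (WithLp.toLp 2 fun i => v (i, k)) := fun v k => PiLp.ext fun i => rfl
    rw [h, h]
    simp only [e, hM]
  · ext z ik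
    change M (WithLp.toLp 2 fun i => a z.1 i * b z.2 ik.2) ik.1 = M (a z.1) ik.1 * b z.2 ik.2
    rw [show (WithLp.toLp 2 fun i => a z.1 i * b z.2 ik.2 : Spin n) = b z.2 ik.2 • a z.1 by
      ext i
      simp [mul_comm], map_smul, PiLp.smul_apply, smul_eq_mul, mul_comm]

/-- The positions, the momenta and the Hermitian operators of the internal space. -/
def IsGenerator (ħ : ℝ) (A : Op (Pos d) (Spin n)) : Prop :=
  (∃ i, A = positionOp i) ∨ (∃ i, A = momentumOp ħ i) ∨
    ∃ M : Spin n →L[ℂ] Spin n, IsSelfAdjoint M ∧ A = spinOp M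

theorem inner_map_of_isSelfAdjoint {M : Spin n →L[ℂ] Spin n} (hM : IsSelfAdjoint M) (a b : Spin n) :
    ⟪M a, b⟫_ℂ = ⟪a, M b⟫_ℂ := by
  rw [← ContinuousLinearMap.adjoint_inner_left, ← ContinuousLinearMap.star_eq_adjoint, hM.star_eq]

theorem IsGenerator.isAttribute {ħ : ℝ} {A : Op (Pos d) (Spin n)} (h : IsGenerator ħ A) :
    IsAttribute ħ A := by
  rcases h with ⟨i, rfl⟩ | ⟨i, rfl⟩ | ⟨M, hM, rfl⟩
  · exact ⟨Algebra.subset_adjoin (.inl (.inl ⟨i, rfl⟩)), isSymm_smulLeftCLM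
      (EuclideanSpace.proj (𝕜 := ℝ) i : Pos d →L[ℝ] ℝ).hasTemperateGrowth⟩
  · exact ⟨Algebra.subset_adjoin (.inl (.inr ⟨i, rfl⟩)), isSymm_lineDeriv ħ _⟩
  · exact ⟨Algebra.subset_adjoin (.inr ⟨M, rfl⟩),
      isSymm_postcompCLM (inner_map_of_isSelfAdjoint hM)⟩

variable (Y κ) in
theorem IsGenerator.exists_isLift₁ {ħ : ℝ} {A : Op (Pos d) (Spin n)} (h : IsGenerator ħ A) :
    ∃ C : Op (Pos d × Y) (EuclideanSpace ℂ (Fin n × κ)), IsLift₁ A C := by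
  rcases h with ⟨i, rfl⟩ | ⟨i, rfl⟩ | ⟨M, hM, rfl⟩
  · exact exists_isLift₁_positionOp Y κ i
  · exact exists_isLift₁_momentumOp Y κ ħ i
  · exact exists_isLift₁_spinOp Y κ (inner_map_of_isSelfAdjoint hM)

variable (Y κ) in
theorem IsGenerator.exists_isLift₂ {ħ : ℝ} {A : Op (Pos d) (Spin n)} (h : IsGenerator ħ A) :
    ∃ C : Op (Y × Pos d) (EuclideanSpace ℂ (κ × Fin n)), IsLift₂ A C := by
  obtain ⟨C, hC⟩ := h.exists_isLift₁ Y κ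
  exact ⟨_, hC.flip⟩

/-- Schur's lemma, for the generators of the algebra of a particle. -/
theorem exists_eq_mul_inner_of_isGenerator {C ħ : ℝ} (hħ : ħ ≠ 0)
    (r : 𝓢(Pos d, Spin n) →ₗ⋆[ℂ] 𝓢(Pos d, Spin n) →ₗ[ℂ] ℂ)
    (hr : ∀ w v, ‖r w v‖ ≤ C * (‖ket w‖ * ‖ket v‖))
    (h : ∀ A, IsGenerator ħ A → ∀ w v, r (A w) v = r w (A v)) :
    ∃ c : ℂ, ∀ w v, r w v = c * ⟪ket w, ket v⟫_ℂ :=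
  exists_eq_mul_inner r hħ hr (fun i => h _ (.inl ⟨i, rfl⟩)) (fun i => h _ (.inr (.inl ⟨i, rfl⟩)))
    fun M hM => h _ (.inr (.inr ⟨M, hM, rfl⟩))

end ParticleLift

/-! ### From product conditions to the exchange form -/

section Sesq

variable {V V' H : Type} [AddCommGroup V] [Module ℂ V] [AddCommGroup V'] [Module ℂ V']
  [NormedAddCommGroup H] [InnerProductSpace ℂ H]

/-- The form `(w, v) ↦ ⟨L w, M v⟩`. -/
def sesq (L M : V →ₗ[ℂ] H) : V →ₗ⋆[ℂ] V →ₗ[ℂ] ℂ :=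
  LinearMap.mk₂'ₛₗ (starRingEnd ℂ) (RingHom.id ℂ) (fun w v => ⟪L w, M v⟫_ℂ)
    (fun _ _ _ => by rw [map_add, inner_add_left])
    (fun _ _ _ => by rw [map_smul, inner_smul_left, smul_eq_mul])
    (fun _ _ _ => by rw [map_add, inner_add_right])
    (fun _ _ _ => by rw [map_smul, inner_smul_right, RingHom.id_apply, smul_eq_mul])

theorem sesq_apply (L M : V →ₗ[ℂ] H) (w v : V) : sesq L M w v = ⟪L w, M v⟫_ℂ := rfl

/-- The form `(w, v) ↦ ((w', v') ↦ ⟨P w w', Q v v'⟩)`. -/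
def sesq₂ (P Q : V →ₗ[ℂ] V' →ₗ[ℂ] H) : V →ₗ⋆[ℂ] V →ₗ[ℂ] (V' →ₗ⋆[ℂ] V' →ₗ[ℂ] ℂ) :=
  LinearMap.mk₂'ₛₗ (starRingEnd ℂ) (RingHom.id ℂ) (fun w v => sesq (P w) (Q v))
    (fun _ _ _ => by
      ext
      simp only [sesq_apply, LinearMap.add_apply, map_add, inner_add_left])
    (fun _ _ _ => by
      ext
      simp only [sesq_apply, LinearMap.smul_apply, map_smul, inner_smul_left, smul_eq_mul])
    (fun _ _ _ => by
      ext
      simp only [sesq_apply, LinearMap.add_apply, map_add, inner_add_right])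
    (fun _ _ _ => by
      ext
      simp only [sesq_apply, LinearMap.smul_apply, map_smul, inner_smul_right, smul_eq_mul,
        RingHom.id_apply])

end Sesq

section Slots

set_option linter.unusedSectionVars false

variable {X Y : Type} [NormedAddCommGroup X] [NormedSpace ℝ X] [FiniteDimensional ℝ X]
  [MeasureSpace X] [BorelSpace X] [(volume : Measure X).IsAddHaarMeasure]
  [NormedAddCommGroup Y] [NormedSpace ℝ Y] [FiniteDimensional ℝ Y]
  [MeasureSpace Y] [BorelSpace Y] [(volume : Measure Y).IsAddHaarMeasure]
  {ι κ : Type} [Fintype ι] [Fintype κ]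

/-- The matrix elements of `α` vanish between product functions whose first factors are
orthogonal. -/
def ActsOnSnd (α : Op (X × Y) (EuclideanSpace ℂ (ι × κ))) : Prop :=
  ∀ w v : 𝓢(X, EuclideanSpace ℂ ι), ⟪ket w, ket v⟫_ℂ = 0 →
    ∀ w' v' : 𝓢(Y, EuclideanSpace ℂ κ), ⟪ket (box w w'), ket (α (box v v'))⟫_ℂ = 0

/-- The matrix elements of `α` vanish between product functions whose second factors are
orthogonal. -/
def ActsOnFst (α : Op (X × Y) (EuclideanSpace ℂ (ι × κ))) : Prop :=
  ∀ w' v' : 𝓢(Y, EuclideanSpace ℂ κ), ⟪ket w', ket v'⟫_ℂ = 0 →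
    ∀ w v : 𝓢(X, EuclideanSpace ℂ ι), ⟪ket (box w w'), ket (α (box v v'))⟫_ℂ = 0

/-- The tensor product followed by the inclusion in the Hilbert space. -/
def ketBox (α : Op (X × Y) (EuclideanSpace ℂ (ι × κ))) : 𝓢(X, EuclideanSpace ℂ ι) →ₗ[ℂ]
    𝓢(Y, EuclideanSpace ℂ κ) →ₗ[ℂ] L2 (X × Y) (EuclideanSpace ℂ (ι × κ)) :=
  box.compr₂ (ket ∘L α).toLinearMap

/-- The operator `Λ` is the contraction of `α` with a unit vector of the second particle. -/
theorem ActsOnFst.exists_eq [DecidableEq ι] [DecidableEq κ]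
    {α : Op (X × Y) (EuclideanSpace ℂ (ι × κ))} (h : ActsOnFst α) {e : 𝓢(Y, EuclideanSpace ℂ κ)}
    (he : ‖ket e‖ = 1) : ∃ Λ : 𝓢(X, EuclideanSpace ℂ ι) → 𝓢(X, EuclideanSpace ℂ ι),
      ∀ a b, α (box a b) = box (Λ a) b := by
  refine ⟨fun a => contr e (α (box a e)), fun a b => sub_eq_zero.1 <|
    eq_zero_of_inner_ket_box _ fun f g => ?_⟩
  have := eq_inner_smul_of_orthogonal ket.toLinearMap (sesq₂ (ketBox 1).flip (ketBox α).flip)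
    (fun w' v' h0 => by
      ext w v
      exact h w' v' h0 w v) he g b
  have := LinearMap.congr_fun₂ this f a
  rw [map_sub, inner_sub_right, inner_box, inner_contr, sub_eq_zero, mul_comm]
  exact this

/-- The operator `Λ` is the contraction of `α` with a unit vector of the first particle. -/
theorem ActsOnSnd.exists_eq [DecidableEq ι] [DecidableEq κ]
    {α : Op (X × Y) (EuclideanSpace ℂ (ι × κ))} (h : ActsOnSnd α) {e : 𝓢(X, EuclideanSpace ℂ ι)}
    (he : ‖ket e‖ = 1) : ∃ Λ : 𝓢(Y, EuclideanSpace ℂ κ) → 𝓢(Y, EuclideanSpace ℂ κ),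
      ∀ a b, α (box a b) = box a (Λ b) := by
  refine ⟨fun b => contr₁ e (α (box e b)), fun a b => sub_eq_zero.1 <|
    eq_zero_of_inner_ket_box _ fun f g => ?_⟩
  have := eq_inner_smul_of_orthogonal ket.toLinearMap (sesq₂ (ketBox 1) (ketBox α))
    (fun w v h0 => by
      ext w' v'
      exact h w v h0 w' v') he f a
  have := LinearMap.congr_fun₂ this g b
  rw [map_sub, inner_sub_right, inner_box, inner_contr₁, sub_eq_zero]
  exact this

/-- If the expectations of `α` and `β` multiply to the expectation of `α β` in all product vectors,
then, for each particle, one of `α`, `β` does not act on it. By polarization in both factors, the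
relation holds for all matrix elements between product vectors, and its right-hand side vanishes if
the factors of one particle are orthogonal. -/
theorem actsOn_of_expect_mul {α β : Op (X × Y) (EuclideanSpace ℂ (ι × κ))}
    (h : ∀ a b, ⟪ket (box a b), ket (α (box a b))⟫_ℂ * ⟪ket (box a b), ket (β (box a b))⟫_ℂ =
      ⟪ket (box a b), ket (box a b)⟫_ℂ * ⟪ket (box a b), ket (α (β (box a b)))⟫_ℂ) :
    (ActsOnSnd α ∨ ActsOnSnd β) ∧ (ActsOnFst α ∨ ActsOnFst β) := by
  have h1 : ∀ (w v : 𝓢(X, EuclideanSpace ℂ ι)) (b : 𝓢(Y, EuclideanSpace ℂ κ)),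
      ⟪ket (box w b), ket (α (box v b))⟫_ℂ * ⟪ket (box w b), ket (β (box v b))⟫_ℂ =
        ⟪ket (box w b), ket (box v b)⟫_ℂ * ⟪ket (box w b), ket (α (β (box v b)))⟫_ℂ :=
    fun w v b => mul_eq_mul_of_diag (sesq ((ketBox 1).flip b) ((ketBox α).flip b))
      (sesq ((ketBox 1).flip b) ((ketBox β).flip b)) (sesq ((ketBox 1).flip b) ((ketBox 1).flip b))
      (sesq ((ketBox 1).flip b) ((ketBox (α ∘L β)).flip b)) (fun a => h a b) w v
  have h2 : ∀ (w v : 𝓢(X, EuclideanSpace ℂ ι)) (w' v' : 𝓢(Y, EuclideanSpace ℂ κ)),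
      ⟪ket (box w w'), ket (α (box v v'))⟫_ℂ * ⟪ket (box w w'), ket (β (box v v'))⟫_ℂ =
        ⟪ket (box w w'), ket (box v v')⟫_ℂ * ⟪ket (box w w'), ket (α (β (box v v')))⟫_ℂ :=
    fun w v w' v' => mul_eq_mul_of_diag (sesq (ketBox 1 w) (ketBox α v))
      (sesq (ketBox 1 w) (ketBox β v)) (sesq (ketBox 1 w) (ketBox 1 v))
      (sesq (ketBox 1 w) (ketBox (α ∘L β) v)) (fun b => h1 w v b) w' v'
  constructor
  · refine (orthogonal_dichotomy ket.toLinearMap ket_injective (sesq₂ (ketBox 1) (ketBox α))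
      (sesq₂ (ketBox 1) (ketBox β)) fun w v h0 => eq_zero_or_eq_zero_of_mul _ _ fun w' v' => ?_).imp
      (fun hα w v h0 w' v' => LinearMap.congr_fun₂ (hα w v h0) w' v')
      (fun hα w v h0 w' v' => LinearMap.congr_fun₂ (hα w v h0) w' v')
    refine (h2 w v w' v').trans ?_
    rw [inner_box, show ⟪ket w, ket v⟫_ℂ = 0 from h0, zero_mul, zero_mul]
  · refine (orthogonal_dichotomy ket.toLinearMap ket_injective
      (sesq₂ (ketBox 1).flip (ketBox α).flip) (sesq₂ (ketBox 1).flip (ketBox β).flip)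
      fun w' v' h0 => eq_zero_or_eq_zero_of_mul _ _ fun w v => ?_).imp
      (fun hα w v h0 w' v' => LinearMap.congr_fun₂ (hα w v h0) w' v')
      (fun hα w v h0 w' v' => LinearMap.congr_fun₂ (hα w v h0) w' v')
    refine (h2 w v w' v').trans ?_
    rw [inner_box, show ⟪ket w', ket v'⟫_ℂ = 0 from h0, mul_zero, zero_mul]

/-- An operator that acts on neither particle is a multiple of the identity. -/
theorem exists_eq_smul_of_actsOn [DecidableEq ι] [DecidableEq κ]
    {α : Op (X × Y) (EuclideanSpace ℂ (ι × κ))} (hα : IsSymm α) (h₁ : ActsOnFst α)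
    (h₂ : ActsOnSnd α) {e : 𝓢(X, EuclideanSpace ℂ ι)} {e' : 𝓢(Y, EuclideanSpace ℂ κ)}
    (he : ‖ket e‖ = 1) (he' : ‖ket e'‖ = 1) : ∃ c : ℂ, ∀ Ψ, α Ψ = c • Ψ := by
  obtain ⟨Λ, hΛ⟩ := h₁.exists_eq he'
  have hval : ∀ w v w' v', ⟪ket (box w w'), ket (α (box v v'))⟫_ℂ =
      ⟪ket (box e e'), ket (α (box e e'))⟫_ℂ * ⟪ket (box w w'), ket (box v v')⟫_ℂ := by
    intro w v w' v'
    have := eq_inner_smul_of_orthogonal ket.toLinearMap (sesq₂ (ketBox 1) (ketBox α))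
      (fun w v h0 => by
        ext w' v'
        exact h₂ w v h0 w' v') he w v
    have h3 : ⟪ket (box w w'), ket (α (box v v'))⟫_ℂ = ⟪ket w, ket v⟫_ℂ *
      ⟪ket (box e w'), ket (α (box e v'))⟫_ℂ := LinearMap.congr_fun₂ this w' v'
    have i2 : ⟪ket e', ket e'⟫_ℂ = 1 := by simp [inner_self_eq_norm_sq_to_K, he']
    rw [h3, hΛ, hΛ, inner_box, inner_box, inner_box, i2]
    ring
  refine ⟨starRingEnd ℂ ⟪ket (box e e'), ket (α (box e e'))⟫_ℂ, fun Ψ => sub_eq_zero.1 <|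
    eq_zero_of_inner_ket_box _ fun f g => ?_⟩
  have hbox : α (box f g) = ⟪ket (box e e'), ket (α (box e e'))⟫_ℂ • box f g :=
    sub_eq_zero.1 <| eq_zero_of_inner_ket_box _ fun a b => by
      rw [map_sub, inner_sub_right, map_smul, inner_smul_right, hval, sub_self]
  rw [map_sub, inner_sub_right, ← hα, hbox, map_smul, map_smul, inner_smul_left, inner_smul_right,
    sub_self]

/-- A functional that is bounded in the Hilbert space norm vanishes if it vanishes on the product
functions. -/
theorem eq_zero_of_forall_box [DecidableEq ι] [DecidableEq κ]
    (l : 𝓢(X × Y, EuclideanSpace ℂ (ι × κ)) →ₗ[ℂ] ℂ) {C : ℝ} (hl : ∀ p, ‖l p‖ ≤ C * ‖ket p‖)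
    (h : ∀ a b, l (box a b) = 0) (p : 𝓢(X × Y, EuclideanSpace ℂ (ι × κ))) : l p = 0 := by
  obtain ⟨η, hη⟩ := exists_inner_eq l C hl
  have h0 : η = 0 := eq_zero_of_inner_box η fun f g => by
    rw [← inner_conj_symm, ← hη, map_eq_zero]
    exact h f g
  rw [hη p, h0, inner_zero_left]

theorem eq_zero_of_forall_box_box [DecidableEq ι] [DecidableEq κ]
    (l : 𝓢(X × Y, EuclideanSpace ℂ (ι × κ)) →ₗ[ℂ] 𝓢(X × Y, EuclideanSpace ℂ (ι × κ)) →ₗ[ℂ] ℂ)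
    {C : ℝ} (hl : ∀ p q, ‖l p q‖ ≤ C * (‖ket p‖ * ‖ket q‖))
    (h : ∀ a b c d, l (box a b) (box c d) = 0)
    (p q : 𝓢(X × Y, EuclideanSpace ℂ (ι × κ))) : l p q = 0 :=
  eq_zero_of_forall_box (l p) (C := C * ‖ket p‖) (fun q => (hl p q).trans_eq (mul_assoc _ _ _).symm)
    (fun c d => eq_zero_of_forall_box (l.flip (box c d)) (C := C * ‖ket (box c d)‖)
      (fun p => (hl p _).trans_eq (by ring)) (fun a b => h a b c d) p) q

/-- Two bounded bilinear maps whose matrix elements with fixed vectors are proportional on products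
have proportional matrix elements. -/
theorem inner_eq_of_forall_box_box [DecidableEq ι] [DecidableEq κ] {G G' : Type}
    [NormedAddCommGroup G] [InnerProductSpace ℂ G] [NormedAddCommGroup G'] [InnerProductSpace ℂ G']
    (P : 𝓢(X × Y, EuclideanSpace ℂ (ι × κ)) →ₗ[ℂ] 𝓢(X × Y, EuclideanSpace ℂ (ι × κ)) →ₗ[ℂ] G)
    (P' : 𝓢(X × Y, EuclideanSpace ℂ (ι × κ)) →ₗ[ℂ] 𝓢(X × Y, EuclideanSpace ℂ (ι × κ)) →ₗ[ℂ] G')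
    (hP : ∀ p q, ‖P p q‖ ≤ ‖ket p‖ * ‖ket q‖) (hP' : ∀ p q, ‖P' p q‖ ≤ ‖ket p‖ * ‖ket q‖)
    (ξ : G) (ξ' : G') (k : ℂ)
    (h : ∀ a b c d, ⟪ξ, P (box a b) (box c d)⟫_ℂ = k * ⟪ξ', P' (box a b) (box c d)⟫_ℂ)
    (p q : 𝓢(X × Y, EuclideanSpace ℂ (ι × κ))) : ⟪ξ, P p q⟫_ℂ = k * ⟪ξ', P' p q⟫_ℂ := by
  refine sub_eq_zero.1 (eq_zero_of_forall_box_box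
    (P.compr₂ (innerₛₗ ℂ ξ) - k • P'.compr₂ (innerₛₗ ℂ ξ')) (C := ‖ξ‖ + ‖k‖ * ‖ξ'‖)
    (fun p q => ?_) (fun a b c d => sub_eq_zero.2 (h a b c d)) p q)
  change ‖⟪ξ, P p q⟫_ℂ - k * ⟪ξ', P' p q⟫_ℂ‖ ≤ _
  refine (norm_sub_le _ _).trans ?_
  rw [norm_mul, add_mul, mul_assoc]
  gcongr
  · exact (norm_inner_le_norm _ _).trans (mul_le_mul_of_nonneg_left (hP p q) (norm_nonneg _))
  · exact (norm_inner_le_norm _ _).trans (mul_le_mul_of_nonneg_left (hP' p q) (norm_nonneg _))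

end Slots

/-! ### Schur's lemma on two copies of a pair -/

section FourSlots

/-- Schur's lemma for the form `(a, c) ↦ ⟨L a, M c⟩`, with the constant computed in a unit vector
`e`. -/
theorem inner_eq_mul_of_isGenerator {d n : ℕ} {ħ : ℝ} (hħ : ħ ≠ 0) {G : Type} [NormedAddCommGroup G]
    [InnerProductSpace ℂ G] (L M : 𝓢(Pos d, Spin n) →ₗ[ℂ] G) {C C' : ℝ}
    (hL : ∀ a, ‖L a‖ ≤ ‖ket a‖ * C) (hM : ∀ a, ‖M a‖ ≤ ‖ket a‖ * C')
    (h : ∀ A, IsGenerator ħ A → ∀ w v, ⟪L (A w), M v⟫_ℂ = ⟪L w, M (A v)⟫_ℂ)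
    {e : 𝓢(Pos d, Spin n)} (he : ‖ket e‖ = 1) (a c : 𝓢(Pos d, Spin n)) :
    ⟪L a, M c⟫_ℂ = ⟪ket a, ket c⟫_ℂ * ⟪L e, M e⟫_ℂ := by
  have i1 : ⟪ket e, ket e⟫_ℂ = 1 := by simp [inner_self_eq_norm_sq_to_K, he]
  obtain ⟨k, hk⟩ := exists_eq_mul_inner_of_isGenerator hħ (sesq L M) (C := C * C')
    (fun w v => (norm_inner_le_norm _ _).trans ((mul_le_mul (hL w) (hM v) (norm_nonneg _)
      ((norm_nonneg _).trans (hL w))).trans_eq (by ring))) h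
  have e1 := hk a c
  have e2 := hk e e
  rw [sesq_apply] at e1 e2
  rw [e1, e2, i1, mul_one, mul_comm]

variable {d₁ n₁ d₂ n₂ : ℕ} {ħ : ℝ}

/-- The bilinear map `(p, q) ↦ P p q` on two copies of a pair is dominated by the norms. -/
abbrev BoxBounded {G : Type} [NormedAddCommGroup G] [InnerProductSpace ℂ G]
    (P : 𝓢(Pos₂ d₁ d₂, Spin₂ n₁ n₂) →ₗ[ℂ] 𝓢(Pos₂ d₁ d₂, Spin₂ n₁ n₂) →ₗ[ℂ] G) : Prop :=
  ∀ p q, ‖P p q‖ ≤ ‖ket p‖ * ‖ket q‖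

variable {G : Type} [NormedAddCommGroup G] [InnerProductSpace ℂ G]
    (P Q : 𝓢(Pos₂ d₁ d₂, Spin₂ n₁ n₂) →ₗ[ℂ] 𝓢(Pos₂ d₁ d₂, Spin₂ n₁ n₂) →ₗ[ℂ] G)

/-- Schur's lemma for the first particles of the first copies: the form commutes with their
attributes, hence it factors through the inner product `⟨a, c⟩`. -/
theorem inner_eq_mul_fst_fst (hħ : ħ ≠ 0) (hP : BoxBounded P) (hQ : BoxBounded Q)
    (h : ∀ A : Op (Pos d₁) (Spin n₁), IsGenerator ħ A → ∃ C, IsLift₁ A C ∧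
      ∀ p q w z, ⟪P (C p) q, Q w z⟫_ℂ = ⟪P p q, Q (C w) z⟫_ℂ)
    {e : 𝓢(Pos d₁, Spin n₁)} (he : ‖ket e‖ = 1) (a b c d : 𝓢(Pos d₁, Spin n₁))
    (a' b' c' d' : 𝓢(Pos d₂, Spin n₂)) :
    ⟪P (box a a') (box b b'), Q (box c c') (box d d')⟫_ℂ =
      ⟪ket a, ket c⟫_ℂ * ⟪P (box e a') (box b b'), Q (box e c') (box d d')⟫_ℂ := by
  refine inner_eq_mul_of_isGenerator hħ (P.flip (box b b') ∘ₗ box.flip a')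
    (Q.flip (box d d') ∘ₗ box.flip c') (C := ‖ket a'‖ * ‖ket (box b b')‖)
    (C' := ‖ket c'‖ * ‖ket (box d d')‖) (fun x => (hP _ _).trans_eq ?_)
    (fun x => (hQ _ _).trans_eq ?_) (fun A hA w v => ?_) he a c
  · have := norm_ket_box x a'
    simp only [LinearMap.flip_apply, this]
    ring
  · have := norm_ket_box x c'
    simp only [LinearMap.flip_apply, this]
    ring
  · obtain ⟨C, hC, hC1⟩ := h A hA
    change ⟪P (box (A w) a') (box b b'), Q (box v c') (box d d')⟫_ℂ =
      ⟪P (box w a') (box b b'), Q (box (A v) c') (box d d')⟫_ℂ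
    rw [← hC.2, ← hC.2, hC1]

/-- Schur's lemma for the first particles of the second copies. -/
theorem inner_eq_mul_snd_fst (hħ : ħ ≠ 0) (hP : BoxBounded P) (hQ : BoxBounded Q)
    (h : ∀ A : Op (Pos d₁) (Spin n₁), IsGenerator ħ A → ∃ C, IsLift₁ A C ∧
      ∀ p q w z, ⟪P p (C q), Q w z⟫_ℂ = ⟪P p q, Q w (C z)⟫_ℂ)
    {e : 𝓢(Pos d₁, Spin n₁)} (he : ‖ket e‖ = 1) (a b c d : 𝓢(Pos d₁, Spin n₁))
    (a' b' c' d' : 𝓢(Pos d₂, Spin n₂)) :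
    ⟪P (box a a') (box b b'), Q (box c c') (box d d')⟫_ℂ =
      ⟪ket b, ket d⟫_ℂ * ⟪P (box a a') (box e b'), Q (box c c') (box e d')⟫_ℂ := by
  refine inner_eq_mul_of_isGenerator hħ (P (box a a') ∘ₗ box.flip b')
    (Q (box c c') ∘ₗ box.flip d') (C := ‖ket (box a a')‖ * ‖ket b'‖)
    (C' := ‖ket (box c c')‖ * ‖ket d'‖) (fun x => (hP _ _).trans_eq ?_)
    (fun x => (hQ _ _).trans_eq ?_) (fun A hA w v => ?_) he b d
  · have := norm_ket_box x b'
    simp only [LinearMap.flip_apply, this]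
    ring
  · have := norm_ket_box x d'
    simp only [LinearMap.flip_apply, this]
    ring
  · obtain ⟨C, hC, hC1⟩ := h A hA
    change ⟪P (box a a') (box (A w) b'), Q (box c c') (box v d')⟫_ℂ =
      ⟪P (box a a') (box w b'), Q (box c c') (box (A v) d')⟫_ℂ
    rw [← hC.2, ← hC.2, hC1]

/-- Schur's lemma for the second particle of the first copy on the left and of the second copy on
the right, as the exchange pairs these. -/
theorem inner_eq_mul_fst_snd (hħ : ħ ≠ 0) (hP : BoxBounded P) (hQ : BoxBounded Q)
    (h : ∀ A : Op (Pos d₂) (Spin n₂), IsGenerator ħ A → ∃ C, IsLift₂ A C ∧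
      ∀ p q w z, ⟪P (C p) q, Q w z⟫_ℂ = ⟪P p q, Q w (C z)⟫_ℂ)
    {e : 𝓢(Pos d₂, Spin n₂)} (he : ‖ket e‖ = 1) (a b c d : 𝓢(Pos d₁, Spin n₁))
    (a' b' c' d' : 𝓢(Pos d₂, Spin n₂)) :
    ⟪P (box a a') (box b b'), Q (box c c') (box d d')⟫_ℂ =
      ⟪ket a', ket d'⟫_ℂ * ⟪P (box a e) (box b b'), Q (box c c') (box d e)⟫_ℂ := by
  refine inner_eq_mul_of_isGenerator hħ (P.flip (box b b') ∘ₗ box a)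
    (Q (box c c') ∘ₗ box d) (C := ‖ket a‖ * ‖ket (box b b')‖)
    (C' := ‖ket (box c c')‖ * ‖ket d‖) (fun x => (hP _ _).trans_eq ?_)
    (fun x => (hQ _ _).trans_eq ?_) (fun A hA w v => ?_) he a' d'
  · have := norm_ket_box a x
    simp only [this]
    ring
  · have := norm_ket_box d x
    simp only [this]
    ring
  · obtain ⟨C, hC, hC1⟩ := h A hA
    change ⟪P (box a (A w)) (box b b'), Q (box c c') (box d v)⟫_ℂ =
      ⟪P (box a w) (box b b'), Q (box c c') (box d (A v))⟫_ℂ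
    rw [← hC.2, ← hC.2, hC1]

/-- Schur's lemma for the second particle of the second copy on the left and of the first copy on
the right. -/
theorem inner_eq_mul_snd_snd (hħ : ħ ≠ 0) (hP : BoxBounded P) (hQ : BoxBounded Q)
    (h : ∀ A : Op (Pos d₂) (Spin n₂), IsGenerator ħ A → ∃ C, IsLift₂ A C ∧
      ∀ p q w z, ⟪P p (C q), Q w z⟫_ℂ = ⟪P p q, Q (C w) z⟫_ℂ)
    {e : 𝓢(Pos d₂, Spin n₂)} (he : ‖ket e‖ = 1) (a b c d : 𝓢(Pos d₁, Spin n₁))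
    (a' b' c' d' : 𝓢(Pos d₂, Spin n₂)) :
    ⟪P (box a a') (box b b'), Q (box c c') (box d d')⟫_ℂ =
      ⟪ket b', ket c'⟫_ℂ * ⟪P (box a a') (box b e), Q (box c e) (box d d')⟫_ℂ := by
  refine inner_eq_mul_of_isGenerator hħ (P (box a a') ∘ₗ box b)
    (Q.flip (box d d') ∘ₗ box c) (C := ‖ket (box a a')‖ * ‖ket b‖)
    (C' := ‖ket c‖ * ‖ket (box d d')‖) (fun x => (hP _ _).trans_eq ?_)
    (fun x => (hQ _ _).trans_eq ?_) (fun A hA w v => ?_) he b' c'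
  · have := norm_ket_box b x
    simp only [this]
    ring
  · have := norm_ket_box c x
    simp only [this]
    ring
  · obtain ⟨C, hC, hC1⟩ := h A hA
    change ⟪P (box a a') (box b (A w)), Q (box c v) (box d d')⟫_ℂ =
      ⟪P (box a a') (box b w), Q (box c (A v)) (box d d')⟫_ℂ
    rw [← hC.2, ← hC.2, hC1]

/-- Bounded forms on two copies of a pair are proportional as soon as they are proportional for
product wave functions, as the span of these is dense. -/
theorem inner_eq_mul_inner_of_box {G' : Type} [NormedAddCommGroup G'] [InnerProductSpace ℂ G']
    (B S : 𝓢(Pos₂ d₁ d₂, Spin₂ n₁ n₂) →ₗ[ℂ] 𝓢(Pos₂ d₁ d₂, Spin₂ n₁ n₂) →ₗ[ℂ] G')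
    (hP : BoxBounded P) (hQ : BoxBounded Q) (hB : BoxBounded B) (hS : BoxBounded S) (k : ℂ)
    (hk : ∀ a a' b b' c c' d d', ⟪P (box a a') (box b b'), Q (box c c') (box d d')⟫_ℂ =
      k * ⟪B (box a a') (box b b'), S (box c c') (box d d')⟫_ℂ)
    (p q w z : 𝓢(Pos₂ d₁ d₂, Spin₂ n₁ n₂)) : ⟪P p q, Q w z⟫_ℂ = k * ⟪B p q, S w z⟫_ℂ := by
  have step : ∀ a a' b b' w z, ⟪P (box a a') (box b b'), Q w z⟫_ℂ =
      k * ⟪B (box a a') (box b b'), S w z⟫_ℂ := fun a a' b b' w z =>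
    inner_eq_of_forall_box_box Q S hQ hS (P (box a a') (box b b')) (B (box a a') (box b b')) k
      (hk a a' b b') w z
  have := inner_eq_of_forall_box_box P B hP hB (Q w z) (S w z) (starRingEnd ℂ k)
    (fun a a' b b' => by
      rw [← inner_conj_symm, step, map_mul, inner_conj_symm]) p q
  rw [← inner_conj_symm, this, map_mul, Complex.conj_conj, inner_conj_symm]

/-- Schur's lemma in each of the four factors: up to a constant, the exchange form is the only
bounded form on two copies of a pair that is compatible with the attributes of the particles in the
same way. -/
theorem exists_eq_mul_exchForm (hħ : ħ ≠ 0) (hP : BoxBounded P) (hQ : BoxBounded Q)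
    (h₁ : ∀ A : Op (Pos d₁) (Spin n₁), IsGenerator ħ A → ∃ C, IsLift₁ A C ∧
      (∀ p q w z, ⟪P (C p) q, Q w z⟫_ℂ = ⟪P p q, Q (C w) z⟫_ℂ) ∧
      ∀ p q w z, ⟪P p (C q), Q w z⟫_ℂ = ⟪P p q, Q w (C z)⟫_ℂ)
    (h₂ : ∀ B : Op (Pos d₂) (Spin n₂), IsGenerator ħ B → ∃ C, IsLift₂ B C ∧
      (∀ p q w z, ⟪P (C p) q, Q w z⟫_ℂ = ⟪P p q, Q w (C z)⟫_ℂ) ∧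
      ∀ p q w z, ⟪P p (C q), Q w z⟫_ℂ = ⟪P p q, Q (C w) z⟫_ℂ)
    {e : 𝓢(Pos d₁, Spin n₁)} {e' : 𝓢(Pos d₂, Spin n₂)} (he : ‖ket e‖ = 1) (he' : ‖ket e'‖ = 1) :
    ∃ k : ℂ, ∀ p q w z, ⟪P p q, Q w z⟫_ℂ = k * exchForm p q w z := by
  let k : ℂ := ⟪P (box e e') (box e e'), Q (box e e') (box e e')⟫_ℂ
  have hk : ∀ a a' b b' c c' d d', ⟪P (box a a') (box b b'), Q (box c c') (box d d')⟫_ℂ =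
      k * exchForm (box a a') (box b b') (box c c') (box d d') := by
    intro a a' b b' c c' d d'
    rw [inner_eq_mul_fst_fst P Q hħ hP hQ
        (fun A hA => (h₁ A hA).imp fun C hC => ⟨hC.1, hC.2.1⟩) he,
      inner_eq_mul_snd_fst P Q hħ hP hQ (fun A hA => (h₁ A hA).imp fun C hC => ⟨hC.1, hC.2.2⟩) he,
      inner_eq_mul_fst_snd P Q hħ hP hQ (fun A hA => (h₂ A hA).imp fun C hC => ⟨hC.1, hC.2.1⟩) he',
      inner_eq_mul_snd_snd P Q hħ hP hQ (fun A hA => (h₂ A hA).imp fun C hC => ⟨hC.1, hC.2.2⟩) he',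
      exchForm_box_box, inner_box, inner_box]
    ring
  have hB : ∀ p q : 𝓢(Pos₂ d₁ d₂, Spin₂ n₁ n₂), ‖ket (box p q)‖ ≤ ‖ket p‖ * ‖ket q‖ :=
    fun p q => (norm_ket_box p q).le
  have hS : ∀ p q : 𝓢(Pos₂ d₁ d₂, Spin₂ n₁ n₂), ‖ket (exch (box p q))‖ ≤ ‖ket p‖ * ‖ket q‖ :=
    fun p q => ((norm_ket_exch _).trans (norm_ket_box p q)).le
  exact ⟨k, inner_eq_mul_inner_of_box P Q (box.compr₂ ket.toLinearMap)
    (box.compr₂ (ket ∘L exch).toLinearMap) hP hQ hB hS k hk⟩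

end FourSlots

/-! ### Evolution of the attributes -/

section Heisenberg

/-- If all generators of the algebra of a particle are scalars, its Hilbert space has dimension at
most one. -/
theorem eq_zero_or_eq_zero_of_isGenerator_scalar {d n : ℕ} {ħ : ℝ} (hħ : ħ ≠ 0)
    (h : ∀ A : Op (Pos d) (Spin n), IsGenerator ħ A → ∃ c : ℂ, ∀ a, A a = c • a)
    {e : 𝓢(Pos d, Spin n)} (he : ‖ket e‖ = 1) {w v : 𝓢(Pos d, Spin n)}
    (h0 : ⟪ket w, ket v⟫_ℂ = 0) : w = 0 ∨ v = 0 := by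
  -- The form `(x, y) ↦ ⟨x, v⟩ ⟨w, y⟩` commutes with the generators.
  have key := inner_eq_mul_of_isGenerator (ħ := ħ) hħ
    ((innerₛₗ ℂ (ket v)) ∘ₗ ket.toLinearMap) ((innerₛₗ ℂ (ket w)) ∘ₗ ket.toLinearMap)
    (C := ‖ket v‖) (C' := ‖ket w‖)
    (fun a => (norm_inner_le_norm (ket v) (ket a)).trans_eq (mul_comm _ _))
    (fun a => (norm_inner_le_norm (ket w) (ket a)).trans_eq (mul_comm _ _))
    (fun A hA x y => by
      obtain ⟨c, hc⟩ := h A hA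
      change ⟪⟪ket v, ket (A x)⟫_ℂ, ⟪ket w, ket y⟫_ℂ⟫_ℂ = ⟪⟪ket v, ket x⟫_ℂ, ⟪ket w, ket (A y)⟫_ℂ⟫_ℂ
      rw [← hA.isAttribute.2, hc v, hc y]
      simp only [map_smul, inner_smul_left, inner_smul_right, map_mul, Complex.conj_conj,
        RCLike.inner_apply]
      ring) he v w
  have h1 : ⟪⟪ket v, ket v⟫_ℂ, ⟪ket w, ket w⟫_ℂ⟫_ℂ = 0 := by
    refine Eq.trans key ?_
    rw [← inner_conj_symm (ket v), h0, map_zero, zero_mul]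
  rw [RCLike.inner_apply, mul_eq_zero, map_eq_zero, inner_self_eq_zero, inner_self_eq_zero] at h1
  exact h1.imp (fun h => ket_injective (h.trans (map_zero _).symm))
    fun h => ket_injective (h.trans (map_zero _).symm)

variable {d₁ n₁ d₂ n₂ : ℕ}

theorem eq_of_box_eq_left {a b : 𝓢(Pos d₁, Spin n₁)} {e' : 𝓢(Pos d₂, Spin n₂)} (he' : ‖ket e'‖ = 1)
    (h : box a e' = box b e') : a = b := by
  have h1 : ‖ket (a - b)‖ * ‖ket e'‖ = 0 := by
    rw [← norm_ket_box, map_sub, LinearMap.sub_apply, h, sub_self, map_zero, norm_zero]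
  rw [he', mul_one, norm_eq_zero] at h1
  exact sub_eq_zero.1 (ket_injective (h1.trans (map_zero _).symm))

theorem eq_of_box_eq_right {e : 𝓢(Pos d₁, Spin n₁)} {a b : 𝓢(Pos d₂, Spin n₂)} (he : ‖ket e‖ = 1)
    (h : box e a = box e b) : a = b := by
  have h1 : ‖ket e‖ * ‖ket (a - b)‖ = 0 := by
    rw [← norm_ket_box, map_sub, h, sub_self, map_zero, norm_zero]
  rw [he, one_mul, norm_eq_zero] at h1
  exact sub_eq_zero.1 (ket_injective (h1.trans (map_zero _).symm))

variable {ħ : ℝ} {H : Op (Pos₂ d₁ d₂) (Spin₂ n₁ n₂)} (𝒰 : Evolution ħ H)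

/-- The operator `U(t)* C U(t)` of the Heisenberg picture. -/
def heisenberg (t : ℝ) (C : Op (Pos₂ d₁ d₂) (Spin₂ n₁ n₂)) : Op (Pos₂ d₁ d₂) (Spin₂ n₁ n₂) :=
  𝒰.smooth (-t) ∘L C ∘L 𝒰.smooth t

theorem heisenberg_apply (t : ℝ) (C : Op (Pos₂ d₁ d₂) (Spin₂ n₁ n₂))
    (Ψ : 𝓢(Pos₂ d₁ d₂, Spin₂ n₁ n₂)) :
    heisenberg 𝒰 t C Ψ = 𝒰.smooth (-t) (C (𝒰.smooth t Ψ)) := rfl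

theorem smooth_neg_apply (t : ℝ) (C : Op (Pos₂ d₁ d₂) (Spin₂ n₁ n₂))
    (Ψ : 𝓢(Pos₂ d₁ d₂, Spin₂ n₁ n₂)) :
    𝒰.smooth (-t) (C Ψ) = heisenberg 𝒰 t C (𝒰.smooth (-t) Ψ) := by
  rw [heisenberg_apply, 𝒰.smooth_smooth_neg]

theorem inner_heisenberg (t : ℝ) (C : Op (Pos₂ d₁ d₂) (Spin₂ n₁ n₂))
    (Φ Ψ : 𝓢(Pos₂ d₁ d₂, Spin₂ n₁ n₂)) :
    ⟪ket Φ, ket (heisenberg 𝒰 t C Ψ)⟫_ℂ = ⟪ket (𝒰.smooth t Φ), ket (C (𝒰.smooth t Ψ))⟫_ℂ := by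
  rw [heisenberg_apply, ← 𝒰.inner_smooth_left]

theorem isSymm_heisenberg (t : ℝ) {C : Op (Pos₂ d₁ d₂) (Spin₂ n₁ n₂)} (hC : IsSymm C) :
    IsSymm (heisenberg 𝒰 t C) := fun Φ Ψ => by
  rw [inner_heisenberg, ← inner_conj_symm, inner_heisenberg, inner_conj_symm, hC]

/-- The evolved exchange form as the form `⟨P p q, Q w z⟩` of two bounded bilinear maps. -/
theorem exists_inner_eq_evolvedExchForm (t : ℝ) :
    ∃ P Q : 𝓢(Pos₂ d₁ d₂, Spin₂ n₁ n₂) →ₗ[ℂ] 𝓢(Pos₂ d₁ d₂, Spin₂ n₁ n₂) →ₗ[ℂ]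
      L2 (Pos₂ d₁ d₂ × Pos₂ d₁ d₂) (EuclideanSpace ℂ ((Fin n₁ × Fin n₂) × (Fin n₁ × Fin n₂))),
      BoxBounded P ∧ BoxBounded Q ∧ ∀ p q w z, ⟪P p q, Q w z⟫_ℂ = evolvedExchForm 𝒰 t p q w z := by
  refine ⟨(box.compl₁₂ (𝒰.smooth t).toLinearMap (𝒰.smooth t).toLinearMap).compr₂ ket.toLinearMap,
    (box.compl₁₂ (𝒰.smooth t).toLinearMap (𝒰.smooth t).toLinearMap).compr₂
      (ket ∘L exch).toLinearMap, fun p q => ?_, fun p q => ?_, fun p q w z => rfl⟩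
  · rw [← 𝒰.norm_ket_smooth t p, ← 𝒰.norm_ket_smooth t q]
    exact (norm_ket_box _ _).le
  · rw [← 𝒰.norm_ket_smooth t p, ← 𝒰.norm_ket_smooth t q]
    exact ((norm_ket_exch _).trans (norm_ket_box _ _)).le

theorem evolvedExchForm_comm (t : ℝ) (p q w z : 𝓢(Pos₂ d₁ d₂, Spin₂ n₁ n₂)) :
    evolvedExchForm 𝒰 t q p z w = evolvedExchForm 𝒰 t p q w z :=
  exchForm_comm _ _ _ _

/-- An observable that evolves to an observable of the first particle moves through the evolved
exchange form within its copy. -/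
theorem evolvedExchForm_of_actsOnFst {t : ℝ} {C : Op (Pos₂ d₁ d₂) (Spin₂ n₁ n₂)} (hC : IsSymm C)
    (h : ActsOnFst (heisenberg 𝒰 t C)) {e' : 𝓢(Pos d₂, Spin n₂)} (he' : ‖ket e'‖ = 1)
    (p q w z : 𝓢(Pos₂ d₁ d₂, Spin₂ n₁ n₂)) :
    evolvedExchForm 𝒰 (-t) (C p) q w z = evolvedExchForm 𝒰 (-t) p q (C w) z := by
  obtain ⟨Λ, hΛ⟩ := h.exists_eq he'
  rw [evolvedExchForm, evolvedExchForm, smooth_neg_apply, smooth_neg_apply,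
    exchForm_fst_op (isSymm_heisenberg 𝒰 t hC) Λ hΛ]

/-- An observable that evolves to an observable of the second particle moves through the evolved
exchange form to the other copy. -/
theorem evolvedExchForm_of_actsOnSnd {t : ℝ} {C : Op (Pos₂ d₁ d₂) (Spin₂ n₁ n₂)} (hC : IsSymm C)
    (h : ActsOnSnd (heisenberg 𝒰 t C)) {e : 𝓢(Pos d₁, Spin n₁)} (he : ‖ket e‖ = 1)
    (p q w z : 𝓢(Pos₂ d₁ d₂, Spin₂ n₁ n₂)) :
    evolvedExchForm 𝒰 (-t) (C p) q w z = evolvedExchForm 𝒰 (-t) p q w (C z) := by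
  obtain ⟨Λ, hΛ⟩ := h.exists_eq he
  rw [evolvedExchForm, evolvedExchForm, smooth_neg_apply, smooth_neg_apply,
    exchForm_snd_op (isSymm_heisenberg 𝒰 t hC) Λ hΛ]

/-- The evolved exchange form is a multiple of the exchange form as soon as each particle's
observables evolve to observables of that particle. -/
theorem exists_preserves_const (hħ : ħ ≠ 0) (t : ℝ)
    (h₁ : ∀ A : Op (Pos d₁) (Spin n₁), IsGenerator ħ A → ∀ C, IsLift₁ A C →
      ActsOnFst (heisenberg 𝒰 t C))
    (h₂ : ∀ B : Op (Pos d₂) (Spin n₂), IsGenerator ħ B → ∀ C, IsLift₂ B C →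
      ActsOnSnd (heisenberg 𝒰 t C))
    {e : 𝓢(Pos d₁, Spin n₁)} {e' : 𝓢(Pos d₂, Spin n₂)} (he : ‖ket e‖ = 1) (he' : ‖ket e'‖ = 1) :
    ∃ k : ℂ, ∀ p q w z, evolvedExchForm 𝒰 (-t) p q w z = k * exchForm p q w z := by
  obtain ⟨P, Q, hP, hQ, hPQ⟩ := exists_inner_eq_evolvedExchForm 𝒰 (-t)
  have H₁ : ∀ A : Op (Pos d₁) (Spin n₁), IsGenerator ħ A → ∃ C, IsLift₁ A C ∧
      (∀ p q w z, ⟪P (C p) q, Q w z⟫_ℂ = ⟪P p q, Q (C w) z⟫_ℂ) ∧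
      ∀ p q w z, ⟪P p (C q), Q w z⟫_ℂ = ⟪P p q, Q w (C z)⟫_ℂ := fun A hA => by
    obtain ⟨C, hC⟩ := hA.exists_isLift₁ (Pos d₂) (Fin n₂)
    have key := evolvedExchForm_of_actsOnFst 𝒰 hC.1 (h₁ A hA C hC) he'
    refine ⟨C, hC, fun p q w z => ?_, fun p q w z => ?_⟩
    · rw [hPQ, hPQ, key]
    · rw [hPQ, hPQ, ← evolvedExchForm_comm, key, evolvedExchForm_comm]
  have H₂ : ∀ B : Op (Pos d₂) (Spin n₂), IsGenerator ħ B → ∃ C, IsLift₂ B C ∧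
      (∀ p q w z, ⟪P (C p) q, Q w z⟫_ℂ = ⟪P p q, Q w (C z)⟫_ℂ) ∧
      ∀ p q w z, ⟪P p (C q), Q w z⟫_ℂ = ⟪P p q, Q (C w) z⟫_ℂ := fun B hB => by
    obtain ⟨C, hC⟩ := hB.exists_isLift₂ (Pos d₁) (Fin n₁)
    have key := evolvedExchForm_of_actsOnSnd 𝒰 hC.1 (h₂ B hB C hC) he
    refine ⟨C, hC, fun p q w z => ?_, fun p q w z => ?_⟩
    · rw [hPQ, hPQ, key]
    · rw [hPQ, hPQ, ← evolvedExchForm_comm, key, evolvedExchForm_comm]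
  obtain ⟨k, hk⟩ := exists_eq_mul_exchForm P Q hħ hP hQ H₁ H₂ he he'
  exact ⟨k, fun p q w z => (hPQ p q w z).symm.trans (hk p q w z)⟩

/-- The evolved exchange form is a multiple of the exchange form of the swapped pairs as soon as
each particle's observables evolve to observables of the other particle. -/
theorem exists_swaps_const (hħ : ħ ≠ 0) (t : ℝ)
    (h₁ : ∀ A : Op (Pos d₁) (Spin n₁), IsGenerator ħ A → ∀ C, IsLift₁ A C →
      ActsOnSnd (heisenberg 𝒰 t C))
    (h₂ : ∀ B : Op (Pos d₂) (Spin n₂), IsGenerator ħ B → ∀ C, IsLift₂ B C →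
      ActsOnFst (heisenberg 𝒰 t C))
    {e : 𝓢(Pos d₁, Spin n₁)} {e' : 𝓢(Pos d₂, Spin n₂)} (he : ‖ket e‖ = 1) (he' : ‖ket e'‖ = 1) :
    ∃ k : ℂ, ∀ p q w z, evolvedExchForm 𝒰 (-t) q p w z = k * exchForm p q w z := by
  obtain ⟨P, Q, hP, hQ, hPQ⟩ : ∃ P Q : 𝓢(Pos₂ d₁ d₂, Spin₂ n₁ n₂) →ₗ[ℂ]
      𝓢(Pos₂ d₁ d₂, Spin₂ n₁ n₂) →ₗ[ℂ] L2 (Pos₂ d₁ d₂ × Pos₂ d₁ d₂)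
        (EuclideanSpace ℂ ((Fin n₁ × Fin n₂) × (Fin n₁ × Fin n₂))), BoxBounded P ∧ BoxBounded Q ∧
      ∀ p q w z, ⟪P p q, Q w z⟫_ℂ = evolvedExchForm 𝒰 (-t) q p w z := by
    obtain ⟨P, Q, hP, hQ, hPQ⟩ := exists_inner_eq_evolvedExchForm 𝒰 (-t)
    exact ⟨P.flip, Q, fun p q => (hP q p).trans_eq (mul_comm _ _), hQ, fun p q => hPQ q p⟩
  have H₁ : ∀ A : Op (Pos d₁) (Spin n₁), IsGenerator ħ A → ∃ C, IsLift₁ A C ∧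
      (∀ p q w z, ⟪P (C p) q, Q w z⟫_ℂ = ⟪P p q, Q (C w) z⟫_ℂ) ∧
      ∀ p q w z, ⟪P p (C q), Q w z⟫_ℂ = ⟪P p q, Q w (C z)⟫_ℂ := fun A hA => by
    obtain ⟨C, hC⟩ := hA.exists_isLift₁ (Pos d₂) (Fin n₂)
    have key := evolvedExchForm_of_actsOnSnd 𝒰 hC.1 (h₁ A hA C hC) he
    refine ⟨C, hC, fun p q w z => ?_, fun p q w z => ?_⟩
    · rw [hPQ, hPQ, ← evolvedExchForm_comm, key, evolvedExchForm_comm]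
    · rw [hPQ, hPQ, key]
  have H₂ : ∀ B : Op (Pos d₂) (Spin n₂), IsGenerator ħ B → ∃ C, IsLift₂ B C ∧
      (∀ p q w z, ⟪P (C p) q, Q w z⟫_ℂ = ⟪P p q, Q w (C z)⟫_ℂ) ∧
      ∀ p q w z, ⟪P p (C q), Q w z⟫_ℂ = ⟪P p q, Q (C w) z⟫_ℂ := fun B hB => by
    obtain ⟨C, hC⟩ := hB.exists_isLift₂ (Pos d₁) (Fin n₁)
    have key := evolvedExchForm_of_actsOnFst 𝒰 hC.1 (h₂ B hB C hC) he'
    refine ⟨C, hC, fun p q w z => ?_, fun p q w z => ?_⟩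
    · rw [hPQ, hPQ, ← evolvedExchForm_comm, key, evolvedExchForm_comm]
    · rw [hPQ, hPQ, key]
  obtain ⟨k, hk⟩ := exists_eq_mul_exchForm P Q hħ hP hQ H₁ H₂ he he'
  exact ⟨k, fun p q w z => (hPQ p q w z).symm.trans (hk p q w z)⟩

theorem exists_inner_box_smooth_ne_zero (t : ℝ) {e : 𝓢(Pos d₁, Spin n₁)}
    {e' : 𝓢(Pos d₂, Spin n₂)} (he : ‖ket e‖ = 1) (he' : ‖ket e'‖ = 1) :
    ∃ (v : 𝓢(Pos d₁, Spin n₁)) (v' : 𝓢(Pos d₂, Spin n₂)),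
      ⟪ket (box v v'), ket (𝒰.smooth t (box e e'))⟫_ℂ ≠ 0 := by
  by_contra! h0
  have h1 := congrArg (fun Ψ => ‖ket Ψ‖) (eq_zero_of_inner_ket_box _ h0)
  simp [𝒰.norm_ket_smooth, norm_ket_box, he, he'] at h1

/-- The constant is one, since `exchForm p p w w = ⟨p, w⟩ ²` if `p` or `w` is a product. -/
theorem eq_one_of_evolvedExchForm (t : ℝ) {k : ℂ}
    (h : ∀ p w, evolvedExchForm 𝒰 (-t) p p w w = k * exchForm p p w w)
    {e : 𝓢(Pos d₁, Spin n₁)} {e' : 𝓢(Pos d₂, Spin n₂)} (he : ‖ket e‖ = 1) (he' : ‖ket e'‖ = 1) :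
    k = 1 := by
  obtain ⟨a, a', ha⟩ := exists_inner_box_smooth_ne_zero 𝒰 t he he'
  have ha' : ⟪ket (𝒰.smooth t (box e e')), ket (box a a')⟫_ℂ ≠ 0 := by
    rwa [← inner_conj_symm, map_ne_zero]
  have h1 := h (𝒰.smooth t (box e e')) (box a a')
  rw [evolvedExchForm, 𝒰.smooth_neg_smooth, exchForm_box_box, exchForm_right_box_box,
    ← 𝒰.inner_smooth_left] at h1
  exact (mul_right_cancel₀ (mul_ne_zero ha' ha') ((one_mul _).trans h1)).symm

/-- If at time `t` the expectations of the generators of the algebras of the particles multiply in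
the evolved product vectors, the evolution up to time `t` preserves or swaps the exchange form. -/
theorem preserves_or_swaps (hħ : ħ ≠ 0) (t : ℝ)
    (h : ∀ (A : Op (Pos d₁) (Spin n₁)) (B : Op (Pos d₂) (Spin n₂)), IsGenerator ħ A →
      IsGenerator ħ B → ∀ C D, IsLift₁ A C → IsLift₂ B D → ∀ a b,
      ⟪ket (𝒰.smooth t (box a b)), ket (C (𝒰.smooth t (box a b)))⟫_ℂ *
        ⟪ket (𝒰.smooth t (box a b)), ket (D (𝒰.smooth t (box a b)))⟫_ℂ =
      ⟪ket (box a b), ket (box a b)⟫_ℂ *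
        ⟪ket (𝒰.smooth t (box a b)), ket (C (D (𝒰.smooth t (box a b))))⟫_ℂ)
    {e : 𝓢(Pos d₁, Spin n₁)} {e' : 𝓢(Pos d₂, Spin n₂)} (he : ‖ket e‖ = 1) (he' : ‖ket e'‖ = 1) :
    Preserves 𝒰 t ∨ Swaps 𝒰 t := by
  have hact : ∀ (A : Op (Pos d₁) (Spin n₁)) (B : Op (Pos d₂) (Spin n₂)), IsGenerator ħ A →
      IsGenerator ħ B → ∀ C D, IsLift₁ A C → IsLift₂ B D →
      (ActsOnSnd (heisenberg 𝒰 t C) ∨ ActsOnSnd (heisenberg 𝒰 t D)) ∧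
      (ActsOnFst (heisenberg 𝒰 t C) ∨ ActsOnFst (heisenberg 𝒰 t D)) := by
    intro A B hA hB C D hC hD
    refine actsOn_of_expect_mul fun a b => ?_
    simp only [inner_heisenberg]
    rw [h A B hA hB C D hC hD, heisenberg_apply 𝒰 t D, 𝒰.smooth_smooth_neg]
  have hsnd : (∀ A : Op (Pos d₁) (Spin n₁), IsGenerator ħ A → ∀ C, IsLift₁ A C →
      ActsOnSnd (heisenberg 𝒰 t C)) ∨ ∀ B : Op (Pos d₂) (Spin n₂), IsGenerator ħ B →
      ∀ D, IsLift₂ B D → ActsOnSnd (heisenberg 𝒰 t D) := by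
    by_contra! hc
    obtain ⟨⟨A, hA, C, hC, hAC⟩, B, hB, D, hD, hBD⟩ := hc
    exact (hact A B hA hB C D hC hD).1.elim hAC hBD
  have hfst : (∀ A : Op (Pos d₁) (Spin n₁), IsGenerator ħ A → ∀ C, IsLift₁ A C →
      ActsOnFst (heisenberg 𝒰 t C)) ∨ ∀ B : Op (Pos d₂) (Spin n₂), IsGenerator ħ B →
      ∀ D, IsLift₂ B D → ActsOnFst (heisenberg 𝒰 t D) := by
    by_contra! hc
    obtain ⟨⟨A, hA, C, hC, hAC⟩, B, hB, D, hD, hBD⟩ := hc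
    exact (hact A B hA hB C D hC hD).2.elim hAC hBD
  have hpres : (∀ A : Op (Pos d₁) (Spin n₁), IsGenerator ħ A → ∀ C, IsLift₁ A C →
      ActsOnFst (heisenberg 𝒰 t C)) → (∀ B : Op (Pos d₂) (Spin n₂), IsGenerator ħ B →
      ∀ D, IsLift₂ B D → ActsOnSnd (heisenberg 𝒰 t D)) → Preserves 𝒰 t := by
    intro h₁ h₂
    obtain ⟨k, hk⟩ := exists_preserves_const 𝒰 hħ t h₁ h₂ he he'
    have h1 : Preserves 𝒰 (-t) := fun p q w z => by
      rw [hk, eq_one_of_evolvedExchForm 𝒰 t (fun p w => hk p p w w) he he', one_mul]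
    simpa using h1.neg
  -- An operator that evolves to one acting on neither particle is a scalar.
  have hscal : ∀ C : Op (Pos₂ d₁ d₂) (Spin₂ n₁ n₂), IsSymm C → ActsOnFst (heisenberg 𝒰 t C) →
      ActsOnSnd (heisenberg 𝒰 t C) → ∃ c : ℂ, ∀ Ψ, C Ψ = c • Ψ := by
    intro C hC hf hs
    obtain ⟨c, hc⟩ := exists_eq_smul_of_actsOn (isSymm_heisenberg 𝒰 t hC) hf hs he he'
    refine ⟨c, fun Ψ => ?_⟩
    have := congrArg (𝒰.smooth t) (hc (𝒰.smooth (-t) Ψ))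
    rwa [heisenberg_apply, map_smul, 𝒰.smooth_smooth_neg, 𝒰.smooth_smooth_neg] at this
  rcases hsnd with ha | hb <;> rcases hfst with hc | hd
  -- The attributes of the first particle are scalars, so that its Hilbert space is a line, and
  -- every operator acts on the second particle only.
  · refine .inl (hpres hc fun B _ D _ w v h0 w' v' => ?_)
    have h1 := eq_zero_or_eq_zero_of_isGenerator_scalar hħ (fun A hA => ?_) he h0
    · rcases h1 with rfl | rfl <;> simp
    · obtain ⟨C, hC⟩ := hA.exists_isLift₁ (Pos d₂) (Fin n₂)
      obtain ⟨c, hcc⟩ := hscal C hC.1 (hc A hA C hC) (ha A hA C hC)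
      exact ⟨c, fun a => eq_of_box_eq_left he'
        (by rw [← hC.2, hcc, map_smul, LinearMap.smul_apply])⟩
  -- The attributes of each particle evolve to observables of the other one.
  · obtain ⟨k, hk⟩ := exists_swaps_const 𝒰 hħ t ha hd he he'
    have h1 : Swaps 𝒰 (-t) := fun p q w z => by
      rw [hk, eq_one_of_evolvedExchForm 𝒰 t (fun p w => hk p p w w) he he', one_mul]
    exact .inr (by simpa using h1.neg)
  -- The attributes of each particle evolve to observables of the same particle.
  · exact .inl (hpres hc hb)
  -- The attributes of the second particle are scalars.
  · refine .inl (hpres (fun A _ D _ w v h0 w' v' => ?_) hb)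
    have h1 := eq_zero_or_eq_zero_of_isGenerator_scalar hħ (fun B hB => ?_) he' h0
    · rcases h1 with rfl | rfl <;> simp
    · obtain ⟨C, hC⟩ := hB.exists_isLift₂ (Pos d₁) (Fin n₁)
      obtain ⟨c, hcc⟩ := hscal C hC.1 (hd B hB C hC) (hb B hB C hC)
      exact ⟨c, fun a => eq_of_box_eq_right he (by rw [← hC.2, hcc, map_smul])⟩

end Heisenberg

/-! ### Mixtures of states -/

section Mixture

set_option linter.unusedSectionVars false

variable {E F : Type} [NormedAddCommGroup E] [NormedSpace ℝ E] [FiniteDimensional ℝ E]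
  [MeasureSpace E] [BorelSpace E] [(volume : Measure E).IsAddHaarMeasure]
  [NormedAddCommGroup F] [InnerProductSpace ℂ F] [CompleteSpace F]

/-- The decomposition `ρ = ∑ |φ i⟩⟨φ i|` of a state, with an arbitrary index type. -/
structure IsMixture {ι : Type} (φ : ι → 𝓢(E, F)) (ρ : State E F) : Prop where
  summable : ∀ p : Seminorm ℂ 𝓢(E, F), Continuous p → Summable fun i => p (φ i) ^ 2
  trace_one : HasSum (fun i => ‖ket (φ i)‖ ^ 2) 1
  hasSum : ∀ ξ : L2 E F, HasSum (fun i => ⟪ket (φ i), ξ⟫_ℂ • ket (φ i)) (ρ.op ξ)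

theorem State.exists_isMixture (ρ : State E F) : ∃ φ : ℕ → 𝓢(E, F), IsMixture φ ρ := by
  obtain ⟨φ, hφ, h⟩ := ρ.exists_ensemble
  exact ⟨φ, hφ.summable, hφ.trace_one, h⟩

variable {ι κ : Type} {φ : ι → 𝓢(E, F)} {ρ : State E F}

theorem IsMixture.comp_equiv (h : IsMixture φ ρ) (e : κ ≃ ι) : IsMixture (φ ∘ e) ρ where
  summable p hp := (e.summable_iff (f := fun i => p (φ i) ^ 2)).2 (h.summable p hp)
  trace_one := (e.hasSum_iff (f := fun i => ‖ket (φ i)‖ ^ 2)).2 h.trace_one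
  hasSum ξ := (e.hasSum_iff (f := fun i => ⟪ket (φ i), ξ⟫_ℂ • ket (φ i))).2 (h.hasSum ξ)

theorem IsMixture.hasSum_inner (h : IsMixture φ ρ) (η ξ : L2 E F) :
    HasSum (fun i => ⟪η, ket (φ i)⟫_ℂ * ⟪ket (φ i), ξ⟫_ℂ) ⟪η, ρ.op ξ⟫_ℂ := by
  simpa [mul_comm] using (h.hasSum ξ).mapL (innerSL ℂ η)

/-- The expectation of a symmetric operator may be computed from any decomposition of the state. -/
theorem IsMixture.hasSum_expect [Denumerable ι] (h : IsMixture φ ρ) {A : Op E F} (hA : IsSymm A) :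
    HasSum (fun i => ⟪ket (φ i), ket (A (φ i))⟫_ℂ) (ρ.expect A) := by
  have h' := h.comp_equiv (Denumerable.eqv ι).symm
  have hens : IsSmoothEnsemble (φ ∘ (Denumerable.eqv ι).symm) := ⟨h'.summable, h'.trace_one⟩
  refine (Denumerable.eqv ι).symm.hasSum_iff.1 ?_
  rw [ρ.expect_eq hA hens h'.hasSum]
  refine Summable.hasSum (Summable.of_norm_bounded
    ((summable_norm_ket hens 1).add (summable_norm_ket hens A)) fun i => ?_)
  refine (norm_inner_le_norm _ _).trans ?_
  rw [one_apply_eq_self]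
  change _ ≤ ‖ket (φ _)‖ ^ 2 + ‖ket (A (φ _))‖ ^ 2
  nlinarith [sq_nonneg (‖ket (φ ((Denumerable.eqv ι).symm i))‖ -
    ‖ket (A (φ ((Denumerable.eqv ι).symm i)))‖), sq_nonneg ‖ket (φ ((Denumerable.eqv ι).symm i))‖,
    sq_nonneg ‖ket (A (φ ((Denumerable.eqv ι).symm i)))‖]

theorem State.exists_ensemble_of [Denumerable ι] {T : L2 E F →L[ℂ] L2 E F}
    (hs : ∀ p : Seminorm ℂ 𝓢(E, F), Continuous p → Summable fun i => p (φ i) ^ 2)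
    (ht : HasSum (fun i => ‖ket (φ i)‖ ^ 2) 1)
    (h : ∀ ξ : L2 E F, HasSum (fun i => ⟪ket (φ i), ξ⟫_ℂ • ket (φ i)) (T ξ)) :
    ∃ ρ : State E F, ρ.op = T ∧ IsMixture φ ρ := by
  let e := (Denumerable.eqv ι).symm
  exact ⟨⟨T, φ ∘ e, ⟨fun p hp => (e.summable_iff (f := fun i => p (φ i) ^ 2)).2 (hs p hp),
    (e.hasSum_iff (f := fun i => ‖ket (φ i)‖ ^ 2)).2 ht⟩,
    fun ξ => (e.hasSum_iff (f := fun i => ⟪ket (φ i), ξ⟫_ℂ • ket (φ i))).2 (h ξ)⟩, rfl, hs, ht, h⟩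

theorem exists_isMixture [Denumerable ι]
    (hs : ∀ p : Seminorm ℂ 𝓢(E, F), Continuous p → Summable fun i => p (φ i) ^ 2)
    (ht : HasSum (fun i => ‖ket (φ i)‖ ^ 2) 1) : ∃ ρ : State E F, IsMixture φ ρ := by
  have hsum : Summable fun i =>
      (InnerProductSpace.rankOne ℂ (ket (φ i)) (ket (φ i)) : L2 E F →L[ℂ] L2 E F) := by
    refine Summable.of_norm ?_
    simpa [InnerProductSpace.norm_rankOne, ← pow_two] using ht.summable
  obtain ⟨ρ, -, h⟩ := State.exists_ensemble_of hs ht (fun ξ => by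
    simpa using hsum.hasSum.mapL (ContinuousLinearMap.apply ℂ (L2 E F) ξ))
  exact ⟨ρ, h⟩

/-- The pure state `|a⟩⟨a|`. -/
theorem exists_pure {a : 𝓢(E, F)} (ha : ‖ket a‖ = 1) : ∃ ρ : State E F,
    (∀ ξ, ρ.op ξ = ⟪ket a, ξ⟫_ℂ • ket a) ∧
      ∀ A, IsSymm A → ρ.expect A = ⟪ket a, ket (A a)⟫_ℂ := by
  let φ : ℕ → 𝓢(E, F) := fun n => if n = 0 then a else 0
  have h0 : ∀ n, n ≠ 0 → φ n = 0 := fun n hn => if_neg hn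
  obtain ⟨ρ, hρ⟩ := exists_isMixture (φ := φ)
    (fun p _ => (hasSum_single 0 fun n hn => by simp [h0 n hn]).summable)
    (by
      have := hasSum_single (f := fun n => ‖ket (φ n)‖ ^ 2) 0 fun n hn => by simp [h0 n hn]
      simpa [φ, ha] using this)
  refine ⟨ρ, fun ξ => (hρ.hasSum ξ).unique ?_, fun A hA => (hρ.hasSum_expect hA).unique ?_⟩
  · exact hasSum_single (f := fun n => ⟪ket (φ n), ξ⟫_ℂ • ket (φ n)) 0
      fun n hn => by simp [h0 n hn]
  · exact hasSum_single (f := fun n => ⟪ket (φ n), ket (A (φ n))⟫_ℂ) 0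
      fun n hn => by simp [h0 n hn]

theorem exists_conj_mul_self {s : ℝ} (hs : 0 ≤ s) :
    ∃ x : ℂ, starRingEnd ℂ x * x = s ∧ ‖x‖ ^ 2 = s := by
  have h : ‖(√s : ℂ)‖ ^ 2 = s := by
    rw [Complex.norm_real, Real.norm_eq_abs, sq_abs, Real.sq_sqrt hs]
  exact ⟨√s, by rw [← Complex.normSq_eq_conj_mul_self, Complex.normSq_eq_norm_sq, h], h⟩

/-- The mixture `(1 - s) ρ + s σ`. -/
theorem exists_mix (ρ σ : State E F) {s : ℝ} (h0 : 0 ≤ s) (h1 : s ≤ 1) : ∃ τ : State E F,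
    τ.op = ((1 - s : ℝ) : ℂ) • ρ.op + (s : ℂ) • σ.op ∧
      ∀ A, IsSymm A → τ.expect A = ((1 - s : ℝ) : ℂ) * ρ.expect A + (s : ℂ) * σ.expect A := by
  obtain ⟨φ, hφ⟩ := ρ.exists_isMixture
  obtain ⟨ψ, hψ⟩ := σ.exists_isMixture
  obtain ⟨x, hx, nx⟩ := exists_conj_mul_self (sub_nonneg.2 h1)
  obtain ⟨y, hy, ny⟩ := exists_conj_mul_self h0
  -- The vectors of both decompositions, with the weights `√(1 - s)` and `√s`.
  let θ : ℕ ⊕ ℕ → 𝓢(E, F) := Sum.elim (fun n => x • φ n) fun n => y • ψ n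
  have hp : ∀ (p : Seminorm ℂ 𝓢(E, F)) (c : ℂ) (v : 𝓢(E, F)), p (c • v) ^ 2 = ‖c‖ ^ 2 * p v ^ 2 :=
    fun p c v => by rw [map_smul_eq_mul, mul_pow]
  have hn : ∀ (c : ℂ) (v : 𝓢(E, F)), ‖ket (c • v)‖ ^ 2 = ‖c‖ ^ 2 * ‖ket v‖ ^ 2 := fun c v => by
    rw [map_smul, norm_smul, mul_pow]
  have hv : ∀ (c : ℂ) (v : 𝓢(E, F)) (ξ : L2 E F), ⟪ket (c • v), ξ⟫_ℂ • ket (c • v) =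
      (starRingEnd ℂ c * c) • ⟪ket v, ξ⟫_ℂ • ket v := fun c v ξ => by
    rw [map_smul, inner_smul_left, smul_smul, smul_smul]
    ring_nf
  have he : ∀ (A : Op E F) (c : ℂ) (v : 𝓢(E, F)), ⟪ket (c • v), ket (A (c • v))⟫_ℂ =
      (starRingEnd ℂ c * c) * ⟪ket v, ket (A v)⟫_ℂ := fun A c v => by
    rw [map_smul, map_smul, map_smul, inner_smul_left, inner_smul_right, mul_assoc]
  obtain ⟨τ, hτ, hm⟩ := State.exists_ensemble_of (φ := θ)
    (T := ((1 - s : ℝ) : ℂ) • ρ.op + (s : ℂ) • σ.op)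
    (fun p hpc => Summable.sum (fun i => p (θ i) ^ 2)
      (((hφ.summable p hpc).mul_left (‖x‖ ^ 2)).congr fun n => (hp p x (φ n)).symm)
      (((hψ.summable p hpc).mul_left (‖y‖ ^ 2)).congr fun n => (hp p y (ψ n)).symm))
    (by
      have h2 := HasSum.sum (f := fun i => ‖ket (θ i)‖ ^ 2)
        ((hφ.trace_one.mul_left (‖x‖ ^ 2)).congr_fun fun n => hn x (φ n))
        ((hψ.trace_one.mul_left (‖y‖ ^ 2)).congr_fun fun n => hn y (ψ n))
      rwa [nx, ny, mul_one, mul_one, sub_add_cancel] at h2)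
    (fun ξ => by
      have h2 := HasSum.sum (f := fun i => ⟪ket (θ i), ξ⟫_ℂ • ket (θ i))
        (((hφ.hasSum ξ).const_smul (starRingEnd ℂ x * x)).congr_fun fun n => hv x (φ n) ξ)
        (((hψ.hasSum ξ).const_smul (starRingEnd ℂ y * y)).congr_fun fun n => hv y (ψ n) ξ)
      rwa [hx, hy] at h2)
  refine ⟨τ, hτ, fun A hA => (hm.hasSum_expect hA).unique ?_⟩
  have h2 := HasSum.sum (f := fun i => ⟪ket (θ i), ket (A (θ i))⟫_ℂ)
    (((hφ.hasSum_expect hA).mul_left (starRingEnd ℂ x * x)).congr_fun fun n => he A x (φ n))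
    (((hψ.hasSum_expect hA).mul_left (starRingEnd ℂ y * y)).congr_fun fun n => he A y (ψ n))
  rwa [hx, hy] at h2

/-! ### The topology of the state space -/

theorem traceNorm_add_le (S T : L2 E F →L[ℂ] L2 E F) :
    traceNorm (S + T) ≤ traceNorm S + traceNorm T := by
  refine iSup_le fun n => iSup_le fun e => iSup_le fun f => iSup_le fun he => iSup_le fun hf => ?_
  have h : ∀ R : L2 E F →L[ℂ] L2 E F, ∑ i, ‖⟪e i, R (f i)⟫_ℂ‖ₑ ≤ traceNorm R := fun R =>
    le_iSup_of_le n (le_iSup_of_le e (le_iSup_of_le f (le_iSup_of_le he (le_iSup_of_le hf le_rfl))))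
  refine le_trans ?_ (add_le_add (h S) (h T))
  rw [← Finset.sum_add_distrib]
  refine Finset.sum_le_sum fun i _ => ?_
  rw [add_apply, inner_add_right]
  exact enorm_add_le _ _

theorem traceNorm_smul_le (c : ℂ) (T : L2 E F →L[ℂ] L2 E F) :
    traceNorm (c • T) ≤ ‖c‖ₑ * traceNorm T := by
  refine iSup_le fun n => iSup_le fun e => iSup_le fun f => iSup_le fun he => iSup_le fun hf => ?_
  have h : ∀ R : L2 E F →L[ℂ] L2 E F, ∑ i, ‖⟪e i, R (f i)⟫_ℂ‖ₑ ≤ traceNorm R := fun R =>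
    le_iSup_of_le n (le_iSup_of_le e (le_iSup_of_le f (le_iSup_of_le he (le_iSup_of_le hf le_rfl))))
  refine le_trans (le_of_eq ?_) (mul_le_mul_right (h T) _)
  rw [Finset.mul_sum]
  refine Finset.sum_congr rfl fun i _ => ?_
  rw [smul_apply, inner_smul_right, enorm_mul]

/-- By Bessel's inequality, `∑ₖ |⟨eₖ, φ⟩ ⟨φ, fₖ⟩| ≤ ‖φ‖²` for orthonormal families `e`, `f`. -/
theorem traceNorm_op_le_one (ρ : State E F) : traceNorm ρ.op ≤ 1 := by
  obtain ⟨φ, hφ⟩ := ρ.exists_isMixture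
  refine iSup_le fun n => iSup_le fun e => iSup_le fun f => iSup_le fun he => iSup_le fun hf => ?_
  have h1 : ∀ k, ∑ i, ‖⟪e i, ket (φ k)⟫_ℂ * ⟪ket (φ k), f i⟫_ℂ‖ ≤ ‖ket (φ k)‖ ^ 2 := by
    intro k
    have b1 := he.sum_inner_products_le (ket (φ k)) (s := Finset.univ)
    have b2 := hf.sum_inner_products_le (ket (φ k)) (s := Finset.univ)
    have : ∑ i, ‖⟪e i, ket (φ k)⟫_ℂ * ⟪ket (φ k), f i⟫_ℂ‖ ≤
        ∑ i, (‖⟪e i, ket (φ k)⟫_ℂ‖ ^ 2 + ‖⟪f i, ket (φ k)⟫_ℂ‖ ^ 2) / 2 := by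
      refine Finset.sum_le_sum fun i _ => ?_
      rw [norm_mul, norm_inner_symm (ket (φ k))]
      nlinarith [sq_nonneg (‖⟪e i, ket (φ k)⟫_ℂ‖ - ‖⟪f i, ket (φ k)⟫_ℂ‖)]
    refine this.trans ?_
    rw [← Finset.sum_div, Finset.sum_add_distrib]
    linarith
  have hsum : ∀ i, Summable fun k => ‖⟪e i, ket (φ k)⟫_ℂ * ⟪ket (φ k), f i⟫_ℂ‖ := fun i =>
    Summable.of_nonneg_of_le (fun _ => norm_nonneg _)
      (fun k => (Finset.single_le_sum (f := fun i => ‖⟪e i, ket (φ k)⟫_ℂ * ⟪ket (φ k), f i⟫_ℂ‖)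
        (fun _ _ => norm_nonneg _) (Finset.mem_univ i)).trans (h1 k)) hφ.trace_one.summable
  have h2 : ∑ i, ‖⟪e i, ρ.op (f i)⟫_ℂ‖ ≤ 1 := by
    calc ∑ i, ‖⟪e i, ρ.op (f i)⟫_ℂ‖
        ≤ ∑ i, ∑' k, ‖⟪e i, ket (φ k)⟫_ℂ * ⟪ket (φ k), f i⟫_ℂ‖ := by
          refine Finset.sum_le_sum fun i _ => ?_
          rw [← (hφ.hasSum_inner (e i) (f i)).tsum_eq]
          exact norm_tsum_le_tsum_norm (hsum i)
      _ = ∑' k, ∑ i, ‖⟪e i, ket (φ k)⟫_ℂ * ⟪ket (φ k), f i⟫_ℂ‖ :=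
          (Summable.tsum_finsetSum fun i _ => hsum i).symm
      _ ≤ ∑' k, ‖ket (φ k)‖ ^ 2 :=
          (summable_sum fun i _ => hsum i).tsum_le_tsum h1 hφ.trace_one.summable
      _ = 1 := hφ.trace_one.tsum_eq
  calc ∑ i, ‖⟪e i, ρ.op (f i)⟫_ℂ‖ₑ = ENNReal.ofReal (∑ i, ‖⟪e i, ρ.op (f i)⟫_ℂ‖) := by
        rw [ENNReal.ofReal_sum_of_nonneg fun _ _ => norm_nonneg _]
        simp only [ofReal_norm]
    _ ≤ 1 := by simpa using ENNReal.ofReal_le_ofReal h2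

end Mixture

/-- An open set of states that contains `ρ` contains the mixtures `(1 - s) ρ + s σ` for small `s`:
the mixtures depend continuously on `s`, for the topology of the expectations and for the trace
norm. -/
theorem exists_mix_mem {d n : ℕ} {ħ : ℝ} {W : Set (State (Pos d) (Spin n))}
    (hW : IsOpen[stateTopology ħ d n] W) {ρ : State (Pos d) (Spin n)} (hρ : ρ ∈ W)
    (σ : State (Pos d) (Spin n)) : ∃ ε > 0, ∀ (s : ℝ) (τ : State (Pos d) (Spin n)), 0 ≤ s → s < ε →
      τ.op = ((1 - s : ℝ) : ℂ) • ρ.op + (s : ℂ) • σ.op → τ ∈ W := by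
  choose m hm hmA using fun s : Set.Icc (0 : ℝ) 1 => exists_mix ρ σ s.2.1 s.2.2
  have hfin : traceNorm (σ.op - ρ.op) ≠ ⊤ := by
    have h1 := traceNorm_add_le σ.op ((-1 : ℂ) • ρ.op)
    have h2 := traceNorm_smul_le (-1 : ℂ) ρ.op
    have h3 := traceNorm_op_le_one ρ
    have h4 := traceNorm_op_le_one σ
    rw [enorm_neg, enorm_one, one_mul] at h2
    rw [neg_one_smul, ← sub_eq_add_neg] at h1
    rw [neg_one_smul] at h2
    exact ((h1.trans (add_le_add h4 (h2.trans h3))).trans_lt (by simp)).ne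
  have hc : @Continuous _ _ _ (stateTopology ħ d n) m := by
    refine continuous_generateFrom_iff.2 ?_
    rintro U (⟨ρ', A, ε, hA, hε, rfl⟩ | ⟨ρ', δ, hδ, rfl⟩)
    · have : m ⁻¹' scrN ρ' A ε = {s : Set.Icc (0 : ℝ) 1 |
          ‖((1 - (s : ℝ) : ℝ) : ℂ) * ρ.expect A + ((s : ℝ) : ℂ) * σ.expect A -
            ρ'.expect A‖ < ε} := by
        ext s
        simp only [scrN, mem_preimage, mem_ofPred_eq, hmA s A hA.2]
      rw [this]
      exact isOpen_lt (by fun_prop) continuous_const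
    · have hop : ∀ s s₀, (m s).op - ρ'.op =
          ((m s₀).op - ρ'.op) + (((s : ℝ) - (s₀ : ℝ) : ℝ) : ℂ) • (σ.op - ρ.op) := by
        intro s s₀
        rw [hm, hm]
        push_cast
        module
      rw [isOpen_iff_mem_nhds]
      intro s₀ hs₀
      have hlim : Tendsto (fun s : Set.Icc (0 : ℝ) 1 => traceNorm ((m s₀).op - ρ'.op) +
          ENNReal.ofReal |(s : ℝ) - s₀| * traceNorm (σ.op - ρ.op)) (𝓝 s₀)
          (𝓝 (traceNorm ((m s₀).op - ρ'.op) + ENNReal.ofReal |(s₀ : ℝ) - s₀| *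
            traceNorm (σ.op - ρ.op))) := by
        refine tendsto_const_nhds.add (ENNReal.Tendsto.mul_const ?_ (.inr hfin))
        exact (ENNReal.continuous_ofReal.comp (by fun_prop)).tendsto s₀
      rw [sub_self, abs_zero, ENNReal.ofReal_zero, zero_mul, add_zero] at hlim
      filter_upwards [hlim.eventually_lt_const hs₀] with s hs
      refine lt_of_le_of_lt ?_ hs
      change traceNorm ((m s).op - ρ'.op) ≤ _
      rw [hop s s₀]
      refine (traceNorm_add_le _ _).trans (add_le_add le_rfl ((traceNorm_smul_le _ _).trans_eq ?_))
      rw [← ofReal_norm, Complex.norm_real, Real.norm_eq_abs]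
  have hpre : IsOpen (m ⁻¹' W) := @Continuous.isOpen_preimage _ _ _ (stateTopology ħ d n) _ hc W hW
  have h0 : (⟨0, by simp⟩ : Set.Icc (0 : ℝ) 1) ∈ m ⁻¹' W := by
    have : m ⟨0, by simp⟩ = ρ := State.ext (by rw [hm]; simp)
    rwa [mem_preimage, this]
  obtain ⟨ε, hε, hball⟩ := Metric.isOpen_iff.1 hpre _ h0
  refine ⟨min ε 1, by positivity, fun s τ hs0 hs1 hτ => ?_⟩
  have hs : s ∈ Set.Icc (0 : ℝ) 1 := ⟨hs0, (hs1.trans_le (min_le_right _ _)).le⟩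
  have hmem := @hball ⟨s, hs⟩ (by
    rw [Metric.mem_ball, Subtype.dist_eq, Real.dist_eq, sub_zero, abs_of_nonneg hs0]
    exact hs1.trans_le (min_le_left _ _))
  have : m ⟨s, hs⟩ = τ := State.ext ((hm _).trans hτ.symm)
  rwa [mem_preimage, this] at hmem

/-! ### Product states -/

section Evolve

set_option linter.unusedSectionVars false

variable {E F : Type} [NormedAddCommGroup E] [NormedSpace ℝ E] [FiniteDimensional ℝ E]
  [MeasureSpace E] [BorelSpace E] [(volume : Measure E).IsAddHaarMeasure]
  [NormedAddCommGroup F] [InnerProductSpace ℂ F] [CompleteSpace F]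
  {ħ : ℝ} {H : Op E F} (𝒰 : Evolution ħ H)

theorem IsMixture.evolve {ι : Type} {φ : ι → 𝓢(E, F)} {ρ : State E F} (h : IsMixture φ ρ) (t : ℝ) :
    IsMixture (fun i => 𝒰.smooth t (φ i)) (𝒰.evolve t ρ) where
  summable p hp := h.summable (p.comp (𝒰.smooth t : 𝓢(E, F) →ₗ[ℂ] 𝓢(E, F)))
    (hp.comp (𝒰.smooth t).continuous)
  trace_one := by simpa only [𝒰.norm_ket_smooth] using h.trace_one
  hasSum ξ := by
    have h1 := (h.hasSum ((𝒰.unitary t).symm ξ)).mapL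
      ((𝒰.unitary t).toContinuousLinearEquiv : L2 E F →L[ℂ] L2 E F)
    have key : ∀ i, ⟪𝒰.unitary t (ket (φ i)), ξ⟫_ℂ = ⟪ket (φ i), (𝒰.unitary t).symm ξ⟫_ℂ := by
      intro i
      rw [← (𝒰.unitary t).inner_map_map (ket (φ i)) ((𝒰.unitary t).symm ξ),
        LinearIsometryEquiv.apply_symm_apply]
    simpa [𝒰.ket_smooth, key, Evolution.evolve] using h1

theorem expect_one (ρ : State E F) : ρ.expect 1 = 1 := by
  obtain ⟨φ, hφ⟩ := ρ.exists_isMixture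
  refine (hφ.hasSum_expect (A := 1) fun _ _ => rfl).unique ?_
  have h := Complex.hasSum_ofReal.2 hφ.trace_one
  simpa [inner_self_eq_norm_sq_to_K] using h

theorem expect_im (ρ : State E F) {A : Op E F} (hA : IsSymm A) : (ρ.expect A).im = 0 := by
  obtain ⟨φ, hφ⟩ := ρ.exists_isMixture
  have h := Complex.hasSum_im (hφ.hasSum_expect hA)
  refine h.unique (hasSum_zero.congr_fun fun n => ?_)
  rw [← Complex.conj_eq_iff_im, inner_conj_symm, hA]

theorem exists_inner_op_self (ρ : State E F) (η : L2 E F) :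
    ∃ r : ℝ, 0 ≤ r ∧ ⟪η, ρ.op η⟫_ℂ = r := by
  obtain ⟨φ, hφ⟩ := ρ.exists_isMixture
  have h := hφ.hasSum_inner η η
  have e : ∀ n, ⟪η, ket (φ n)⟫_ℂ * ⟪ket (φ n), η⟫_ℂ = ((‖⟪ket (φ n), η⟫_ℂ‖ ^ 2 : ℝ) : ℂ) := by
    intro n
    rw [← inner_conj_symm η, ← Complex.normSq_eq_conj_mul_self, Complex.normSq_eq_norm_sq]
  simp only [e] at h
  obtain ⟨r, hr⟩ := (Complex.summable_ofReal.1 h.summable)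
  exact ⟨r, hr.nonneg fun n => by positivity, h.unique (Complex.hasSum_ofReal.2 hr)⟩

/-- The trace of a state is one in any Hilbert basis. -/
theorem hasSum_inner_op_basis {κ : Type} (ρ : State E F) (b : HilbertBasis κ ℂ (L2 E F)) :
    HasSum (fun k => ⟪b k, ρ.op (b k)⟫_ℂ) 1 := by
  obtain ⟨φ, hφ⟩ := ρ.exists_isMixture
  have h := tsum_norm_eq_of_mixture hφ.trace_one.summable (fun ξ η => hφ.hasSum_inner η ξ) b
  rw [hφ.trace_one.tsum_eq, ENNReal.ofReal_one] at h
  have h1 : HasSum (fun k => (⟪b k, ρ.op (b k)⟫_ℂ).re) 1 := by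
    have h2 := ENNReal.hasSum_toReal (h ▸ ENNReal.one_ne_top)
    rw [← ENNReal.tsum_toReal_eq (ENNReal.ne_top_of_tsum_ne_top (h ▸ ENNReal.one_ne_top)), ← h,
      ENNReal.toReal_one] at h2
    refine h2.congr_fun fun k => (ENNReal.toReal_ofReal ?_).symm
    obtain ⟨r, hr, hk⟩ := exists_inner_op_self ρ (b k)
    rwa [hk, Complex.ofReal_re]
  have h3 := Complex.hasSum_ofReal.2 h1
  rw [Complex.ofReal_one] at h3
  refine h3.congr_fun fun k => ?_
  obtain ⟨r, -, hk⟩ := exists_inner_op_self ρ (b k)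
  rw [hk, Complex.ofReal_re]

end Evolve

section Tensor

theorem hasSum_prod_eq_mul {ι κ : Type} {f : ι → ℂ} {g : κ → ℂ} {a b c : ℂ}
    (hf : HasSum f a) (hg : HasSum g b)
    {h : ι × κ → ℂ} (hh : HasSum h c) (e : ∀ x, h x = f x.1 * g x.2) : c = a * b := by
  obtain rfl : h = fun x => f x.1 * g x.2 := funext e
  exact hh.unique (hf.mul hg hh.summable)

variable {d₁ n₁ d₂ n₂ : ℕ}

theorem tensor_eq_box (φ : 𝓢(Pos d₁, Spin n₁)) (χ : 𝓢(Pos d₂, Spin n₂)) :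
    tensor φ χ = box φ χ := by
  ext
  rfl

theorem expect_heisenberg {ħ : ℝ} {H : Op (Pos₂ d₁ d₂) (Spin₂ n₁ n₂)} (𝒰 : Evolution ħ H) (t : ℝ)
    (ρ : State (Pos₂ d₁ d₂) (Spin₂ n₁ n₂)) {C : Op (Pos₂ d₁ d₂) (Spin₂ n₁ n₂)} (hC : IsSymm C) :
    (𝒰.evolve t ρ).expect C = ρ.expect (heisenberg 𝒰 t C) := by
  obtain ⟨φ, hφ⟩ := ρ.exists_isMixture
  refine ((hφ.evolve 𝒰 t).hasSum_expect hC).unique ?_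
  simpa only [inner_heisenberg] using hφ.hasSum_expect (isSymm_heisenberg 𝒰 t hC)

variable {ι κ : Type} {φ : ι → 𝓢(Pos d₁, Spin n₁)}
  {χ : κ → 𝓢(Pos d₂, Spin n₂)} {ρ₁ : State (Pos d₁) (Spin n₁)} {ρ₂ : State (Pos d₂) (Spin n₂)}
  {ρ : State (Pos₂ d₁ d₂) (Spin₂ n₁ n₂)}

theorem IsMixture.isTensorState (h₁ : IsMixture φ ρ₁) (h₂ : IsMixture χ ρ₂)
    (h : IsMixture (fun x : ι × κ => box (φ x.1) (χ x.2)) ρ) : IsTensorState ρ₁ ρ₂ ρ := by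
  intro a a' b b'
  rw [tensor_eq_box, tensor_eq_box]
  refine hasSum_prod_eq_mul (h₁.hasSum_inner (ket a') (ket a)) (h₂.hasSum_inner (ket b') (ket b))
    (h.hasSum_inner (ket (box a' b')) (ket (box a b))) fun x => ?_
  rw [inner_box, inner_box]
  ring

/-- `ρ₁ ⊗ ρ₂` is unique, as the products span a dense subspace. -/
theorem IsTensorState.unique {ρ' : State (Pos₂ d₁ d₂) (Spin₂ n₁ n₂)} (h : IsTensorState ρ₁ ρ₂ ρ)
    (h' : IsTensorState ρ₁ ρ₂ ρ') : ρ = ρ' := by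
  have h1 : ∀ a b, ρ.op (ket (box a b)) = ρ'.op (ket (box a b)) := fun a b =>
    sub_eq_zero.1 <| eq_zero_of_inner_box _ fun a' b' => by
      rw [inner_sub_right, ← tensor_eq_box, ← tensor_eq_box, h, h', sub_self]
  exact State.ext (ContinuousLinearMap.ext_on
    (Submodule.dense_iff_topologicalClosure_eq_top.2 dense_span_box) (by
    rintro _ ⟨x, rfl⟩
    exact h1 _ _))

variable [Denumerable ι] [Denumerable κ]

/-- The products of the vectors of two mixtures are the vectors of a mixture of the pair. -/
theorem IsMixture.exists_box (h₁ : IsMixture φ ρ₁) (h₂ : IsMixture χ ρ₂) :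
    ∃ ρ : State (Pos₂ d₁ d₂) (Spin₂ n₁ n₂),
      IsMixture (fun x : ι × κ => box (φ x.1) (χ x.2)) ρ := by
  refine exists_isMixture (fun p hp => ?_) ?_
  · obtain ⟨q, q', hq, hq', C, hC, hle⟩ := exists_seminorm_box_le p hp
    refine Summable.of_nonneg_of_le (fun _ => by positivity) (fun x => ?_)
      (((h₁.summable q hq).mul_of_nonneg (h₂.summable q' hq') (fun _ => by positivity)
        (fun _ => by positivity)).mul_left (C ^ 2))
    rw [← mul_pow, ← mul_pow]
    exact pow_le_pow_left₀ (apply_nonneg _ _) (hle _ _) 2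
  · have h := h₁.trace_one.mul h₂.trace_one (h₁.trace_one.summable.mul_of_nonneg
      h₂.trace_one.summable (fun _ => by positivity) (fun _ => by positivity))
    rw [mul_one] at h
    refine h.congr_fun fun x => ?_
    rw [norm_ket_box, mul_pow]

theorem exists_isTensorState (ρ₁ : State (Pos d₁) (Spin n₁)) (ρ₂ : State (Pos d₂) (Spin n₂)) :
    ∃ ρ : State (Pos₂ d₁ d₂) (Spin₂ n₁ n₂), IsTensorState ρ₁ ρ₂ ρ := by
  obtain ⟨φ, hφ⟩ := ρ₁.exists_isMixture
  obtain ⟨χ, hχ⟩ := ρ₂.exists_isMixture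
  obtain ⟨ρ, h⟩ := hφ.exists_box hχ
  exact ⟨ρ, hφ.isTensorState hχ h⟩

theorem IsTensorState.isMixture (h : IsTensorState ρ₁ ρ₂ ρ) (h₁ : IsMixture φ ρ₁)
    (h₂ : IsMixture χ ρ₂) : IsMixture (fun x : ι × κ => box (φ x.1) (χ x.2)) ρ := by
  obtain ⟨ρ', h'⟩ := h₁.exists_box h₂
  rwa [h.unique (h₁.isTensorState h₂ h')]

/-- `Tr (ρ₁ ⊗ ρ₂) (A ⊗ B) = Tr ρ₁ A · Tr ρ₂ B`. -/
theorem IsTensorState.expect_mul (h : IsTensorState ρ₁ ρ₂ ρ) {A : Op (Pos d₁) (Spin n₁)}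
    {B : Op (Pos d₂) (Spin n₂)} {C : Op (Pos₂ d₁ d₂) (Spin₂ n₁ n₂)} (hA : IsSymm A) (hB : IsSymm B)
    (hC : IsTensorOp A B C) : ρ.expect C = ρ₁.expect A * ρ₂.expect B := by
  obtain ⟨φ, hφ⟩ := ρ₁.exists_isMixture
  obtain ⟨χ, hχ⟩ := ρ₂.exists_isMixture
  refine hasSum_prod_eq_mul (hφ.hasSum_expect hA) (hχ.hasSum_expect hB)
    ((h.isMixture hφ hχ).hasSum_expect hC.1) fun x => ?_
  rw [← tensor_eq_box, hC.2, tensor_eq_box, tensor_eq_box, inner_box]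

theorem hasSum_inner_op {d n : ℕ} {κ : Type} (ρ : State (Pos d) (Spin n))
    {s : κ → 𝓢(Pos d, Spin n)} (hs : IsOrthonormalBasis s) :
    HasSum (fun k => ⟪ket (s k), ρ.op (ket (s k))⟫_ℂ) 1 := by
  simpa using hasSum_inner_op_basis ρ (HilbertBasis.mk hs.1 hs.2.ge)

theorem IsTensorState.isReduced₁ (h : IsTensorState ρ₁ ρ₂ ρ) : IsReduced₁ ρ ρ₁ := by
  intro κ s hs a a'
  have h1 := (hasSum_inner_op ρ₂ hs).mul_left ⟪ket a', ρ₁.op (ket a)⟫_ℂ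
  rw [mul_one] at h1
  exact h1.congr_fun fun k => h _ _ _ _

theorem IsTensorState.isReduced₂ (h : IsTensorState ρ₁ ρ₂ ρ) : IsReduced₂ ρ ρ₂ := by
  intro κ s hs b b'
  have h1 := (hasSum_inner_op ρ₁ hs).mul_right ⟪ket b', ρ₂.op (ket b)⟫_ℂ
  rw [one_mul] at h1
  exact h1.congr_fun fun k => h _ _ _ _

end Tensor

/-! ### Evolved product conditions -/

/-- The value at the product of two mixtures with weights `1 - s` and `s`, as a function of `s`. -/
def mixValue (x₀₀ x₁₀ x₀₁ x₁₁ s : ℝ) : ℝ :=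
  (1 - s) * ((1 - s) * x₀₀ + s * x₁₀) + s * ((1 - s) * x₀₁ + s * x₁₁)

/-- A polynomial identity in the weight `s` that holds for small `s` holds for `s = 1`. -/
theorem eq_mul_of_mixValue {x₀₀ x₁₀ x₀₁ x₁₁ y₀₀ y₁₀ y₀₁ y₁₁ z₀₀ z₁₀ z₀₁ z₁₁ ε : ℝ} (hε : 0 < ε)
    (h : ∀ s, 0 ≤ s → s < ε → mixValue z₀₀ z₁₀ z₀₁ z₁₁ s =
      mixValue x₀₀ x₁₀ x₀₁ x₁₁ s * mixValue y₀₀ y₁₀ y₀₁ y₁₁ s) : z₁₁ = x₁₁ * y₁₁ := by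
  let q : ℝ → ℝ → ℝ → ℝ → Polynomial ℝ := fun x₀₀ x₁₀ x₀₁ x₁₁ =>
    (1 - .X) * ((1 - .X) * .C x₀₀ + .X * .C x₁₀) + .X * ((1 - .X) * .C x₀₁ + .X * .C x₁₁)
  have hq : ∀ a b c d s, (q a b c d).eval s = mixValue a b c d s := fun a b c d s => by
    simp only [q, mixValue, Polynomial.eval_add, Polynomial.eval_mul, Polynomial.eval_sub,
      Polynomial.eval_one, Polynomial.eval_X, Polynomial.eval_C]
  have h0 : q z₀₀ z₁₀ z₀₁ z₁₁ - q x₀₀ x₁₀ x₀₁ x₁₁ * q y₀₀ y₁₀ y₀₁ y₁₁ = 0 := by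
    refine Polynomial.eq_zero_of_infinite_isRoot _ ((Set.Ico_infinite hε).mono fun s hs => ?_)
    change Polynomial.eval s _ = 0
    rw [Polynomial.eval_sub, Polynomial.eval_mul, hq, hq, hq, h s hs.1 hs.2, sub_self]
  have h1 := congrArg (Polynomial.eval 1) h0
  rw [Polynomial.eval_sub, Polynomial.eval_mul, hq, hq, hq, Polynomial.eval_zero] at h1
  simpa [mixValue, sub_eq_zero] using h1

section Product

variable {d₁ n₁ d₂ n₂ : ℕ} {ħ : ℝ}

theorem isAttribute_one {d n : ℕ} : IsAttribute ħ (1 : Op (Pos d) (Spin n)) :=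
  ⟨one_mem _, fun _ _ => rfl⟩

theorem IsLift₁.isTensorOp {A : Op (Pos d₁) (Spin n₁)} {C : Op (Pos₂ d₁ d₂) (Spin₂ n₁ n₂)}
    (h : IsLift₁ A C) : IsTensorOp A (1 : Op (Pos d₂) (Spin n₂)) C :=
  ⟨h.1, fun φ χ => by rw [tensor_eq_box, tensor_eq_box, h.2, one_apply_eq_self]⟩

theorem IsLift₂.isTensorOp {B : Op (Pos d₂) (Spin n₂)} {D : Op (Pos₂ d₁ d₂) (Spin₂ n₁ n₂)}
    (h : IsLift₂ B D) : IsTensorOp (1 : Op (Pos d₁) (Spin n₁)) B D :=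
  ⟨h.1, fun φ χ => by rw [tensor_eq_box, tensor_eq_box, h.2, one_apply_eq_self]⟩

theorem isTensorOp_comp {A : Op (Pos d₁) (Spin n₁)} {B : Op (Pos d₂) (Spin n₂)}
    {C D : Op (Pos₂ d₁ d₂) (Spin₂ n₁ n₂)} (hC : IsLift₁ A C) (hD : IsLift₂ B D) :
    IsTensorOp A B (C ∘L D) := by
  refine ⟨fun φ ψ => ?_, fun φ χ => ?_⟩
  · change ⟪ket (C (D φ)), ket ψ⟫_ℂ = ⟪ket φ, ket (C (D ψ))⟫_ℂ
    rw [hC.1, hD.1, comm_of_isLift hC hD]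
  · change C (D (tensor φ χ)) = _
    rw [tensor_eq_box, tensor_eq_box, hD.2, hC.2]

/-- In a product condition the values of attributes of the two particles multiply. The reduced
states are eliminated by means of the attribute `1`. -/
theorem IsProductCondition.expect_mul {W : Set (State (Pos₂ d₁ d₂) (Spin₂ n₁ n₂))}
    (hW : IsProductCondition ħ W) {ρ : State (Pos₂ d₁ d₂) (Spin₂ n₁ n₂)} (hρ : ρ ∈ W)
    {A : Op (Pos d₁) (Spin n₁)} {B : Op (Pos d₂) (Spin n₂)} (hA : IsAttribute ħ A)
    (hB : IsAttribute ħ B) {C D : Op (Pos₂ d₁ d₂) (Spin₂ n₁ n₂)} (hC : IsLift₁ A C)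
    (hD : IsLift₂ B D) :
    (ρ.expect (C ∘L D)).re = (ρ.expect C).re * (ρ.expect D).re := by
  obtain ⟨ρ₁, ρ₂, -, -, h⟩ := hW ⟨ρ, hρ⟩
  have h1 := h A B _ hA hB (isTensorOp_comp hC hD)
  have h2 := h A 1 _ hA isAttribute_one hC.isTensorOp
  have h3 := h 1 B _ isAttribute_one hB hD.isTensorOp
  simp only [qrValue, expect_one, Complex.one_re, mul_one, one_mul] at h1 h2 h3
  rw [h1, h2, h3]

theorem isTensorState_of_pure {a : 𝓢(Pos d₁, Spin n₁)} {b : 𝓢(Pos d₂, Spin n₂)}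
    {π₁ : State (Pos d₁) (Spin n₁)} {π₂ : State (Pos d₂) (Spin n₂)}
    {π : State (Pos₂ d₁ d₂) (Spin₂ n₁ n₂)} (h₁ : ∀ ξ, π₁.op ξ = ⟪ket a, ξ⟫_ℂ • ket a)
    (h₂ : ∀ ξ, π₂.op ξ = ⟪ket b, ξ⟫_ℂ • ket b)
    (h : ∀ ξ, π.op ξ = ⟪ket (box a b), ξ⟫_ℂ • ket (box a b)) : IsTensorState π₁ π₂ π := by
  intro x x' y y'
  rw [tensor_eq_box, tensor_eq_box, h, h₁, h₂, inner_smul_right, inner_smul_right,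
    inner_smul_right, inner_box, inner_box]
  exact mul_mul_mul_comm _ _ _ _

theorem inner_op_mix {d n : ℕ} {ρ π μ : State (Pos d) (Spin n)} {r s : ℂ}
    (h : μ.op = r • ρ.op + s • π.op) (η ξ : L2 (Pos d) (Spin n)) :
    ⟪η, μ.op ξ⟫_ℂ = r * ⟪η, ρ.op ξ⟫_ℂ + s * ⟪η, π.op ξ⟫_ℂ := by
  rw [h, add_apply, smul_apply, smul_apply, inner_add_right, inner_smul_right, inner_smul_right]

theorem inner_op_mix₂ {ρ π μ : State (Pos₂ d₁ d₂) (Spin₂ n₁ n₂)} {r s : ℂ}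
    (h : μ.op = r • ρ.op + s • π.op) (η ξ : L2 (Pos₂ d₁ d₂) (Spin₂ n₁ n₂)) :
    ⟪η, μ.op ξ⟫_ℂ = r * ⟪η, ρ.op ξ⟫_ℂ + s * ⟪η, π.op ξ⟫_ℂ := by
  rw [h, add_apply, smul_apply, smul_apply, inner_add_right, inner_smul_right, inner_smul_right]

/-- The tensor product of states is compatible with mixing. -/
theorem isTensorState_of_mix {ρ₁ π₁ μ₁ : State (Pos d₁) (Spin n₁)}
    {ρ₂ π₂ μ₂ : State (Pos d₂) (Spin n₂)}
    {τ₀₀ τ₁₀ τ₀₁ τ₁₁ σ₀ σ₁ σ : State (Pos₂ d₁ d₂) (Spin₂ n₁ n₂)}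
    (h₀₀ : IsTensorState ρ₁ ρ₂ τ₀₀) (h₁₀ : IsTensorState π₁ ρ₂ τ₁₀) (h₀₁ : IsTensorState ρ₁ π₂ τ₀₁)
    (h₁₁ : IsTensorState π₁ π₂ τ₁₁) {r s : ℂ} (hμ₁ : μ₁.op = r • ρ₁.op + s • π₁.op)
    (hμ₂ : μ₂.op = r • ρ₂.op + s • π₂.op) (hσ₀ : σ₀.op = r • τ₀₀.op + s • τ₁₀.op)
    (hσ₁ : σ₁.op = r • τ₀₁.op + s • τ₁₁.op) (hσ : σ.op = r • σ₀.op + s • σ₁.op) :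
    IsTensorState μ₁ μ₂ σ := by
  intro x x' y y'
  rw [inner_op_mix₂ hσ, inner_op_mix₂ hσ₀, inner_op_mix₂ hσ₁, inner_op_mix hμ₁, inner_op_mix hμ₂,
    h₀₀, h₁₀, h₀₁, h₁₁]
  generalize ⟪ket x', ρ₁.op (ket x)⟫_ℂ = a₀, ⟪ket x', π₁.op (ket x)⟫_ℂ = a₁,
    ⟪ket y', ρ₂.op (ket y)⟫_ℂ = b₀, ⟪ket y', π₂.op (ket y)⟫_ℂ = b₁
  ring

/-- Products of small mixtures stay in the prepared condition. -/
theorem exists_mem_tensorCondition {W₁ : Set (State (Pos d₁) (Spin n₁))}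
    {W₂ : Set (State (Pos d₂) (Spin n₂))} (hW₁ : IsOpen[stateTopology ħ d₁ n₁] W₁)
    (hW₂ : IsOpen[stateTopology ħ d₂ n₂] W₂) {ρ₁ π₁ : State (Pos d₁) (Spin n₁)}
    {ρ₂ π₂ : State (Pos d₂) (Spin n₂)} (hρ₁ : ρ₁ ∈ W₁) (hρ₂ : ρ₂ ∈ W₂)
    {τ₀₀ τ₁₀ τ₀₁ τ₁₁ : State (Pos₂ d₁ d₂) (Spin₂ n₁ n₂)}
    (h₀₀ : IsTensorState ρ₁ ρ₂ τ₀₀) (h₁₀ : IsTensorState π₁ ρ₂ τ₁₀) (h₀₁ : IsTensorState ρ₁ π₂ τ₀₁)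
    (h₁₁ : IsTensorState π₁ π₂ τ₁₁) :
    ∃ ε > 0, ∀ s, 0 ≤ s → s < ε → ∃ σ ∈ tensorCondition W₁ W₂, ∀ X, IsSymm X → (σ.expect X).re =
      mixValue (τ₀₀.expect X).re (τ₁₀.expect X).re (τ₀₁.expect X).re (τ₁₁.expect X).re s := by
  obtain ⟨ε₁, hε₁, hm₁⟩ := exists_mix_mem hW₁ hρ₁ π₁
  obtain ⟨ε₂, hε₂, hm₂⟩ := exists_mix_mem hW₂ hρ₂ π₂
  refine ⟨min 1 (min ε₁ ε₂), by positivity, fun s h0 hs => ?_⟩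
  have hs1 := (hs.trans_le (min_le_left _ _)).le
  obtain ⟨μ₁, hμ₁, -⟩ := exists_mix ρ₁ π₁ h0 hs1
  obtain ⟨μ₂, hμ₂, -⟩ := exists_mix ρ₂ π₂ h0 hs1
  obtain ⟨σ₀, hσ₀, e₀⟩ := exists_mix τ₀₀ τ₁₀ h0 hs1
  obtain ⟨σ₁, hσ₁, e₁⟩ := exists_mix τ₀₁ τ₁₁ h0 hs1
  obtain ⟨σ, hσ, e⟩ := exists_mix σ₀ σ₁ h0 hs1
  refine ⟨σ, ⟨μ₁, hm₁ s μ₁ h0 (hs.trans_le ((min_le_right _ _).trans (min_le_left _ _))) hμ₁,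
    μ₂, hm₂ s μ₂ h0 (hs.trans_le ((min_le_right _ _).trans (min_le_right _ _))) hμ₂,
    isTensorState_of_mix h₀₀ h₁₀ h₀₁ h₁₁ hμ₁ hμ₂ hσ₀ hσ₁ hσ⟩, fun X hX => ?_⟩
  rw [e X hX, e₀ X hX, e₁ X hX, mixValue]
  simp only [Complex.add_re, Complex.re_ofReal_mul]

variable {H : Op (Pos₂ d₁ d₂) (Spin₂ n₁ n₂)} (𝒰 : Evolution ħ H)

/-- Mixing the prepared states with the pure states `|a⟩⟨a|` and `|b⟩⟨b|` shows that the
expectations of attributes of the two particles multiply in the evolved vector of `a ⊗ b`. -/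
theorem re_inner_mul_of_isProductCondition {W₁ : Set (State (Pos d₁) (Spin n₁))}
    {W₂ : Set (State (Pos d₂) (Spin n₂))} (hW₁ : IsCondition ħ W₁) (hW₂ : IsCondition ħ W₂) {t : ℝ}
    (hW : IsProductCondition ħ (𝒰.evolve t '' tensorCondition W₁ W₂))
    {A : Op (Pos d₁) (Spin n₁)} {B : Op (Pos d₂) (Spin n₂)} (hA : IsAttribute ħ A)
    (hB : IsAttribute ħ B) {C D : Op (Pos₂ d₁ d₂) (Spin₂ n₁ n₂)} (hC : IsLift₁ A C)
    (hD : IsLift₂ B D) {a : 𝓢(Pos d₁, Spin n₁)} {b : 𝓢(Pos d₂, Spin n₂)} (ha : ‖ket a‖ = 1)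
    (hb : ‖ket b‖ = 1) :
    (⟪ket (box a b), ket (heisenberg 𝒰 t (C ∘L D) (box a b))⟫_ℂ).re =
      (⟪ket (box a b), ket (heisenberg 𝒰 t C (box a b))⟫_ℂ).re *
        (⟪ket (box a b), ket (heisenberg 𝒰 t D (box a b))⟫_ℂ).re := by
  obtain ⟨ρ₁, hρ₁⟩ := hW₁.2
  obtain ⟨ρ₂, hρ₂⟩ := hW₂.2
  obtain ⟨π₁, hπ₁, -⟩ := exists_pure ha
  obtain ⟨π₂, hπ₂, -⟩ := exists_pure hb
  obtain ⟨π, hπ, hπe⟩ := exists_pure (a := box a b) (by rw [norm_ket_box, ha, hb, one_mul])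
  obtain ⟨τ₀₀, h₀₀⟩ := exists_isTensorState ρ₁ ρ₂
  obtain ⟨τ₁₀, h₁₀⟩ := exists_isTensorState π₁ ρ₂
  obtain ⟨τ₀₁, h₀₁⟩ := exists_isTensorState ρ₁ π₂
  have h₁₁ := isTensorState_of_pure hπ₁ hπ₂ hπ
  obtain ⟨ε, hε, key⟩ := exists_mem_tensorCondition hW₁.1 hW₂.1 hρ₁ hρ₂ h₀₀ h₁₀ h₀₁ h₁₁
  have hCD := isTensorOp_comp hC hD
  have hval : ∀ X, IsSymm X → ∀ ρ : State (Pos₂ d₁ d₂) (Spin₂ n₁ n₂),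
      ((𝒰.evolve t ρ).expect X).re = (ρ.expect (heisenberg 𝒰 t X)).re := fun X hX ρ => by
    rw [expect_heisenberg 𝒰 t ρ hX]
  have h := eq_mul_of_mixValue hε fun s h0 hs => by
    obtain ⟨σ, hσ, hσe⟩ := key s h0 hs
    have h1 := hW.expect_mul (mem_image_of_mem _ hσ) hA hB hC hD
    rw [hval _ hCD.1, hval _ hC.1, hval _ hD.1, hσe _ (isSymm_heisenberg 𝒰 t hCD.1),
      hσe _ (isSymm_heisenberg 𝒰 t hC.1), hσe _ (isSymm_heisenberg 𝒰 t hD.1)] at h1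
    exact h1
  rwa [hπe _ (isSymm_heisenberg 𝒰 t hCD.1), hπe _ (isSymm_heisenberg 𝒰 t hC.1),
    hπe _ (isSymm_heisenberg 𝒰 t hD.1)] at h

theorem IsSymm.inner_eq_re {E F : Type} [NormedAddCommGroup E] [NormedSpace ℝ E]
    [FiniteDimensional ℝ E] [MeasureSpace E] [BorelSpace E]
    [(volume : Measure E).IsAddHaarMeasure] [NormedAddCommGroup F] [InnerProductSpace ℂ F]
    {A : Op E F} (hA : IsSymm A) (ψ : 𝓢(E, F)) :
    ⟪ket ψ, ket (A ψ)⟫_ℂ = ((⟪ket ψ, ket (A ψ)⟫_ℂ).re : ℂ) := by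
  refine (Complex.conj_eq_iff_re.1 ?_).symm
  rw [inner_conj_symm, hA]

theorem exists_norm_ket_eq_one {d n : ℕ} (ρ : State (Pos d) (Spin n)) :
    ∃ e : 𝓢(Pos d, Spin n), ‖ket e‖ = 1 := by
  obtain ⟨φ, hφ⟩ := ρ.exists_isMixture
  obtain ⟨i, hi⟩ : ∃ i, ket (φ i) ≠ 0 := by
    by_contra! h
    have h1 := hφ.trace_one
    simp only [h, norm_zero, ne_eq, OfNat.ofNat_ne_zero, not_false_eq_true, zero_pow] at h1
    exact zero_ne_one (hasSum_zero.unique h1)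
  exact ⟨(‖ket (φ i)‖ : ℂ)⁻¹ • φ i, by
    rw [map_smul, norm_smul, norm_inv, Complex.norm_real, norm_norm,
      inv_mul_cancel₀ (norm_ne_zero_iff.2 hi)]⟩

/-- If the pair is again in a product condition at time `t`, the evolution up to time `t` preserves
or swaps the exchange form, whatever the prepared conditions are. -/
theorem preserves_or_swaps_of_isProductCondition (hħ : ħ ≠ 0)
    {W₁ : Set (State (Pos d₁) (Spin n₁))} {W₂ : Set (State (Pos d₂) (Spin n₂))}
    (hW₁ : IsCondition ħ W₁) (hW₂ : IsCondition ħ W₂) {t : ℝ}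
    (hW : IsProductCondition ħ (𝒰.evolve t '' tensorCondition W₁ W₂)) :
    Preserves 𝒰 t ∨ Swaps 𝒰 t := by
  obtain ⟨e, he⟩ := exists_norm_ket_eq_one hW₁.2.some
  obtain ⟨e', he'⟩ := exists_norm_ket_eq_one hW₂.2.some
  refine preserves_or_swaps 𝒰 hħ t (fun A B hA hB C D hC hD a b => ?_) he he'
  -- The relation between expectations is homogeneous, so that unit vectors are enough.
  have hscale : ∀ {d n : ℕ} (a : 𝓢(Pos d, Spin n)), a = 0 ∨ ∃ (c : ℂ) (a₀ : 𝓢(Pos d, Spin n)),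
      ‖ket a₀‖ = 1 ∧ a = c • a₀ := by
    intro d n a
    by_cases h0 : ket a = 0
    · exact .inl (ket_injective (h0.trans (map_zero _).symm))
    · refine .inr ⟨(‖ket a‖ : ℂ), (‖ket a‖ : ℂ)⁻¹ • a, ?_, ?_⟩
      · rw [map_smul, norm_smul, norm_inv, Complex.norm_real, norm_norm,
          inv_mul_cancel₀ (norm_ne_zero_iff.2 h0)]
      · rw [smul_inv_smul₀ (by exact_mod_cast norm_ne_zero_iff.2 h0)]
  rcases hscale a with rfl | ⟨x, a, ha, rfl⟩
  · simp
  rcases hscale b with rfl | ⟨y, b, hb, rfl⟩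
  · simp
  have h := re_inner_mul_of_isProductCondition 𝒰 hW₁ hW₂ hW hA.isAttribute hB.isAttribute hC hD
    ha hb
  have hu : ⟪ket (box a b), ket (box a b)⟫_ℂ = 1 := by
    simp [inner_self_eq_norm_sq_to_K, norm_ket_box, ha, hb]
  have h' := congrArg (fun r : ℝ => (r : ℂ)) h
  simp only [Complex.ofReal_mul] at h'
  rw [← (isSymm_heisenberg 𝒰 t (isTensorOp_comp hC hD).1).inner_eq_re,
    ← (isSymm_heisenberg 𝒰 t hC.1).inner_eq_re, ← (isSymm_heisenberg 𝒰 t hD.1).inner_eq_re,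
    inner_heisenberg, inner_heisenberg, inner_heisenberg] at h'
  simp only [map_smul, LinearMap.smul_apply, inner_smul_left, inner_smul_right, hu]
  rw [ContinuousLinearMap.comp_apply] at h'
  rw [h']
  ring

end Product

/-! ### Evolutions that preserve the exchange form, and separable interactions -/

section Factor

variable {d₁ n₁ d₂ n₂ : ℕ} {ħ : ℝ} {H : Op (Pos₂ d₁ d₂) (Spin₂ n₁ n₂)} {𝒰 : Evolution ħ H}

/-- The matrix elements of the evolution between product vectors are of rank one: the factors of the
second particles may be exchanged. -/
theorem Preserves.inner_mul_inner {t : ℝ} (h : Preserves 𝒰 t) (a c x v : 𝓢(Pos d₁, Spin n₁))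
    (b d y v' : 𝓢(Pos d₂, Spin n₂)) :
    ⟪ket (box x y), ket (𝒰.smooth t (box a b))⟫_ℂ *
        ⟪ket (box v v'), ket (𝒰.smooth t (box c d))⟫_ℂ =
      ⟪ket (box x v'), ket (𝒰.smooth t (box a d))⟫_ℂ *
        ⟪ket (box v y), ket (𝒰.smooth t (box c b))⟫_ℂ := by
  have h1 := h (box a b) (box c d) (𝒰.smooth (-t) (box x v')) (𝒰.smooth (-t) (box v y))
  rw [evolvedExchForm, 𝒰.smooth_smooth_neg, 𝒰.smooth_smooth_neg, exchForm_right_box_box,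
    exchForm_box_box, ← 𝒰.inner_smooth_left, ← 𝒰.inner_smooth_left] at h1
  have h2 := congrArg (starRingEnd ℂ) h1
  rwa [map_mul, map_mul, inner_conj_symm, inner_conj_symm, inner_conj_symm, inner_conj_symm] at h2

theorem eq_box_of_inner {Ψ : 𝓢(Pos₂ d₁ d₂, Spin₂ n₁ n₂)} {f : 𝓢(Pos d₁, Spin n₁)}
    {g : 𝓢(Pos d₂, Spin n₂)}
    (h : ∀ x y, ⟪ket (box x y), ket Ψ⟫_ℂ = ⟪ket x, ket f⟫_ℂ * ⟪ket y, ket g⟫_ℂ) : Ψ = box f g :=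
  sub_eq_zero.1 <| eq_zero_of_inner_ket_box _ fun x y => by
    rw [map_sub, inner_sub_right, inner_box, h, sub_self]

/-- If the exchange form is preserved, the evolution takes product vectors to product vectors: the
factors of `U (a ⊗ b)` are partial matrix elements of `U (a ⊗ e')` and of `U (e ⊗ b)`. -/
theorem Preserves.exists_factor {t : ℝ} (h : Preserves 𝒰 t) {e : 𝓢(Pos d₁, Spin n₁)}
    {e' : 𝓢(Pos d₂, Spin n₂)} (he : ‖ket e‖ = 1) (he' : ‖ket e'‖ = 1) :
    ∃ (U₁ : Op (Pos d₁) (Spin n₁)) (U₂ : Op (Pos d₂) (Spin n₂)),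
      ∀ a b, 𝒰.smooth t (box a b) = box (U₁ a) (U₂ b) := by
  obtain ⟨v, v', hv⟩ := exists_inner_box_smooth_ne_zero 𝒰 t he he'
  obtain ⟨U₁, hU₁⟩ : ∃ U₁ : Op (Pos d₁) (Spin n₁), ∀ x a,
      ⟪ket x, ket (U₁ a)⟫_ℂ = ⟪ket (box x v'), ket (𝒰.smooth t (box a e'))⟫_ℂ :=
    ⟨contr v' ∘L 𝒰.smooth t ∘L boxRight e', fun x a => inner_contr x v' _⟩
  obtain ⟨U₂, hU₂⟩ : ∃ U₂ : Op (Pos d₂) (Spin n₂), ∀ y b,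
      ⟪ket y, ket (U₂ b)⟫_ℂ = ⟪ket (box v y), ket (𝒰.smooth t (box e b))⟫_ℂ :=
    ⟨contr₁ v ∘L 𝒰.smooth t ∘L boxLeft e, fun y b => by
      rw [ContinuousLinearMap.comp_apply, ContinuousLinearMap.comp_apply, boxLeft_apply,
        inner_contr₁]⟩
  generalize hk : ⟪ket (box v v'), ket (𝒰.smooth t (box e e'))⟫_ℂ = k at hv
  refine ⟨U₁, k⁻¹ • U₂, fun a b => eq_box_of_inner fun x y => ?_⟩
  rw [smul_apply, map_smul, inner_smul_right, hU₁, hU₂, mul_left_comm, ← h.inner_mul_inner, hk,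
    mul_comm _ k, inv_mul_cancel_left₀ hv]

/-- The factors may be taken to be isometries. -/
theorem Preserves.exists_isometric_factor {t : ℝ} (h : Preserves 𝒰 t) {e : 𝓢(Pos d₁, Spin n₁)}
    {e' : 𝓢(Pos d₂, Spin n₂)} (he : ‖ket e‖ = 1) (he' : ‖ket e'‖ = 1) :
    ∃ (U₁ : Op (Pos d₁) (Spin n₁)) (U₂ : Op (Pos d₂) (Spin n₂)),
      (∀ a, ‖ket (U₁ a)‖ = ‖ket a‖) ∧ (∀ b, ‖ket (U₂ b)‖ = ‖ket b‖) ∧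
      ∀ a b, 𝒰.smooth t (box a b) = box (U₁ a) (U₂ b) := by
  obtain ⟨U₁, U₂, hU⟩ := h.exists_factor he he'
  have hn : ∀ a b, ‖ket (U₁ a)‖ * ‖ket (U₂ b)‖ = ‖ket a‖ * ‖ket b‖ := fun a b => by
    rw [← norm_ket_box, ← hU, 𝒰.norm_ket_smooth, norm_ket_box]
  have h1 := hn e e'
  rw [he, he', mul_one] at h1
  have hm : ‖ket (U₂ e')‖ ≠ 0 := right_ne_zero_of_mul_eq_one h1
  have hm' : (‖ket (U₂ e')‖ : ℂ) ≠ 0 := by exact_mod_cast hm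
  refine ⟨(‖ket (U₂ e')‖ : ℂ) • U₁, (‖ket (U₂ e')‖ : ℂ)⁻¹ • U₂, fun a => ?_, fun b => ?_,
    fun a b => ?_⟩
  · rw [smul_apply, map_smul, norm_smul, Complex.norm_real, norm_norm, mul_comm, hn, he', mul_one]
  · rw [smul_apply, map_smul, norm_smul, norm_inv, Complex.norm_real, norm_norm,
      ← eq_inv_of_mul_eq_one_left h1, hn, he, one_mul]
  · rw [hU, smul_apply, smul_apply, map_smul, map_smul, LinearMap.smul_apply, smul_smul,
      inv_mul_cancel₀ hm', one_smul]

/-- The image of a state under an isometry of the domain. -/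
theorem IsMixture.exists_map {d n : ℕ} {φ : ℕ → 𝓢(Pos d, Spin n)} {ρ : State (Pos d) (Spin n)}
    (h : IsMixture φ ρ) {U : Op (Pos d) (Spin n)} (hU : ∀ a, ‖ket (U a)‖ = ‖ket a‖) :
    ∃ ρ' : State (Pos d) (Spin n), IsMixture (fun i => U (φ i)) ρ' :=
  exists_isMixture (fun p hp => h.summable (p.comp (U : 𝓢(Pos d, Spin n) →ₗ[ℂ] 𝓢(Pos d, Spin n)))
    (hp.comp U.continuous)) (by simpa only [hU] using h.trace_one)

/-- An evolution that preserves the exchange form takes product states to product states. -/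
theorem Preserves.exists_isTensorState_evolve {t : ℝ} (h : Preserves 𝒰 t)
    {ρ₁ : State (Pos d₁) (Spin n₁)} {ρ₂ : State (Pos d₂) (Spin n₂)}
    {ρ : State (Pos₂ d₁ d₂) (Spin₂ n₁ n₂)} (hρ : IsTensorState ρ₁ ρ₂ ρ) :
    ∃ σ₁ σ₂, IsTensorState σ₁ σ₂ (𝒰.evolve t ρ) := by
  obtain ⟨e, he⟩ := exists_norm_ket_eq_one ρ₁
  obtain ⟨e', he'⟩ := exists_norm_ket_eq_one ρ₂
  obtain ⟨U₁, U₂, h₁, h₂, hU⟩ := h.exists_isometric_factor he he'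
  obtain ⟨φ, hφ⟩ := ρ₁.exists_isMixture
  obtain ⟨χ, hχ⟩ := ρ₂.exists_isMixture
  obtain ⟨σ₁, hσ₁⟩ := hφ.exists_map h₁
  obtain ⟨σ₂, hσ₂⟩ := hχ.exists_map h₂
  refine ⟨σ₁, σ₂, hσ₁.isTensorState hσ₂ ?_⟩
  have := (hρ.isMixture hφ hχ).evolve 𝒰 t
  simpa only [hU] using this

theorem isProductCondition_of_isTensorState {W : Set (State (Pos₂ d₁ d₂) (Spin₂ n₁ n₂))}
    (h : ∀ ρ ∈ W, ∃ (ρ₁ : State (Pos d₁) (Spin n₁)) (ρ₂ : State (Pos d₂) (Spin n₂)),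
      IsTensorState ρ₁ ρ₂ ρ) : IsProductCondition ħ W := by
  rintro ⟨ρ, hρ⟩
  obtain ⟨ρ₁, ρ₂, hT⟩ := h ρ hρ
  refine ⟨⟨ρ₁, ρ, hρ, hT.isReduced₁⟩, ⟨ρ₂, ρ, hρ, hT.isReduced₂⟩, hT.isReduced₁, hT.isReduced₂,
    fun A B C hA hB hC => ?_⟩
  simp only [qrValue]
  rw [hT.expect_mul hA.2 hB.2 hC, Complex.mul_re, expect_im ρ₁ hA.2, zero_mul, sub_zero]

variable {K₁ : Op (Pos d₁) (Spin n₁)} {K₂ : Op (Pos d₂) (Spin n₂)}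
  {K V : Op (Pos₂ d₁ d₂) (Spin₂ n₁ n₂)}

theorem IsSumOp.box {C : Op (Pos₂ d₁ d₂) (Spin₂ n₁ n₂)} (h : IsSumOp K₁ K₂ C)
    (a : 𝓢(Pos d₁, Spin n₁)) (b : 𝓢(Pos d₂, Spin n₂)) :
    C (QR.box a b) = QR.box (K₁ a) b + QR.box a (K₂ b) := by
  rw [← tensor_eq_box, h.2, tensor_eq_box, tensor_eq_box]

theorem IsSymm.add {C D : Op (Pos₂ d₁ d₂) (Spin₂ n₁ n₂)} (hC : IsSymm C) (hD : IsSymm D) :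
    IsSymm (C + D) := fun φ ψ => by
  rw [add_apply, add_apply, map_add, map_add, inner_add_left, inner_add_right, hC, hD]

theorem IsSymm.sub {d n : ℕ} {C D : Op (Pos d) (Spin n)} (hC : IsSymm C) (hD : IsSymm D) :
    IsSymm (C - D) := fun φ ψ => by
  rw [sub_apply, sub_apply, map_sub, map_sub, inner_sub_left, inner_sub_right, hC, hD]

theorem IsSeparable.preserves (hK : IsSumOp K₁ K₂ K) (hV : IsSeparable V)
    (𝒰 : Evolution ħ (K + V)) (t : ℝ) : Preserves 𝒰 t := by
  obtain ⟨V₁, V₂, -, -, hV⟩ := hV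
  exact evolvedExchForm_of_sumOp 𝒰 (hK.1.add hV.1) (K₁ + V₁) (K₂ + V₂) (fun a b => by
    rw [add_apply, hK.box, hV.box, Pi.add_apply, Pi.add_apply, map_add, map_add,
      LinearMap.add_apply]
    abel) t

/-- The free Hamiltonians are subtracted from the two parts of the total Hamiltonian. -/
theorem isSeparable_of_preserves (hħ : ħ ≠ 0) (hK₁ : IsSymm K₁) (hK₂ : IsSymm K₂)
    (hK : IsSumOp K₁ K₂ K) (hV : IsSymm V) (𝒰 : Evolution ħ (K + V)) (h : ∀ t, Preserves 𝒰 t)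
    {e : 𝓢(Pos d₁, Spin n₁)} {e' : 𝓢(Pos d₂, Spin n₂)} (he : ‖ket e‖ = 1) (he' : ‖ket e'‖ = 1) :
    IsSeparable V := by
  have hs : IsSymm (K + V) := hK.1.add hV
  have hpres : ∀ t p q w z, evolvedExchForm 𝒰 t p q w z = exchForm p q w z :=
    fun t p q w z => h t p q w z
  obtain ⟨H₁, H₂, s₁, s₂, hH⟩ := exists_sum_of_evolvedExchForm 𝒰 hħ hs hpres he he'
  refine ⟨H₁ - K₁, H₂ - K₂, s₁.sub hK₁, s₂.sub hK₂, hV, fun a b => ?_⟩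
  have e1 : box (H₁ a - K₁ a) b = box (H₁ a) b - box (K₁ a) b := by
    rw [map_sub, LinearMap.sub_apply]
  have e2 : box a (H₂ b - K₂ b) = box a (H₂ b) - box a (K₂ b) := map_sub _ _ _
  have h1 := hH a b
  rw [add_apply, hK.box] at h1
  rw [tensor_eq_box, tensor_eq_box, tensor_eq_box, sub_apply, sub_apply, e1, e2,
    sub_add_sub_comm, ← h1, add_sub_cancel_left]

end Factor

end QR

end

theorem mainTheorem7 (ħ : ℝ) (hħ : 0 < ħ) {d₁ n₁ d₂ n₂ : ℕ}
    (K₁ : QR.Op (QR.Pos d₁) (QR.Spin n₁)) (K₂ : QR.Op (QR.Pos d₂) (QR.Spin n₂))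
    (K V : QR.Op (QR.Pos₂ d₁ d₂) (QR.Spin₂ n₁ n₂))
    (hK₁ : QR.IsSymm K₁) (hK₂ : QR.IsSymm K₂) (hK : QR.IsSumOp K₁ K₂ K) (hV : QR.IsSymm V)
    (𝒰 : QR.Evolution ħ (K + V)) :
    (QR.IsSeparable V →
      ∀ W₁ W₂, QR.IsCondition ħ W₁ → QR.IsCondition ħ W₂ → ∀ t : ℝ,
        QR.IsProductCondition ħ (𝒰.evolve t '' QR.tensorCondition W₁ W₂)) ∧
    (¬ QR.IsSeparable V →
      ∃ p : ℝ, 0 < p ∧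
        ∀ W₁ W₂, QR.IsCondition ħ W₁ → QR.IsCondition ħ W₂ → ∀ t : ℝ, (∀ k : ℤ, t ≠ k * p) →
          QR.IsEntangled ħ (𝒰.evolve t '' QR.tensorCondition W₁ W₂)) := by
  refine ⟨fun hsep W₁ W₂ _ _ t => ?_, fun hsep => ?_⟩
  · refine QR.isProductCondition_of_isTensorState ?_
    rintro _ ⟨ρ, ⟨ρ₁, -, ρ₂, -, hρ⟩, rfl⟩
    exact (hsep.preserves hK 𝒰 t).exists_isTensorState_evolve hρ
  · by_cases hpres : ∀ t, QR.Preserves 𝒰 t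
    · -- The two Hilbert spaces cannot both be nontrivial, so that there are no pairs of conditions.
      refine ⟨1, one_pos, fun W₁ W₂ hW₁ hW₂ => (hsep ?_).elim⟩
      obtain ⟨e, he⟩ := QR.exists_norm_ket_eq_one hW₁.2.some
      obtain ⟨e', he'⟩ := QR.exists_norm_ket_eq_one hW₂.2.some
      exact QR.isSeparable_of_preserves hħ.ne' hK₁ hK₂ hK hV 𝒰 hpres he he'
    · obtain ⟨p, hp, h⟩ := QR.exists_period hpres
      refine ⟨p, hp, fun W₁ W₂ hW₁ hW₂ t ht hprod => ?_⟩
      obtain ⟨k, hk⟩ := h t (QR.preserves_or_swaps_of_isProductCondition 𝒰 hħ.ne' hW₁ hW₂ hprod)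
      exact ht k hk
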